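/- Let $k\ge 0$ and $n\ge 2k$ be integers. A $k$-diagram is a set partition of $\{1,\dots,k,1',\dots,k'\}$ (unprimed vertices in the top row, primed vertices in the bottom row). Let $\mathbf P_k(n)$ be the partition algebra over $\mathbb C$: it has the $k$-diagrams as a basis and product $d_1d_2=n^{\ell(d_1,d_2)}\,d_1\circ d_2$, where $d_1\circ d_2$ is concatenation ($d_1$ above $d_2$) and $\ell(d_1,d_2)$ is the number of connected components removed from the middle row. Let $\mathbf A_k\subseteq\mathbf P_k(n)$ be one of the following algebras, spanned by the set $\mathcal A_k$ of $k$-diagrams indicated: the partition algebra $\mathbf P_k(n)$ (all diagrams); the Brauer algebra $\mathbf B_k(n)$ (all blocks of size $2$); the rook-Brauer algebra $\mathbf{RB}_k(n)$ (all blocks of size $1$ or $2$); the rook monoid algebra $\mathbf R_k$ (each block has at most one vertex in each row); or the Temperley-Lieb algebra $\mathbf{TL}_k(n)$, the Motzkin algebra $\mathbf M_k(n)$, the planar rook monoid algebra $\mathbf{PR}_k$, spanned by the planar diagrams in $\mathbf B_k(n)$, $\mathbf{RB}_k(n)$, $\mathbf R_k$ respectively. The last three are called the planar families. For $\lambda\vdash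 n$ let $\lambda^*$ be $\lambda$ with its first (largest) part removed. The index set $\Lambda_n^{\mathbf A_k}$ consists of the $\lambda\vdash n$ with $m=|\lambda^*|\le k$ such that, in addition, $k-m$ is even if $\mathbf A_k$ is $\mathbf B_k(n)$ or $\mathbf{TL}_k(n)$, and $\lambda^*=[m]$ if $\mathbf A_k$ is planar. The rank of a diagram is the number of its propagating blocks, i.e. of blocks meeting both rows, and $\mathbf J_{m-1}\subseteq\mathbf A_k$ is the span of the diagrams in $\mathcal A_k$ of rank less than $m$. For $\mu\vdash m$ let $p_\mu=\sum_{\gamma}\sum_{\rho}\operatorname{sign}(\gamma)\,\gamma\rho$ be the Young symmetrizer, where $\gamma$ and $\rho$ run over the column group and the row group of the column-reading tableau of shape $\mu$; $\mathsf S_m^{\mu}=(\mathbb C\mathsf S_m)p_\mu$ is the corresponding irreducible $\mathsf S_m$-module and $\chi^\mu_{\mathsf S_m}$ its character. A permutation $\sigma$ of $\{1,\dots,m\}$, $m\le k$, is viewed as the $k$-diagram in which $j'$ is joined to $\sigma(j)$ for $j\le m$ and to $j$ for $j>m$. Let $\mathsf e_m$ be the idempotent that is a scalar multiple of the diagram with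 blocks $\{i,i'\}$ for $i\le m$ in which the remaining vertices are isolated, or, for $\mathbf B_k(n)$ and $\mathbf{TL}_k(n)$, are paired with their neighbours within each row, $\{m+1,m+2\},\{m+3,m+4\},\dots$ and likewise for primed vertices. Put $\mathsf e_\lambda=p_{\lambda^*}\mathsf e_m$ (and $\mathsf e_\lambda=\mathsf e_m$ if $\mathbf A_k$ is planar). The irreducible $\mathbf A_k$-module indexed by $\lambda\in\Lambda^{\mathbf A_k}_n$ with $|\lambda^*|=m$ is $(\mathbf A_k\mathsf e_\lambda)/\mathbf J_{m-1}$, that is, the image of $\mathbf A_k\mathsf e_\lambda$ in $\mathbf A_k/\mathbf J_{m-1}$; let $\chi^\lambda_{\mathbf A_k}$ be its character. For $\kappa=[\kappa_1\ge\dots\ge\kappa_\ell]\vdash k$ let $\gamma_\kappa\in\mathsf S_k$ be the juxtaposition $\gamma_{\kappa_1}\otimes\cdots\otimes\gamma_{\kappa_\ell}$ of the cycles $\gamma_r=(r,r-1,\dots,1)$, and similarly $\gamma_\mu\in\mathsf S_m$ for $\mu\vdash m$. Let $d^T$ be the reflection of $d$ that exchanges the two rows. A diagram $w$ is a symmetric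 $m$-diagram if $w=w^T$, it has rank $m$, and each propagating block contains, with each of its vertices, the mirror image of that vertex. Order the propagating blocks of a symmetric $m$-diagram by the maximal entries of their top parts. If $d\circ w\circ d^T$ again has rank $m$, the twist $\sigma_{d,w}\in\mathsf S_m$ is the permutation such that the $i$-th propagating block of $w$ is carried by $d$ to the $\sigma_{d,w}(i)$-th propagating block of $d\circ w\circ d^T$. Then for all $\lambda\in\Lambda_n^{\mathbf A_k}$ with $|\lambda^*|=m$ and all $\kappa\vdash k$ with $\gamma_\kappa\in\mathcal A_k$ (a condition that is automatic for the non-planar families and means $\kappa=[1^k]$ for the planar ones), $$\chi^\lambda_{\mathbf A_k}(\gamma_\kappa)=\sum_{\mu\vdash m}\mathsf F^{\mu,\kappa}_{\mathbf A_k}\,\chi^{\lambda^*}_{\mathsf S_m}(\gamma_\mu),$$ where $\mathsf F^{\mu,\kappa}_{\mathbf A_k}\in\mathbb Z_{\ge0}$ is the number of symmetric $m$-diagrams $w\in\mathcal A_k$ such that $\gamma_\kappa\circ w\circ\gamma_\kappa^T=w$ and $\sigma_{\gamma_\kappa,w}$ has cycle type $\mu$. -/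

import Mathlib

noncomputable section

namespace DiagAlg

/-! ### Set-partition diagrams -/

/-- A `k`-diagram: a set partition of `{1, …, k, 1', …, k'}`.
`Sum.inl i` is the top vertex `i + 1`, and `Sum.inr i` is the bottom vertex `(i + 1)'`. -/
abbrev Diagram (k : ℕ) : Type := Setoid (Fin k ⊕ Fin k)

/-- The vertices of two stacked diagrams: top row, (identified) middle row, bottom row. -/
abbrev Rows (k : ℕ) : Type := Fin k ⊕ (Fin k ⊕ Fin k)

/-- Vertices of the upper diagram in the stacked picture. -/
def upper {k : ℕ} : Fin k ⊕ Fin k → Rows k := Sum.map id Sum.inl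

/-- Vertices of the lower diagram in the stacked picture. -/
def lower {k : ℕ} : Fin k ⊕ Fin k → Rows k := Sum.inr

/-- The outer (top and bottom) vertices of the stacked picture. -/
def outer {k : ℕ} : Fin k ⊕ Fin k → Rows k := Sum.map id Sum.inr

/-- Connected components when `d₁` is placed above `d₂` and the middle rows are identified. -/
def stack {k : ℕ} (d₁ d₂ : Diagram k) : Setoid (Rows k) :=
  Relation.EqvGen.setoid fun x y =>
    (∃ a b, d₁ a b ∧ x = upper a ∧ y = upper b) ∨ (∃ a b, d₂ a b ∧ x = lower a ∧ y = lower b)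

/-- Concatenation `d₁ ∘ d₂`. -/
def comp {k : ℕ} (d₁ d₂ : Diagram k) : Diagram k := Setoid.comap outer (stack d₁ d₂)

/-- A connected component of the stacked picture that lies entirely in the middle row. -/
def IsInner {k : ℕ} (d₁ d₂ : Diagram k) (c : Quotient (stack d₁ d₂)) : Prop :=
  ∀ a : Fin k ⊕ Fin k, Quotient.mk (stack d₁ d₂) (outer a) ≠ c

/-- `ℓ(d₁, d₂)`: the number of components removed from the middle row in `d₁ ∘ d₂`. -/
def loops {k : ℕ} (d₁ d₂ : Diagram k) : ℕ :=
  Nat.card {c : Quotient (stack d₁ d₂) // IsInner d₁ d₂ c}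

/-- The identity diagram `{1,1' | ⋯ | k,k'}`. -/
def idDiagram (k : ℕ) : Diagram k := Setoid.ker (Sum.elim id id : Fin k ⊕ Fin k → Fin k)

/-- Reflection in the horizontal axis. -/
def transpose {k : ℕ} (d : Diagram k) : Diagram k := Setoid.comap Sum.swap d

/-- The rank `pn(d)`: the number of blocks that meet both rows. -/
def rank {k : ℕ} (d : Diagram k) : ℕ :=
  Set.ncard {c : Quotient d |
    (∃ i, Quotient.mk d (Sum.inl i) = c) ∧ ∃ j, Quotient.mk d (Sum.inr j) = c}

/-- The diagram of `σ ∈ S_m ⊆ S_k` (for `m ≤ k`): `j'` is joined to `σ(j)` for `j ≤ m`, and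
`j'` is joined to `j` for `j > m`. -/
def permDiagram (k : ℕ) {m : ℕ} (σ : Equiv.Perm (Fin m)) : Diagram k :=
  Setoid.ker (Sum.elim (fun i : Fin k => (i : ℕ))
    (fun j : Fin k => if h : (j : ℕ) < m then ((σ ⟨j, h⟩ : Fin m) : ℕ) else (j : ℕ)))

/-! ### Associativity of diagram multiplication

The number of ways to colour the middle row with two colours, compatibly with `d₁` and `d₂`, and
with a prescribed colouring of the outer rows, is `2 ^ ℓ(d₁, d₂)` or `0`. This represents diagrams
faithfully by matrices, which gives all the monoid identities. -/

open Classical in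
/-- The matrix of a diagram, indexed by two-colourings of the rows. -/
def mat {k : ℕ} (d : Diagram k) : Matrix (Fin k → Bool) (Fin k → Bool) ℕ :=
  fun f g => if d ≤ Setoid.ker (Sum.elim f g) then 1 else 0

theorem stack_le_ker_iff {k : ℕ} (d₁ d₂ : Diagram k) (F : Rows k → Bool) :
    stack d₁ d₂ ≤ Setoid.ker F ↔
      d₁ ≤ Setoid.ker (F ∘ upper) ∧ d₂ ≤ Setoid.ker (F ∘ lower) := by
  constructor
  · intro h
    exact ⟨fun {a b} hab => h (Relation.EqvGen.rel _ _ (Or.inl ⟨a, b, hab, rfl, rfl⟩)),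
      fun {a b} hab => h (Relation.EqvGen.rel _ _ (Or.inr ⟨a, b, hab, rfl, rfl⟩))⟩
  · rintro ⟨h1, h2⟩
    apply Setoid.eqvGen_le
    rintro x y (⟨a, b, hab, rfl, rfl⟩ | ⟨a, b, hab, rfl, rfl⟩)
    · exact h1 hab
    · exact h2 hab

theorem elim_comp_upper {k : ℕ} (f h g : Fin k → Bool) :
    (Sum.elim f (Sum.elim h g) : Rows k → Bool) ∘ upper = Sum.elim f h := by
  funext x; rcases x with x | x <;> rfl

theorem elim_comp_lower {k : ℕ} (f h g : Fin k → Bool) :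
    (Sum.elim f (Sum.elim h g) : Rows k → Bool) ∘ lower = Sum.elim h g := by
  funext x; rcases x with x | x <;> rfl

theorem elim_comp_outer {k : ℕ} (f h g : Fin k → Bool) :
    (Sum.elim f (Sum.elim h g) : Rows k → Bool) ∘ outer = Sum.elim f g := by
  funext x; rcases x with x | x <;> rfl

theorem card_mid {k : ℕ} (d₁ d₂ : Diagram k) (f g : Fin k → Bool)
    (hc : comp d₁ d₂ ≤ Setoid.ker (Sum.elim f g)) :
    Nat.card {h : Fin k → Bool //
      d₁ ≤ Setoid.ker (Sum.elim f h) ∧ d₂ ≤ Setoid.ker (Sum.elim h g)} = 2 ^ loops d₁ d₂ := by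
  classical
  let Q := Quotient (stack d₁ d₂)
  let p : Q → Prop := fun c => ¬ IsInner d₁ d₂ c
  have hp : ∀ c : {c : Q // p c}, ∃ a, Quotient.mk (stack d₁ d₂) (outer a) = c.1 := by
    rintro ⟨c, hcc⟩
    by_contra hne
    exact hcc fun a ha => hne ⟨a, ha⟩
  choose rep hrep using hp
  let x₀ : {c : Q // p c} → Bool := fun c => Sum.elim f g (rep c)
  have hout : ∀ F : Q → Bool, (F ∘ Subtype.val = x₀ ↔
      ∀ a, F (Quotient.mk (stack d₁ d₂) (outer a)) = Sum.elim f g a) := by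
    intro F
    constructor
    · intro hF a
      have hpa : p (Quotient.mk (stack d₁ d₂) (outer a)) := fun h => h a rfl
      have h1 := congrFun hF ⟨_, hpa⟩
      have h2 := hrep ⟨_, hpa⟩
      have h3 : comp d₁ d₂ (rep ⟨_, hpa⟩) a := Quotient.exact (s := stack d₁ d₂) h2
      exact h1.trans (hc h3)
    · intro hF
      funext c
      have := hF (rep c)
      rw [hrep c] at this
      exact this
  let e : {h : Fin k → Bool //
      d₁ ≤ Setoid.ker (Sum.elim f h) ∧ d₂ ≤ Setoid.ker (Sum.elim h g)} ≃
      {F : Q → Bool // F ∘ Subtype.val = x₀} :=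
    { toFun := fun h => ⟨fun c => Quotient.lift (Sum.elim f (Sum.elim h.1 g) : Rows k → Bool)
          (fun a b hab => ((stack_le_ker_iff d₁ d₂ _).2
            (by rw [elim_comp_upper, elim_comp_lower]; exact h.2)) hab) c, by
          rw [hout]
          intro a
          exact congrFun (elim_comp_outer f h.1 g) a⟩
      invFun := fun F => ⟨fun i => F.1 (Quotient.mk _ (Sum.inr (Sum.inl i))), by
          have hF := (hout F.1).1 F.2
          have key : (fun x => F.1 (Quotient.mk (stack d₁ d₂) x)) =
              (Sum.elim f (Sum.elim (fun i => F.1 (Quotient.mk _ (Sum.inr (Sum.inl i)))) g) :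
                Rows k → Bool) := by
            funext x
            rcases x with x | x | x
            · exact hF (Sum.inl x)
            · rfl
            · exact hF (Sum.inr x)
          have h2 := (stack_le_ker_iff d₁ d₂ (fun x => F.1 (Quotient.mk (stack d₁ d₂) x))).1
            (fun {a b} hab => congrArg F.1 (Quotient.sound hab))
          rw [key, elim_comp_upper, elim_comp_lower] at h2
          exact h2⟩
      left_inv := fun h => by
        apply Subtype.ext
        rfl
      right_inv := fun F => by
        apply Subtype.ext
        funext c
        have hF := (hout F.1).1 F.2
        induction c using Quotient.inductionOn with
        | h x =>
          rcases x with x | x | x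
          · exact (hF (Sum.inl x)).symm
          · rfl
          · exact (hF (Sum.inr x)).symm }
  rw [Nat.card_congr (e.trans (Equiv.subtypePreimage p x₀)), Nat.card_fun]
  have : Nat.card {a : Q // ¬ p a} = loops d₁ d₂ := by
    unfold loops
    exact Nat.card_congr (Equiv.subtypeEquivRight fun c => by simp [p])
  rw [this]
  simp

theorem mat_mul {k : ℕ} (d₁ d₂ : Diagram k) :
    mat d₁ * mat d₂ = 2 ^ loops d₁ d₂ • mat (comp d₁ d₂) := by
  classical
  ext f g
  have h1 : (mat d₁ * mat d₂) f g = Nat.card {h : Fin k → Bool //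
      d₁ ≤ Setoid.ker (Sum.elim f h) ∧ d₂ ≤ Setoid.ker (Sum.elim h g)} := by
    rw [Matrix.mul_apply, Nat.card_eq_fintype_card, Fintype.card_subtype, Finset.card_filter]
    refine Finset.sum_congr rfl fun h _ => ?_
    simp only [mat]
    split_ifs <;> simp_all
  rw [h1, Matrix.smul_apply]
  by_cases hc : comp d₁ d₂ ≤ Setoid.ker (Sum.elim f g)
  · rw [card_mid d₁ d₂ f g hc]
    simp [mat, hc]
  · have : IsEmpty {h : Fin k → Bool //
        d₁ ≤ Setoid.ker (Sum.elim f h) ∧ d₂ ≤ Setoid.ker (Sum.elim h g)} := by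
      constructor
      rintro ⟨h, h2⟩
      apply hc
      intro a b hab
      have h3 := (stack_le_ker_iff d₁ d₂ (Sum.elim f (Sum.elim h g))).2
        (by rw [elim_comp_upper, elim_comp_lower]; exact h2)
      have h4 := h3 hab
      rw [Setoid.ker_def] at h4 ⊢
      have h5 := congrFun (elim_comp_outer f h g)
      simp only [Function.comp_apply] at h5
      rw [h5, h5] at h4
      exact h4
    rw [Nat.card_of_isEmpty]
    simp [mat, hc]

theorem mat_smul_inj {k : ℕ} {x y : Diagram k} {a b : ℕ}
    (h : 2 ^ a • mat x = 2 ^ b • mat y) : x = y ∧ a = b := by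
  classical
  have hle : ∀ F : Fin k ⊕ Fin k → Bool, x ≤ Setoid.ker F ↔ y ≤ Setoid.ker F := by
    intro F
    have h1 := congrFun (congrFun h (F ∘ Sum.inl)) (F ∘ Sum.inr)
    simp only [Matrix.smul_apply, mat, Sum.elim_comp_inl_inr] at h1
    have hpa : (2 : ℕ) ^ a ≠ 0 := by positivity
    have hpb : (2 : ℕ) ^ b ≠ 0 := by positivity
    by_cases hx : x ≤ Setoid.ker F <;> by_cases hy : y ≤ Setoid.ker F <;>
      simp only [hx, hy, if_true, if_false, smul_eq_mul, mul_one, mul_zero] at h1 ⊢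
    · exact (hpa h1).elim
    · exact (hpb h1.symm).elim
  have hsub : ∀ u v : Diagram k, (∀ F : Fin k ⊕ Fin k → Bool,
      u ≤ Setoid.ker F → v ≤ Setoid.ker F) → v ≤ u := by
    intro u v huv s t hst
    have hu : u ≤ Setoid.ker (fun z => decide (u s z)) := by
      intro p q hpq
      rw [Setoid.ker_def]
      have : u s p ↔ u s q := ⟨fun h => u.trans h hpq, fun h => u.trans h (u.symm hpq)⟩
      simp [this]
    have := huv _ hu hst
    rw [Setoid.ker_def] at this
    have hss : u s s := u.refl s
    simpa [hss] using this
  refine ⟨le_antisymm (hsub y x fun F => (hle F).2) (hsub x y fun F => (hle F).1), ?_⟩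
  have h1 := congrFun (congrFun h (fun _ => true)) (fun _ => true)
  have hall : ∀ d : Diagram k, mat d (fun _ => true) (fun _ => true) = 1 := by
    intro d
    have : d ≤ Setoid.ker (Sum.elim (fun _ => true) (fun _ => true)) := by
      rintro (p | p) (q | q) _ <;> rfl
    exact if_pos this
  simp only [Matrix.smul_apply, hall, smul_eq_mul, mul_one] at h1
  exact Nat.pow_right_injective le_rfl h1

theorem mat_id (k : ℕ) : mat (idDiagram k) = 1 := by
  classical
  ext f g
  simp only [mat, Matrix.one_apply]
  congr 1
  apply propext
  constructor
  · intro h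
    funext i
    exact h (show idDiagram k (Sum.inl i) (Sum.inr i) from rfl)
  · rintro rfl a b hab
    have hab' : (Sum.elim id id a : Fin k) = Sum.elim id id b := hab
    rcases a with a | a <;> rcases b with b | b <;>
      exact congrArg f hab'

theorem comp_assoc_loops {k : ℕ} (a b c : Diagram k) :
    comp (comp a b) c = comp a (comp b c) ∧
      loops a b + loops (comp a b) c = loops b c + loops a (comp b c) := by
  apply mat_smul_inj
  have h := mul_assoc (mat a) (mat b) (mat c)
  rw [mat_mul, mat_mul, smul_mul_assoc, mul_smul_comm, mat_mul, mat_mul, smul_smul, smul_smul,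
    ← pow_add, ← pow_add] at h
  exact h

theorem id_comp_loops {k : ℕ} (d : Diagram k) :
    comp (idDiagram k) d = d ∧ loops (idDiagram k) d = 0 := by
  apply mat_smul_inj
  rw [← mat_mul, mat_id]
  simp

theorem comp_id_loops {k : ℕ} (d : Diagram k) :
    comp d (idDiagram k) = d ∧ loops d (idDiagram k) = 0 := by
  apply mat_smul_inj
  rw [← mat_mul, mat_id]
  simp

/-! ### The partition algebra -/

/-- The partition algebra `P_k(n)`: the complex vector space with basis the `k`-diagrams. -/
def PartitionAlgebra (k : ℕ) (_n : ℂ) : Type := Diagram k →₀ ℂ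

namespace PartitionAlgebra

variable {k : ℕ} {n : ℂ}

instance : AddCommGroup (PartitionAlgebra k n) := inferInstanceAs (AddCommGroup (Diagram k →₀ ℂ))

instance : Module ℂ (PartitionAlgebra k n) := inferInstanceAs (Module ℂ (Diagram k →₀ ℂ))

/-- The basis of diagrams. -/
def basis (k : ℕ) (n : ℂ) : Module.Basis (Diagram k) ℂ (PartitionAlgebra k n) :=
  Module.Basis.ofRepr (LinearEquiv.refl ℂ (Diagram k →₀ ℂ))

/-- The bilinear product with `d₁ d₂ = n ^ ℓ(d₁, d₂) (d₁ ∘ d₂)` on diagrams. -/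
def mulHom (k : ℕ) (n : ℂ) :
    PartitionAlgebra k n →ₗ[ℂ] PartitionAlgebra k n →ₗ[ℂ] PartitionAlgebra k n :=
  (basis k n).constr ℂ fun d₁ => (basis k n).constr ℂ fun d₂ =>
    n ^ loops d₁ d₂ • basis k n (comp d₁ d₂)

theorem mulHom_basis (d₁ d₂ : Diagram k) :
    mulHom k n (basis k n d₁) (basis k n d₂) = n ^ loops d₁ d₂ • basis k n (comp d₁ d₂) := by
  simp [mulHom, Module.Basis.constr_basis]

theorem eq_of_basis {f g : PartitionAlgebra k n →ₗ[ℂ] PartitionAlgebra k n}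
    (h : ∀ d, f (basis k n d) = g (basis k n d)) (x : PartitionAlgebra k n) : f x = g x := by
  rw [(basis k n).ext h]

theorem mulHom_assoc (x y z : PartitionAlgebra k n) :
    mulHom k n (mulHom k n x y) z = mulHom k n x (mulHom k n y z) := by
  refine eq_of_basis (f := (mulHom k n).flip z ∘ₗ (mulHom k n).flip y)
    (g := (mulHom k n).flip (mulHom k n y z)) (fun a => ?_) x
  refine eq_of_basis (f := (mulHom k n).flip z ∘ₗ mulHom k n (basis k n a))
    (g := mulHom k n (basis k n a) ∘ₗ (mulHom k n).flip z) (fun b => ?_) y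
  refine eq_of_basis (f := mulHom k n (mulHom k n (basis k n a) (basis k n b)))
    (g := mulHom k n (basis k n a) ∘ₗ mulHom k n (basis k n b)) (fun c => ?_) z
  obtain ⟨h1, h2⟩ := comp_assoc_loops a b c
  simp only [LinearMap.comp_apply, mulHom_basis, map_smul, LinearMap.smul_apply, smul_smul,
    ← pow_add]
  rw [h1, h2]

instance : Ring (PartitionAlgebra k n) :=
  { (inferInstance : AddCommGroup (PartitionAlgebra k n)) with
    mul := fun x y => mulHom k n x y
    one := basis k n (idDiagram k)
    left_distrib := fun x y z => map_add (mulHom k n x) y z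
    right_distrib := fun x y z => LinearMap.map_add₂ (mulHom k n) x y z
    zero_mul := fun x => LinearMap.map_zero₂ (mulHom k n) x
    mul_zero := fun x => map_zero (mulHom k n x)
    mul_assoc := mulHom_assoc
    one_mul := fun x => eq_of_basis (f := mulHom k n (basis k n (idDiagram k)))
      (g := LinearMap.id) (fun d => by
        simp [mulHom_basis, (id_comp_loops d).1, (id_comp_loops d).2]) x
    mul_one := fun x => eq_of_basis (f := (mulHom k n).flip (basis k n (idDiagram k)))
      (g := LinearMap.id) (fun d => by
        simp [mulHom_basis, (comp_id_loops d).1, (comp_id_loops d).2]) x }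

theorem mul_def (x y : PartitionAlgebra k n) : x * y = mulHom k n x y := rfl

theorem one_def : (1 : PartitionAlgebra k n) = basis k n (idDiagram k) := rfl

instance : Algebra ℂ (PartitionAlgebra k n) :=
  Algebra.ofModule (fun r x y => LinearMap.map_smul₂ (mulHom k n) r x y)
    (fun r x y => map_smul (mulHom k n x) r y)

/-- The defining multiplication rule. -/
theorem basis_mul_basis (d₁ d₂ : Diagram k) :
    basis k n d₁ * basis k n d₂ = n ^ loops d₁ d₂ • basis k n (comp d₁ d₂) :=
  mulHom_basis d₁ d₂

end PartitionAlgebra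

/-! ### The diagram subalgebras -/

/-- The partition, Brauer, rook-Brauer, rook monoid, Temperley-Lieb, Motzkin and planar rook monoid
algebras. -/
inductive Family : Type
  | partition
  | brauer
  | rookBrauer
  | rook
  | temperleyLieb
  | motzkin
  | planarRook

/-- Position of a vertex when going around the boundary of the rectangle:
`1, …, k` along the top, then `k', …, 1'` along the bottom. -/
def circ {k : ℕ} : Fin k ⊕ Fin k → ℕ :=
  Sum.elim (fun i => (i : ℕ)) (fun j => 2 * k - 1 - (j : ℕ))

/-- A set partition that can be drawn inside the rectangle without crossings. -/
def IsPlanar {k : ℕ} (d : Diagram k) : Prop :=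
  ∀ a b c e, circ a < circ b → circ b < circ c → circ c < circ e → d a c → d b e → d a b

/-- All blocks have size `2`. -/
def IsBrauer {k : ℕ} (d : Diagram k) : Prop := ∀ v, Set.ncard {w | d v w} = 2

/-- All blocks have size `1` or `2`. -/
def IsRookBrauer {k : ℕ} (d : Diagram k) : Prop :=
  ∀ v, Set.ncard {w | d v w} = 1 ∨ Set.ncard {w | d v w} = 2

/-- All blocks have at most one vertex in each row. -/
def IsRook {k : ℕ} (d : Diagram k) : Prop :=
  (∀ i j, d (Sum.inl i) (Sum.inl j) → i = j) ∧ (∀ i j, d (Sum.inr i) (Sum.inr j) → i = j)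

namespace Family

/-- The planar families. -/
def Planar : Family → Prop
  | temperleyLieb | motzkin | planarRook => True
  | _ => False

/-- The families in which every rank has the parity of `k`. -/
def Parity : Family → Prop
  | brauer | temperleyLieb => True
  | _ => False

/-- The diagram basis of `A_k`. -/
def diagrams (A : Family) (k : ℕ) : Set (Diagram k) :=
  match A with
  | partition => Set.univ
  | brauer => {d | IsBrauer d}
  | rookBrauer => {d | IsRookBrauer d}
  | rook => {d | IsRook d}
  | temperleyLieb => {d | IsBrauer d ∧ IsPlanar d}
  | motzkin => {d | IsRookBrauer d ∧ IsPlanar d}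
  | planarRook => {d | IsRook d ∧ IsPlanar d}

/-- The diagram algebra `A_k ⊆ P_k(n)`. As the set of diagrams is closed under concatenation and
contains the identity, the unital subalgebra that it generates is its linear span. -/
def algebra (A : Family) (k : ℕ) (n : ℂ) : Subalgebra ℂ (PartitionAlgebra k n) :=
  Algebra.adjoin ℂ (PartitionAlgebra.basis k n '' A.diagrams k)

/-- A basis diagram of `A_k` as an element of `A_k`. -/
def diag (A : Family) (k : ℕ) (n : ℂ) (d : Diagram k) (hd : d ∈ A.diagrams k) : A.algebra k n :=
  ⟨PartitionAlgebra.basis k n d, Algebra.subset_adjoin (Set.mem_image_of_mem _ hd)⟩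

end Family

/-! ### Characters and symmetric group modules -/

/-- The character of an `R`-module `M`, where `R` is a complex algebra. -/
def moduleChar (R M : Type*) [Ring R] [Algebra ℂ R] [AddCommGroup M] [Module ℂ M] [Module R M]
    [IsScalarTower ℂ R M] (a : R) : ℂ :=
  LinearMap.trace ℂ M (Algebra.lsmul ℂ ℂ M a)

/-- The parts of a partition in decreasing order. -/
def partsList {m : ℕ} (μ : m.Partition) : List ℕ := μ.parts.sort (· ≥ ·)

/-- The boxes (row, column) of the Young diagram of `μ`, listed down the columns from left to right.
Thus the entry `x + 1` of the column-reading tableau `t_c` is in the box with index `x`. -/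
def columnWord {m : ℕ} (μ : m.Partition) : List (ℕ × ℕ) :=
  (List.range m).flatMap fun j =>
    (List.range (μ.parts.countP (j < ·))).map fun i => (i, j)

/-- The box of `t_c` that contains the entry `x + 1`. -/
def boxOf {m : ℕ} (μ : m.Partition) (x : Fin m) : ℕ × ℕ := (columnWord μ).getD x (0, 0)

open Classical in
/-- The permutations that preserve each row of `t_c`. -/
def rowGroup {m : ℕ} (μ : m.Partition) : Finset (Equiv.Perm (Fin m)) :=
  Finset.univ.filter fun σ => ∀ x, (boxOf μ (σ x)).1 = (boxOf μ x).1

open Classical in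
/-- The permutations that preserve each column of `t_c`. -/
def columnGroup {m : ℕ} (μ : m.Partition) : Finset (Equiv.Perm (Fin m)) :=
  Finset.univ.filter fun σ => ∀ x, (boxOf μ (σ x)).2 = (boxOf μ x).2

/-- The Young symmetrizer `p_μ`: the sum of `sign(γ) f(γ ρ)` over `γ` in the column group and `ρ` in
the row group of `t_c`. Here `f` says how permutations are viewed as elements of `V`, which is either
the group algebra of `S_m` or the partition algebra. -/
def youngSymmetrizer {m : ℕ} (μ : m.Partition) {V : Type*} [AddCommGroup V] [Module ℂ V]
    (f : Equiv.Perm (Fin m) → V) : V :=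
  ∑ γ ∈ columnGroup μ, ∑ ρ ∈ rowGroup μ, ((Equiv.Perm.sign γ : ℤ) : ℂ) • f (γ * ρ)

/-- The irreducible module `S_m^μ = (ℂ S_m) p_μ`, a left ideal of the group algebra. -/
def spechtModule {m : ℕ} (μ : m.Partition) :
    Submodule (MonoidAlgebra ℂ (Equiv.Perm (Fin m))) (MonoidAlgebra ℂ (Equiv.Perm (Fin m))) :=
  Submodule.span _ {youngSymmetrizer μ fun σ => MonoidAlgebra.single σ 1}

/-- The irreducible character of `S_m` indexed by `μ`. -/
def symChar {m : ℕ} (μ : m.Partition) (σ : Equiv.Perm (Fin m)) : ℂ :=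
  moduleChar (MonoidAlgebra ℂ (Equiv.Perm (Fin m))) (spechtModule μ) (MonoidAlgebra.single σ 1)

/-- Juxtaposition of the cycles `γ_r = (r, r-1, …, 1)`, for `r` in a list. -/
def cycles : (L : List ℕ) → Equiv.Perm (Fin L.sum)
  | [] => 1
  | r :: L => (finSumFinEquiv.trans (finCongr List.sum_cons.symm)).permCongr
      (Equiv.Perm.sumCongr (finRotate r)⁻¹ (cycles L))

theorem partsList_sum {m : ℕ} (μ : m.Partition) : (partsList μ).sum = m := by
  rw [← Multiset.sum_coe, partsList, Multiset.sort_eq, μ.parts_sum]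

/-- The permutation `γ_κ = γ_{κ₁} ⊗ ⋯ ⊗ γ_{κ_ℓ}`. -/
def gamma {m : ℕ} (κ : m.Partition) : Equiv.Perm (Fin m) :=
  (finCongr (partsList_sum κ)).permCongr (cycles (partsList κ))

/-! ### The irreducible modules of the diagram algebras -/

/-- The parts of `λ*`: the parts of `λ` with one copy of the largest part removed. -/
def starParts {n : ℕ} (lam : n.Partition) : Multiset ℕ := lam.parts.erase lam.parts.sup

/-- `|λ*|`. -/
def starSize {n : ℕ} (lam : n.Partition) : ℕ := (starParts lam).sum

/-- `λ*`, the partition `λ` without its first part. -/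
def star {n : ℕ} (lam : n.Partition) : (starSize lam).Partition where
  parts := starParts lam
  parts_pos := fun h => lam.parts_pos (Multiset.mem_of_mem_erase h)
  parts_sum := rfl

namespace Family

/-- The index set `Λ_n^{A_k}`. -/
def index (A : Family) (k n : ℕ) : Set n.Partition :=
  {lam | starSize lam ≤ k ∧ (A.Parity → Even (k - starSize lam)) ∧
    (A.Planar → star lam = Nat.Partition.indiscrete (starSize lam))}

open Classical in
/-- The diagram underlying `e_m`: identity edges in the first `m` columns; the last `k - m` vertices
in each row are paired with their neighbours for the families with the parity condition and isolated
otherwise. -/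
def idemDiagram (A : Family) (k m : ℕ) : Diagram k :=
  let r : ℕ → ℕ := fun i => if A.Parity then (i - m) / 2 else i
  Setoid.ker (Sum.elim
    (fun i : Fin k => if (i : ℕ) < m then ((0 : ℕ), (i : ℕ)) else (1, r i))
    (fun j : Fin k => if (j : ℕ) < m then ((0 : ℕ), (j : ℕ)) else (2, r j)))

open Classical in
/-- The idempotent `e_m`. -/
def idem (A : Family) (k : ℕ) (n : ℂ) (m : ℕ) : PartitionAlgebra k n :=
  (n ^ (if A.Parity then (k - m) / 2 else k - m))⁻¹ •
    PartitionAlgebra.basis k n (A.idemDiagram k m)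

open Classical in
/-- `e_λ = p_{λ*} e_m`, as a function of `μ = λ* ⊢ m`. For the planar families the only subgroup of
`S_m` in `A_m` is trivial, and the factor `p_{λ*}` is `1`. -/
def primIdem (A : Family) (k : ℕ) (n : ℂ) {m : ℕ} (μ : m.Partition) : PartitionAlgebra k n :=
  if A.Planar then A.idem k n m
  else youngSymmetrizer μ (fun σ => PartitionAlgebra.basis k n (permDiagram k σ)) * A.idem k n m

/-- The ideal `J_{m-1}`, spanned by the diagrams in `A_k` of rank less than `m`. -/
def lowRank (A : Family) (k : ℕ) (n : ℂ) (m : ℕ) :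
    Submodule (A.algebra k n) (PartitionAlgebra k n) :=
  Submodule.span (A.algebra k n)
    (PartitionAlgebra.basis k n '' {d | d ∈ A.diagrams k ∧ rank d < m})

/-- The irreducible `A_k`-module `(A_k e_λ) / J_{m-1}` indexed by `λ`, where `μ = λ* ⊢ m`: the image
of the left ideal `A_k e_λ` in the quotient by `J_{m-1}`. -/
def irrModule (A : Family) (k : ℕ) (n : ℂ) {m : ℕ} (μ : m.Partition) :
    Submodule (A.algebra k n) (PartitionAlgebra k n ⧸ A.lowRank k n m) :=
  Submodule.map (A.lowRank k n m).mkQ (Submodule.span (A.algebra k n) {A.primIdem k n μ})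

/-- The irreducible character `χ^λ_{A_k}`. -/
def irrChar (A : Family) (k n : ℕ) (lam : n.Partition) (a : A.algebra k (n : ℂ)) : ℂ :=
  moduleChar (A.algebra k (n : ℂ)) (A.irrModule k (n : ℂ) (star lam)) a

end Family

/-! ### Symmetric diagrams, twists and fixed points -/

/-- A symmetric `m`-diagram: `d` is symmetric of rank `m`, and each propagating block is connected to
its mirror image. -/
def IsSymmetricDiagram {k : ℕ} (m : ℕ) (d : Diagram k) : Prop :=
  transpose d = d ∧ rank d = m ∧
    ∀ i, (∃ j, d (Sum.inl i) (Sum.inr j)) → d (Sum.inl i) (Sum.inr i)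

/-- `x` is the maximal top vertex of a propagating block of `d`. -/
def IsPropMax {k : ℕ} (d : Diagram k) (x : Fin k) : Prop :=
  (∃ j, d (Sum.inl x) (Sum.inr j)) ∧ ∀ y, d (Sum.inl x) (Sum.inl y) → y ≤ x

/-- `x` is the maximal top vertex of the propagating block number `i` of `d` (counted from `0`), in
max-entry order. -/
def IsNthPropMax {k : ℕ} (d : Diagram k) (i : ℕ) (x : Fin k) : Prop :=
  IsPropMax d x ∧ Set.ncard {y | IsPropMax d y ∧ y < x} = i

/-- The conjugate `d ∘ w ∘ dᵀ`. -/
def conj {k : ℕ} (d w : Diagram k) : Diagram k := comp (comp d w) (transpose d)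

/-- `σ` is the twist `σ_{d,w}`: in the stacked diagram `d` over `w`, propagating block number `i` of
`w` is connected to the top vertices of propagating block number `σ(i)` of `d ∘ w ∘ dᵀ`. -/
def IsTwist {k m : ℕ} (d w : Diagram k) (σ : Equiv.Perm (Fin m)) : Prop :=
  ∀ i : Fin m, ∃ x y : Fin k, IsNthPropMax w i x ∧ IsNthPropMax (conj d w) (σ i) y ∧
    stack d w (Sum.inl y) (Sum.inr (Sum.inl x))

/-- The permutation `σ` has cycle type `μ` (fixed points are parts equal to `1`). -/
def HasCycleType {m : ℕ} (σ : Equiv.Perm (Fin m)) (μ : m.Partition) : Prop :=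
  σ.partition.parts = μ.parts

namespace Family

/-- The fixed point set: symmetric `m`-diagrams in `A_k` that are fixed under conjugation by `γ_κ`
and whose twist has cycle type `μ`. -/
def fixedDiagrams (A : Family) {k m : ℕ} (μ : m.Partition) (κ : k.Partition) : Set (Diagram k) :=
  {w | w ∈ A.diagrams k ∧ IsSymmetricDiagram m w ∧ conj (permDiagram k (gamma κ)) w = w ∧
    ∃ σ : Equiv.Perm (Fin m), IsTwist (permDiagram k (gamma κ)) w σ ∧ HasCycleType σ μ}

/-- The coefficient `F^{μ,κ}_{A_k}`. -/
def coeff (A : Family) {k m : ℕ} (μ : m.Partition) (κ : k.Partition) : ℕ :=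
  (A.fixedDiagrams μ κ).ncard

end Family

end DiagAlg

end

/-! The module $(\mathbf A_k\mathsf e_\lambda)/\mathbf J_{m-1}$ is induced from $\mathsf
S_m^{\lambda^*}$, and a permutation acts on it by a block-monomial matrix; the formula is the trace
of that matrix.

For a symmetric $m$-diagram $w$ let $t_w$ have the top half of $w$ and the bottom half of $\mathsf
e_m$, with propagating blocks attached in max-entry order. A rank-$m$ diagram with the bottom half
of $\mathsf e_m$ equals $t_w\sigma$ for exactly one pair $(w,\sigma)$, where $w=d\circ d^T$
(`IsBot.exists_glue_eq`, `glue_injective`). Left multiplication by a diagram either lowers the rank,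
giving $0$ in the quotient, or preserves this bottom half (`IsBot.comp`). Hence the module is
$\bigoplus_w t_w\,\mathsf S_m^{\lambda^*}$ (`mem_map_span_iff`); independence is read off from
diagram coefficients (`Family.lowRank_le`, `Family.repr_halfBasis_mul`).

For a permutation $\gamma$ one has $\gamma t_w=t_{\gamma w\gamma^T}\,\sigma_{\gamma,w}$. Only fixed
$w$ contribute to the trace, each by $\chi^{\lambda^*}(\sigma_{\gamma,w})$
(`moduleChar_eq_sum_fixed`). Since characters are class functions, sorting the fixed $w$ by the
cycle type of the twist gives the coefficients $\mathsf F^{\mu,\kappa}$.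

In a planar family only $\sigma=1$ occurs. The same argument runs with the trivial group in place of
$\mathsf S_m$, and the result agrees with the formula because $\lambda^*=[m]$ has the trivial
character. `Family.moduleChar_irrModule` covers both cases through a group $G$ with an injection
into $\mathsf S_m$.

All of this needs each family to be closed under concatenation (`Family.comp_mem`). For blocks of
size at most two that is a degree count on components of the stacked picture, and planarity follows
from counting crossings modulo two. -/

namespace DiagAlg

/-! ### Stacked diagrams -/

section Stack

variable {k : ℕ}

/-- Universal property of the generated relation. To show that vertices are not connected, one
labels the three rows by a function constant on the blocks of both diagrams and takes `R` to be its
kernel. -/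
theorem stack_le_iff {d₁ d₂ : Diagram k} {R : Setoid (Rows k)} :
    stack d₁ d₂ ≤ R ↔
      (∀ a b, d₁ a b → R (upper a) (upper b)) ∧ ∀ a b, d₂ a b → R (lower a) (lower b) := by
  constructor
  · intro h
    exact ⟨fun a b hab => h (Relation.EqvGen.rel _ _ (Or.inl ⟨a, b, hab, rfl, rfl⟩)),
      fun a b hab => h (Relation.EqvGen.rel _ _ (Or.inr ⟨a, b, hab, rfl, rfl⟩))⟩
  · rintro ⟨h1, h2⟩
    apply Setoid.eqvGen_le
    rintro x y (⟨a, b, hab, rfl, rfl⟩ | ⟨a, b, hab, rfl, rfl⟩)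
    · exact h1 a b hab
    · exact h2 a b hab

theorem stack_upper {d₁ : Diagram k} (d₂ : Diagram k) {a b : Fin k ⊕ Fin k} (h : d₁ a b) :
    stack d₁ d₂ (upper a) (upper b) :=
  (stack_le_iff.1 le_rfl).1 a b h

theorem stack_lower (d₁ : Diagram k) {d₂ : Diagram k} {a b : Fin k ⊕ Fin k} (h : d₂ a b) :
    stack d₁ d₂ (lower a) (lower b) :=
  (stack_le_iff.1 le_rfl).2 a b h

theorem comp_apply {d₁ d₂ : Diagram k} {a b : Fin k ⊕ Fin k} :
    comp d₁ d₂ a b ↔ stack d₁ d₂ (outer a) (outer b) := Iff.rfl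

theorem transpose_apply {d : Diagram k} {a b : Fin k ⊕ Fin k} :
    transpose d a b ↔ d a.swap b.swap := Iff.rfl

/-- A block that lies in the bottom row of `d₂` is a component of the stacked picture. -/
theorem exists_of_stack_bottom {d₁ d₂ : Diagram k} {j : Fin k}
    (hj : ∀ x, ¬ d₂ (Sum.inl x) (Sum.inr j)) {y : Rows k}
    (h : stack d₁ d₂ (Sum.inr (Sum.inr j)) y) :
    ∃ v, y = Sum.inr (Sum.inr v) ∧ d₂ (Sum.inr v) (Sum.inr j) := by
  -- The label is the predicate of lying in the block of `j`; the upper diagram never sees it,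
  -- because this block has no vertex in the middle row.
  have hle : stack d₁ d₂ ≤
      Setoid.ker (fun x : Rows k => ∃ v, x = Sum.inr (Sum.inr v) ∧ d₂ (Sum.inr v) (Sum.inr j)) := by
    refine stack_le_iff.2 ⟨fun a b _ => ?_, fun a b hab => ?_⟩
    · rw [Setoid.ker_def]
      rcases a with a | a <;> rcases b with b | b <;> simp [upper]
    · rw [Setoid.ker_def, eq_iff_iff]
      have key : ∀ c, (∃ v, lower c = (Sum.inr (Sum.inr v) : Rows k) ∧ d₂ (Sum.inr v) (Sum.inr j)) ↔
          d₂ c (Sum.inr j) := by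
        rintro (c | c)
        · simp [lower, hj c]
        · simp [lower]
      rw [key, key]
      exact ⟨fun h => d₂.trans (d₂.symm hab) h, fun h => d₂.trans hab h⟩
  have := hle h
  rw [Setoid.ker_def, eq_iff_iff] at this
  exact this.1 ⟨j, rfl, d₂.refl _⟩

/-- A bottom vertex that is joined to the top row in `d₁ ∘ d₂` is joined to the top row in `d₂`. -/
theorem exists_lower_of_comp {d₁ d₂ : Diagram k} {i j : Fin k}
    (h : comp d₁ d₂ (Sum.inl i) (Sum.inr j)) : ∃ x, d₂ (Sum.inl x) (Sum.inr j) := by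
  by_contra hne
  push Not at hne
  obtain ⟨v, hv, -⟩ := exists_of_stack_bottom hne ((stack d₁ d₂).symm h)
  simp [outer] at hv

/-! ### Permutation diagrams -/

theorem permDiagram_apply (γ : Equiv.Perm (Fin k)) {a b : Fin k ⊕ Fin k} :
    permDiagram k γ a b ↔ Sum.elim id γ a = Sum.elim id γ b := by
  have key : ∀ c : Fin k ⊕ Fin k, (Sum.elim (fun i : Fin k => (i : ℕ))
      (fun j : Fin k => if h : (j : ℕ) < k then ((γ ⟨j, h⟩ : Fin k) : ℕ) else (j : ℕ)) c) =
      (Sum.elim id γ c : Fin k) := by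
    rintro (c | c)
    · rfl
    · simp
  unfold permDiagram
  rw [Setoid.ker_def, key, key, Fin.val_inj]

theorem permDiagram_one (k : ℕ) : permDiagram k (1 : Equiv.Perm (Fin k)) = idDiagram k := by
  ext a b
  rw [permDiagram_apply]
  rfl

theorem transpose_permDiagram (γ : Equiv.Perm (Fin k)) :
    transpose (permDiagram k γ) = permDiagram k γ⁻¹ := by
  ext a b
  rw [transpose_apply, permDiagram_apply, permDiagram_apply]
  rcases a with a | a <;> rcases b with b | b <;>
    simp [Equiv.eq_symm_apply, Equiv.symm_apply_eq]

/-- A permutation diagram consists of edges from the top vertex `x` to the middle vertex `γ⁻¹ x`;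
contracting them retracts the stacked picture onto `d`. -/
theorem stack_permDiagram_left (γ : Equiv.Perm (Fin k)) (d : Diagram k) :
    stack (permDiagram k γ) d = Setoid.comap (Sum.elim (Sum.inl ∘ γ.symm) id) d := by
  apply le_antisymm
  · refine stack_le_iff.2 ⟨fun a b hab => ?_, fun a b hab => ?_⟩
    · rw [permDiagram_apply] at hab
      rw [Setoid.comap_rel]
      have key : ∀ c : Fin k ⊕ Fin k, (Sum.elim (Sum.inl ∘ γ.symm) id (upper c) : Fin k ⊕ Fin k) =
          Sum.inl (γ.symm (Sum.elim id γ c)) := by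
        rintro (c | c) <;> simp [upper]
      rw [key, key, hab]
    · exact hab
  · have key : ∀ x : Rows k, stack (permDiagram k γ) d x
        (lower (Sum.elim (Sum.inl ∘ γ.symm) id x)) := by
      rintro (x | x)
      · exact stack_upper d (a := Sum.inl x) (b := Sum.inr (γ.symm x))
          ((permDiagram_apply γ).2 (by simp))
      · exact (stack _ _).refl _
    intro x y hxy
    exact (stack _ _).trans (key x) ((stack _ _).trans (stack_lower _ hxy)
      ((stack _ _).symm (key y)))

theorem stack_permDiagram_right (d : Diagram k) (γ : Equiv.Perm (Fin k)) :
    stack d (permDiagram k γ) =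
      Setoid.comap (Sum.elim Sum.inl (Sum.elim Sum.inr (Sum.inr ∘ γ))) d := by
  apply le_antisymm
  · refine stack_le_iff.2 ⟨fun a b hab => ?_, fun a b hab => ?_⟩
    · rcases a with a | a <;> rcases b with b | b <;> exact hab
    · rw [permDiagram_apply] at hab
      rw [Setoid.comap_rel]
      have key : ∀ c : Fin k ⊕ Fin k,
          (Sum.elim Sum.inl (Sum.elim Sum.inr (Sum.inr ∘ γ)) (lower c) : Fin k ⊕ Fin k) =
          Sum.inr (Sum.elim id γ c) := by
        rintro (c | c) <;> rfl
      rw [key, key, hab]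
  · have key : ∀ x : Rows k, stack d (permDiagram k γ) x
        (upper (Sum.elim Sum.inl (Sum.elim Sum.inr (Sum.inr ∘ γ)) x)) := by
      rintro (x | x | x)
      · exact (stack _ _).refl _
      · exact (stack _ _).refl _
      · exact stack_lower d (a := Sum.inr x) (b := Sum.inl (γ x))
          ((permDiagram_apply γ).2 (by simp))
    intro x y hxy
    exact (stack _ _).trans (key x) ((stack _ _).trans (stack_upper _ hxy)
      ((stack _ _).symm (key y)))

theorem comp_permDiagram_left (γ : Equiv.Perm (Fin k)) (d : Diagram k) :
    comp (permDiagram k γ) d = Setoid.comap (Sum.map γ.symm id) d := by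
  ext a b
  rw [comp_apply, stack_permDiagram_left]
  rcases a with a | a <;> rcases b with b | b <;> rfl

theorem comp_permDiagram_right (d : Diagram k) (γ : Equiv.Perm (Fin k)) :
    comp d (permDiagram k γ) = Setoid.comap (Sum.map id γ) d := by
  ext a b
  rw [comp_apply, stack_permDiagram_right]
  rcases a with a | a <;> rcases b with b | b <;> rfl

theorem conj_permDiagram (γ : Equiv.Perm (Fin k)) (d : Diagram k) :
    conj (permDiagram k γ) d = Setoid.comap (Sum.map γ.symm γ.symm) d := by
  unfold conj
  rw [transpose_permDiagram, comp_permDiagram_right, comp_permDiagram_left]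
  ext a b
  rcases a with a | a <;> rcases b with b | b <;> rfl

theorem loops_eq_zero {d₁ d₂ : Diagram k}
    (h : ∀ x : Fin k, ∃ a, stack d₁ d₂ (outer a) (Sum.inr (Sum.inl x))) : loops d₁ d₂ = 0 := by
  unfold loops
  have : IsEmpty {c : Quotient (stack d₁ d₂) // IsInner d₁ d₂ c} := by
    refine ⟨fun ⟨c, hc⟩ => ?_⟩
    induction c using Quotient.inductionOn with
    | h x =>
      rcases x with x | x | x
      · exact hc (Sum.inl x) rfl
      · obtain ⟨a, ha⟩ := h x
        exact hc a (Quotient.sound ha)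
      · exact hc (Sum.inr x) rfl
  exact Nat.card_of_isEmpty

theorem loops_permDiagram_left (γ : Equiv.Perm (Fin k)) (d : Diagram k) :
    loops (permDiagram k γ) d = 0 :=
  loops_eq_zero fun x => ⟨Sum.inl (γ x), stack_upper d (a := Sum.inl (γ x)) (b := Sum.inr x)
    ((permDiagram_apply γ).2 rfl)⟩

theorem loops_permDiagram_right (d : Diagram k) (γ : Equiv.Perm (Fin k)) :
    loops d (permDiagram k γ) = 0 :=
  loops_eq_zero fun x => ⟨Sum.inr (γ.symm x),
    stack_lower d (a := Sum.inr (γ.symm x)) (b := Sum.inl x)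
      ((permDiagram_apply γ).2 (by simp))⟩

/-- A permutation of `{1, …, m}` as a permutation of `{1, …, k}`. -/
noncomputable def extPerm {m k : ℕ} (h : m ≤ k) : Equiv.Perm (Fin m) →* Equiv.Perm (Fin k) :=
  Equiv.Perm.viaEmbeddingHom (Fin.castLEEmb h)

theorem extPerm_castLE {m k : ℕ} (h : m ≤ k) (σ : Equiv.Perm (Fin m)) (i : Fin m) :
    extPerm h σ (Fin.castLE h i) = Fin.castLE h (σ i) :=
  Equiv.Perm.viaEmbedding_apply σ (Fin.castLEEmb h) i

theorem extPerm_of_le {m k : ℕ} (h : m ≤ k) (σ : Equiv.Perm (Fin m)) {j : Fin k} (hj : m ≤ j) :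
    extPerm h σ j = j := by
  refine Equiv.Perm.viaEmbedding_apply_of_notMem σ (Fin.castLEEmb h) j ?_
  rintro ⟨i, rfl⟩
  exact absurd i.2 (not_lt.2 hj)

theorem permDiagram_extPerm {m k : ℕ} (h : m ≤ k) (σ : Equiv.Perm (Fin m)) :
    permDiagram k (extPerm h σ) = permDiagram k σ := by
  ext a b
  have key : ∀ c : Fin k ⊕ Fin k, (Sum.elim (fun i : Fin k => (i : ℕ))
      (fun j : Fin k => if h : (j : ℕ) < m then ((σ ⟨j, h⟩ : Fin m) : ℕ) else (j : ℕ)) c) =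
      (Sum.elim id (extPerm h σ) c : Fin k) := by
    rintro (c | c)
    · rfl
    · by_cases hc : (c : ℕ) < m
      · have := extPerm_castLE h σ ⟨c, hc⟩
        rw [show Fin.castLE h ⟨c, hc⟩ = c from rfl] at this
        simp [hc, this]
      · simp [hc, extPerm_of_le h σ (not_lt.1 hc)]
  rw [permDiagram_apply]
  unfold permDiagram
  rw [Setoid.ker_def, key, key, Fin.val_inj]

end Stack

/-! ### Rank and maximal entries of propagating blocks -/

section Rank

variable {k : ℕ}

/-- The top vertex `x` lies in a propagating block. -/
def IsProp (d : Diagram k) (x : Fin k) : Prop := ∃ j, d (Sum.inl x) (Sum.inr j)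

theorem IsProp.congr {d : Diagram k} {x y : Fin k} (h : d (Sum.inl x) (Sum.inl y))
    (hx : IsProp d x) : IsProp d y := by
  obtain ⟨j, hj⟩ := hx
  exact ⟨j, d.trans (d.symm h) hj⟩

theorem exists_propMax {d : Diagram k} {x : Fin k} (hx : IsProp d x) :
    ∃ y, IsPropMax d y ∧ d (Sum.inl x) (Sum.inl y) := by
  obtain ⟨y, hy, hmax⟩ := Set.exists_max_image {y | d (Sum.inl x) (Sum.inl y)} id (Set.toFinite _)
    ⟨x, d.refl _⟩
  exact ⟨y, ⟨hx.congr hy, fun z hz => hmax z (d.trans hy hz)⟩, hy⟩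

theorem IsPropMax.eq {d : Diagram k} {x y : Fin k} (hx : IsPropMax d x) (hy : IsPropMax d y)
    (h : d (Sum.inl x) (Sum.inl y)) : x = y :=
  le_antisymm (hy.2 x (d.symm h)) (hx.2 y h)

/-- Each propagating block has one maximal top vertex. Consequently the rank depends only on the top
half of the diagram and on which top vertices propagate. -/
theorem rank_eq_ncard_propMax (d : Diagram k) : rank d = Set.ncard {x | IsPropMax d x} := by
  have h : {c : Quotient d | (∃ i, Quotient.mk d (Sum.inl i) = c) ∧
      ∃ j, Quotient.mk d (Sum.inr j) = c} =
      (fun x => Quotient.mk d (Sum.inl x)) '' {x | IsPropMax d x} := by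
    ext c
    constructor
    · rintro ⟨⟨i, rfl⟩, j, hj⟩
      obtain ⟨y, hy, hiy⟩ := exists_propMax (d := d) ⟨j, d.symm (Quotient.exact hj)⟩
      exact ⟨y, hy, Quotient.sound (d.symm hiy)⟩
    · rintro ⟨x, ⟨⟨j, hj⟩, -⟩, rfl⟩
      exact ⟨⟨x, rfl⟩, j, Quotient.sound (d.symm hj)⟩
  unfold rank
  rw [h, Set.InjOn.ncard_image]
  intro x hx y hy hxy
  exact IsPropMax.eq hx hy (Quotient.exact hxy)

theorem isPropMax_congr {d d' : Diagram k}
    (h : ∀ x y, d (Sum.inl x) (Sum.inl y) ↔ d' (Sum.inl x) (Sum.inl y))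
    (hp : ∀ x, IsProp d x ↔ IsProp d' x) (x : Fin k) : IsPropMax d x ↔ IsPropMax d' x :=
  and_congr (hp x) (forall_congr' fun y => imp_congr_left (h x y))

theorem rank_congr {d d' : Diagram k}
    (h : ∀ x y, d (Sum.inl x) (Sum.inl y) ↔ d' (Sum.inl x) (Sum.inl y))
    (hp : ∀ x, IsProp d x ↔ IsProp d' x) : rank d = rank d' := by
  rw [rank_eq_ncard_propMax, rank_eq_ncard_propMax]
  congr 1
  ext x
  exact isPropMax_congr h hp x

theorem rank_comp_permDiagram_right (d : Diagram k) (γ : Equiv.Perm (Fin k)) :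
    rank (comp d (permDiagram k γ)) = rank d := by
  rw [comp_permDiagram_right]
  refine rank_congr (fun x y => Iff.rfl) fun x => ⟨?_, ?_⟩
  · rintro ⟨j, hj⟩
    exact ⟨γ j, hj⟩
  · rintro ⟨j, hj⟩
    refine ⟨γ.symm j, ?_⟩
    simpa [Setoid.comap_rel] using hj

theorem rank_comp_permDiagram_left (d : Diagram k) (γ : Equiv.Perm (Fin k)) :
    rank (comp (permDiagram k γ) d) = rank d := by
  rw [comp_permDiagram_left]
  let e : Fin k ⊕ Fin k ≃ Fin k ⊕ Fin k := Equiv.sumCongr γ.symm (Equiv.refl _)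
  let q : Quotient (Setoid.comap (Sum.map γ.symm id) d) ≃ Quotient d :=
    Quotient.congr e fun _ _ => Iff.rfl
  unfold rank
  rw [← Set.ncard_image_of_injective _ q.injective]
  congr 1
  ext c
  constructor
  · rintro ⟨c, ⟨⟨i, rfl⟩, j, hj⟩, rfl⟩
    refine ⟨⟨γ.symm i, rfl⟩, j, ?_⟩
    rw [← hj]
    rfl
  · rintro ⟨⟨i, rfl⟩, j, hj⟩
    refine ⟨q.symm (Quotient.mk d (Sum.inl i)), ⟨⟨γ i, ?_⟩, j, ?_⟩, by simp⟩
    · rw [Equiv.eq_symm_apply]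
      change Quotient.mk d (Sum.inl (γ.symm (γ i))) = _
      simp
    · rw [Equiv.eq_symm_apply, ← hj]
      rfl

/-- A propagating block of the composite contains a bottom vertex whose `d₂`-block propagates.
Stacking only merges blocks of `d₂`, so distinct blocks of the composite come from distinct blocks
of `d₂`. -/
theorem rank_comp_le (d₁ d₂ : Diagram k) : rank (comp d₁ d₂) ≤ rank d₂ := by
  classical
  unfold rank
  refine Set.ncard_le_ncard_of_injOn
    (fun c => if h : ∃ j, Quotient.mk (comp d₁ d₂) (Sum.inr j) = c then
      Quotient.mk d₂ (Sum.inr h.choose) else Quotient.mk d₂ c.out) ?_ ?_ (Set.toFinite _)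
  · rintro c ⟨⟨i, hi⟩, h⟩
    simp only [h, dif_pos]
    obtain ⟨x, hx⟩ := exists_lower_of_comp (d₁ := d₁) (d₂ := d₂) (i := i) (j := h.choose)
      (Quotient.exact (hi.trans h.choose_spec.symm))
    exact ⟨⟨x, Quotient.sound hx⟩, h.choose, rfl⟩
  · rintro c ⟨-, h⟩ c' ⟨-, h'⟩ hcc
    simp only [h, h', dif_pos] at hcc
    rw [← h.choose_spec, ← h'.choose_spec]
    exact Quotient.sound (stack_lower d₁ (Quotient.exact hcc))

/-! ### Symmetric diagrams as a record of the top half -/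

/-- The diagram `d ∘ dᵀ`: the top half of `d` and its mirror image, with each propagating block
joined to its mirror image. -/
noncomputable abbrev symDiagram (d : Diagram k) : Diagram k := comp d (transpose d)

/-- The picture of `d` over its reflection can be folded along the middle row onto `d`; folding
sends connected vertices into one block. -/
theorem symDiagram_le (d : Diagram k) :
    symDiagram d ≤ Setoid.ker (fun a => Quotient.mk d (Sum.inl (Sum.elim id id a))) := by
  have h : stack d (transpose d) ≤ Setoid.ker (Sum.elim (fun x => Quotient.mk d (Sum.inl x))
      (fun y => Quotient.mk d (Sum.swap y)) : Rows k → Quotient d) := by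
    refine stack_le_iff.2 ⟨fun a b hab => ?_, fun a b hab => Quotient.sound hab⟩
    rw [Setoid.ker_def]
    have := Quotient.sound (s := d) hab
    rcases a with a | a <;> rcases b with b | b <;> exact this
  intro a b hab
  have := h hab
  rcases a with a | a <;> rcases b with b | b <;> exact this

theorem symDiagram_inl_inl {d : Diagram k} {x y : Fin k} :
    symDiagram d (Sum.inl x) (Sum.inl y) ↔ d (Sum.inl x) (Sum.inl y) :=
  ⟨fun h => Quotient.exact (symDiagram_le d h), fun h => stack_upper _ h⟩

theorem symDiagram_inr_inr {d : Diagram k} {x y : Fin k} :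
    symDiagram d (Sum.inr x) (Sum.inr y) ↔ d (Sum.inl x) (Sum.inl y) :=
  ⟨fun h => Quotient.exact (symDiagram_le d h),
    fun h => stack_lower d (a := Sum.inr x) (b := Sum.inr y) h⟩

theorem symDiagram_inl_inr {d : Diagram k} {x y : Fin k} :
    symDiagram d (Sum.inl x) (Sum.inr y) ↔ d (Sum.inl x) (Sum.inl y) ∧ IsProp d y := by
  constructor
  · intro h
    refine ⟨Quotient.exact (symDiagram_le d h), ?_⟩
    obtain ⟨v, hv⟩ := exists_lower_of_comp h
    exact ⟨v, d.symm hv⟩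
  · rintro ⟨h, v, hv⟩
    exact (stack _ _).trans (stack_upper _ (d.trans h hv))
      (stack_lower d (a := Sum.inl v) (b := Sum.inr y) (d.symm hv))

theorem isProp_symDiagram {d : Diagram k} {x : Fin k} : IsProp (symDiagram d) x ↔ IsProp d x := by
  constructor
  · rintro ⟨j, hj⟩
    rw [symDiagram_inl_inr] at hj
    exact hj.2.congr (d.symm hj.1)
  · intro h
    exact ⟨x, symDiagram_inl_inr.2 ⟨d.refl _, h⟩⟩

theorem rank_symDiagram (d : Diagram k) : rank (symDiagram d) = rank d :=
  rank_congr (fun _ _ => symDiagram_inl_inl) fun _ => isProp_symDiagram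

theorem isSymmetricDiagram_symDiagram (d : Diagram k) :
    IsSymmetricDiagram (rank d) (symDiagram d) := by
  refine ⟨?_, rank_symDiagram d, fun i hi => ?_⟩
  · ext a b
    rw [transpose_apply]
    rcases a with a | a <;> rcases b with b | b
    · exact symDiagram_inr_inr.trans symDiagram_inl_inl.symm
    · refine (Setoid.comm' _).trans (symDiagram_inl_inr.trans (Iff.trans ?_
        symDiagram_inl_inr.symm))
      exact ⟨fun h => ⟨d.symm h.1, h.2.congr (d.symm h.1)⟩,
        fun h => ⟨d.symm h.1, h.2.congr (d.symm h.1)⟩⟩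
    · refine symDiagram_inl_inr.trans (Iff.trans ?_ (symDiagram_inl_inr.symm.trans
        (Setoid.comm' _)))
      exact ⟨fun h => ⟨d.symm h.1, h.2.congr (d.symm h.1)⟩,
        fun h => ⟨d.symm h.1, h.2.congr (d.symm h.1)⟩⟩
    · exact symDiagram_inl_inl.trans symDiagram_inr_inr.symm
  · exact symDiagram_inl_inr.2 ⟨d.refl _, isProp_symDiagram.1 hi⟩

theorem IsSymmetricDiagram.inr_inr {m : ℕ} {w : Diagram k} (hw : IsSymmetricDiagram m w)
    {x y : Fin k} : w (Sum.inr x) (Sum.inr y) ↔ w (Sum.inl x) (Sum.inl y) := by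
  conv_lhs => rw [← hw.1]
  rfl

theorem IsSymmetricDiagram.inl_inr {m : ℕ} {w : Diagram k} (hw : IsSymmetricDiagram m w)
    {x y : Fin k} : w (Sum.inl x) (Sum.inr y) ↔ w (Sum.inl x) (Sum.inl y) ∧ IsProp w y := by
  constructor
  · intro h
    have h2 : w (Sum.inr x) (Sum.inr y) := w.trans (w.symm (hw.2.2 x ⟨y, h⟩)) h
    have h3 := hw.inr_inr.1 h2
    exact ⟨h3, IsProp.congr h3 ⟨y, h⟩⟩
  · rintro ⟨h, hy⟩
    exact w.trans h (hw.2.2 y hy)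

/-- A symmetric diagram is determined by its top half. -/
theorem IsSymmetricDiagram.symDiagram_eq {m : ℕ} {w d : Diagram k} (hw : IsSymmetricDiagram m w)
    (h : ∀ x y, d (Sum.inl x) (Sum.inl y) ↔ w (Sum.inl x) (Sum.inl y))
    (hp : ∀ x, IsProp d x ↔ IsProp w x) : symDiagram d = w := by
  have key : ∀ x y, symDiagram d (Sum.inl x) (Sum.inr y) ↔ w (Sum.inl x) (Sum.inr y) := by
    intro x y
    rw [hw.inl_inr, symDiagram_inl_inr, h, hp]
  ext a b
  rcases a with a | a <;> rcases b with b | b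
  · rw [← h]
    exact symDiagram_inl_inl
  · exact key a b
  · exact (Setoid.comm' _).trans ((key b a).trans (Setoid.comm' _))
  · rw [hw.inr_inr, ← h]
    exact symDiagram_inr_inr

/-! ### Max-entry order of the propagating blocks -/

/-- The maximal top vertices of the propagating blocks of a diagram of rank `m`, in increasing
order. -/
noncomputable def propMax {m : ℕ} (d : Diagram k) (h : rank d = m) : Fin m ↪o Fin k :=
  (Set.toFinite {x | IsPropMax d x}).toFinset.orderEmbOfFin
    (by rw [← Set.ncard_eq_toFinset_card, ← rank_eq_ncard_propMax, h])

theorem isPropMax_propMax {m : ℕ} {d : Diagram k} (h : rank d = m) (i : Fin m) :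
    IsPropMax d (propMax d h i) := by
  have := Finset.orderEmbOfFin_mem (Set.toFinite {x | IsPropMax d x}).toFinset
    (by rw [← Set.ncard_eq_toFinset_card, ← rank_eq_ncard_propMax, h]) i
  exact (Set.Finite.mem_toFinset (Set.toFinite {x | IsPropMax d x})).1 this

theorem exists_propMax_eq {m : ℕ} {d : Diagram k} (h : rank d = m) {x : Fin k}
    (hx : IsPropMax d x) : ∃ i, propMax d h i = x := by
  have := Finset.range_orderEmbOfFin (Set.toFinite {x | IsPropMax d x}).toFinset
    (by rw [← Set.ncard_eq_toFinset_card, ← rank_eq_ncard_propMax, h])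
  have h2 : x ∈ Set.range (propMax d h) := by
    unfold propMax
    rw [this]
    simpa using hx
  exact h2

theorem exists_propMax_rel {m : ℕ} {d : Diagram k} (h : rank d = m) {x : Fin k}
    (hx : IsProp d x) : ∃ i, d (Sum.inl x) (Sum.inl (propMax d h i)) := by
  obtain ⟨y, hy, hxy⟩ := exists_propMax hx
  obtain ⟨i, rfl⟩ := exists_propMax_eq h hy
  exact ⟨i, hxy⟩

theorem propMax_rel_iff {m : ℕ} {d : Diagram k} (h : rank d = m) {i j : Fin m} :
    d (Sum.inl (propMax d h i)) (Sum.inl (propMax d h j)) ↔ i = j := by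
  constructor
  · intro hij
    exact (propMax d h).injective (IsPropMax.eq (isPropMax_propMax h i) (isPropMax_propMax h j) hij)
  · rintro rfl
    exact d.refl _

theorem isNthPropMax_iff {m : ℕ} {d : Diagram k} (h : rank d = m) {i : Fin m} {x : Fin k} :
    IsNthPropMax d i x ↔ x = propMax d h i := by
  have hcard : ∀ i : Fin m, Set.ncard {y | IsPropMax d y ∧ y < propMax d h i} = i := by
    intro i
    have : {y | IsPropMax d y ∧ y < propMax d h i} = propMax d h '' (Set.Iio i) := by
      ext y
      constructor
      · rintro ⟨hy, hlt⟩
        obtain ⟨j, rfl⟩ := exists_propMax_eq h hy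
        exact ⟨j, (propMax d h).lt_iff_lt.1 hlt, rfl⟩
      · rintro ⟨j, hj, rfl⟩
        exact ⟨isPropMax_propMax h j, (propMax d h).lt_iff_lt.2 hj⟩
    rw [this, Set.ncard_image_of_injective _ (propMax d h).injective, ← Finset.coe_Iio,
      Set.ncard_coe_finset, Fin.card_Iio]
  constructor
  · rintro ⟨hx, hi⟩
    obtain ⟨j, rfl⟩ := exists_propMax_eq h hx
    rw [hcard] at hi
    rw [Fin.ext hi]
  · rintro rfl
    exact ⟨isPropMax_propMax h i, hcard i⟩

end Rank

/-! ### Blocks of size at most two -/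

section Pairs

variable {k : ℕ}

/-- All blocks have at most two vertices. -/
def AtMostPairs (d : Diagram k) : Prop := ∀ a b c, d a b → d a c → a = b ∨ a = c ∨ b = c

theorem isRookBrauer_iff {d : Diagram k} : IsRookBrauer d ↔ AtMostPairs d := by
  constructor
  · intro h a b c hab hac
    by_contra hne
    push Not at hne
    have h3 : Set.ncard ({a, b, c} : Set (Fin k ⊕ Fin k)) ≤ Set.ncard {w | d a w} := by
      refine Set.ncard_le_ncard ?_ (Set.toFinite _)
      rintro x (rfl | rfl | rfl)
      exacts [d.refl _, hab, hac]
    rw [Set.ncard_eq_three.2 ⟨a, b, c, hne.1, hne.2.1, hne.2.2, rfl⟩] at h3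
    rcases h a with h | h <;> omega
  · intro h v
    by_cases hv : ∃ b, d v b ∧ v ≠ b
    · obtain ⟨b, hb, hne⟩ := hv
      right
      rw [Set.ncard_eq_two]
      refine ⟨v, b, hne, ?_⟩
      ext x
      constructor
      · intro hx
        rcases h v b x hb hx with h | h | h
        exacts [absurd h hne, Or.inl h.symm, Or.inr h.symm]
      · rintro (rfl | rfl)
        exacts [d.refl _, hb]
    · push Not at hv
      left
      rw [Set.ncard_eq_one]
      refine ⟨v, ?_⟩
      ext x
      constructor
      · intro hx
        exact (hv x hx).symm
      · rintro rfl
        exact d.refl _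

theorem isBrauer_iff {d : Diagram k} :
    IsBrauer d ↔ AtMostPairs d ∧ ∀ a, ∃ b, b ≠ a ∧ d a b := by
  constructor
  · intro h
    refine ⟨isRookBrauer_iff.1 fun v => Or.inr (h v), fun a => ?_⟩
    obtain ⟨x, hx, hne⟩ := Set.exists_ne_of_one_lt_ncard (s := {w | d a w}) (by rw [h a]; simp) a
    exact ⟨x, hne, hx⟩
  · rintro ⟨h, h2⟩ v
    obtain ⟨b, hne, hb⟩ := h2 v
    rcases isRookBrauer_iff.2 h v with h1 | h1
    · rw [Set.ncard_eq_one] at h1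
      obtain ⟨x, hx⟩ := h1
      have hv : v ∈ ({x} : Set _) := hx ▸ d.refl v
      have hb' : b ∈ ({x} : Set _) := hx ▸ hb
      exact absurd (hb'.trans hv.symm) hne
    · exact h1

open Classical in
/-- The other vertex of the block of `a`, if there is one. -/
noncomputable def partner (d : Diagram k) (a : Fin k ⊕ Fin k) : Fin k ⊕ Fin k :=
  if h : ∃ b, b ≠ a ∧ d a b then h.choose else a

theorem rel_partner (d : Diagram k) (a : Fin k ⊕ Fin k) : d a (partner d a) := by
  unfold partner
  split_ifs with h
  · exact h.choose_spec.2
  · exact d.refl _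

theorem AtMostPairs.partner_eq {d : Diagram k} (hd : AtMostPairs d) {a b : Fin k ⊕ Fin k}
    (hne : b ≠ a) (h : d a b) : partner d a = b := by
  have hp : partner d a ≠ a := by
    unfold partner
    rw [dif_pos ⟨b, hne, h⟩]
    exact (Exists.choose_spec (p := fun b => b ≠ a ∧ d a b) _).1
  rcases hd a _ b (rel_partner d a) h with h1 | h1 | h1
  exacts [absurd h1.symm hp, absurd h1.symm hne, h1]

theorem AtMostPairs.partner_partner {d : Diagram k} (hd : AtMostPairs d) (a : Fin k ⊕ Fin k) :
    partner d (partner d a) = a := by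
  by_cases h : partner d a = a
  · rw [h, h]
  · exact hd.partner_eq (fun h' => h h'.symm) (d.symm (rel_partner d a))

/-- The support of `c` is a union of two-element blocks on which `c` is constant, so the terms
cancel in pairs under `partner`. -/
theorem AtMostPairs.sum_eq_zero {d : Diagram k} (hd : AtMostPairs d) {c : Fin k ⊕ Fin k → ZMod 2}
    (hc : ∀ a b, d a b → c a = c b) (hne : ∀ a, c a ≠ 0 → ∃ b, b ≠ a ∧ d a b) :
    ∑ a, c a = 0 := by
  refine Finset.sum_involution (fun a _ => partner d a) (fun a _ => ?_) (fun a _ ha => ?_)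
    (fun a _ => Finset.mem_univ _) (fun a _ => hd.partner_partner a)
  · rw [← hc a _ (rel_partner d a)]
    exact CharTwo.add_self_eq_zero _
  · obtain ⟨b, hb, hab⟩ := hne a ha
    rw [hd.partner_eq hb hab]
    exact hb

/-! ### Crossing numbers modulo two -/

open Classical in
/-- The number modulo two of pairs of a vertex counted by `c` and a later vertex counted by `e`. -/
noncomputable def crossSum (c e : Fin k ⊕ Fin k → ZMod 2) : ZMod 2 :=
  ∑ a, c a * ∑ b, e b * if circ a < circ b then 1 else 0

theorem circ_injective : Function.Injective (circ : Fin k ⊕ Fin k → ℕ) := by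
  rintro (a | a) (b | b) h <;> simp only [circ, Sum.elim_inl, Sum.elim_inr] at h <;>
    have := a.2 <;> have := b.2 <;> first
      | (congr 1; apply Fin.ext; omega)
      | omega

/-- Of the four comparisons between two pairs of boundary points, an odd number hold exactly when
the pairs interlace. -/
theorem IsPlanar.not_cross {d : Diagram k} (hd : IsPlanar d) {a a' b b' : Fin k ⊕ Fin k}
    (ha : d a a') (hb : d b b') (hab : ¬ d a b) :
    ((if circ a < circ b then 1 else 0) + (if circ a' < circ b then 1 else 0) +
      ((if circ a < circ b' then 1 else 0) + if circ a' < circ b' then 1 else 0) : ZMod 2) = 0 := by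
  have hab' : ¬ d a b' := fun h => hab (d.trans h (d.symm hb))
  have ha'b : ¬ d a' b := fun h => hab (d.trans ha h)
  have ha'b' : ¬ d a' b' := fun h => hab' (d.trans ha h)
  have n1 : circ a ≠ circ b := fun h => hab (circ_injective h ▸ d.refl _)
  have n2 : circ a ≠ circ b' := fun h => hab' (circ_injective h ▸ d.refl _)
  have n3 : circ a' ≠ circ b := fun h => ha'b (circ_injective h ▸ d.refl _)
  have n4 : circ a' ≠ circ b' := fun h => ha'b' (circ_injective h ▸ d.refl _)
  -- These are the eight orders in which the pairs interlace; planarity excludes each one.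
  have p1 := hd a b a' b'
  have p2 := hd a b' a' b
  have p3 := hd a' b a b'
  have p4 := hd a' b' a b
  have p5 := hd b a b' a'
  have p6 := hd b a' b' a
  have p7 := hd b' a b a'
  have p8 := hd b' a' b a
  have s1 := d.symm ha
  have s2 := d.symm hb
  have t1 : ¬ d b a := fun h => hab (d.symm h)
  have t2 : ¬ d b a' := fun h => ha'b (d.symm h)
  have t3 : ¬ d b' a := fun h => hab' (d.symm h)
  have t4 : ¬ d b' a' := fun h => ha'b' (d.symm h)
  simp only [ha, hb, s1, s2, hab, hab', ha'b, ha'b', t1, t2, t3, t4, forall_const, imp_false,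
    not_lt] at p1 p2 p3 p4 p5 p6 p7 p8
  split_ifs <;> first | decide | (exfalso; omega)

/-- Grouping both summation variables by blocks turns the sum into a count of crossings between
pairs in the two supports, and each such count is even by `IsPlanar.not_cross`. Disjoint supports
guarantee that the two pairs are different blocks. -/
theorem IsPlanar.crossSum_eq_zero {d : Diagram k} (hd : IsPlanar d) (hp : AtMostPairs d)
    {c e : Fin k ⊕ Fin k → ZMod 2} (hc : ∀ a b, d a b → c a = c b)
    (hcne : ∀ a, c a ≠ 0 → ∃ b, b ≠ a ∧ d a b) (he : ∀ a b, d a b → e a = e b)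
    (hene : ∀ a, e a ≠ 0 → ∃ b, b ≠ a ∧ d a b) (hce : ∀ a, c a = 0 ∨ e a = 0) :
    crossSum c e = 0 := by
  classical
  unfold crossSum
  refine Finset.sum_involution (fun a _ => partner d a) (fun a _ => ?_) (fun a _ ha => ?_)
    (fun a _ => Finset.mem_univ _) (fun a _ => hp.partner_partner a)
  · rw [← hc a _ (rel_partner d a), ← mul_add, ← Finset.sum_add_distrib]
    by_cases hca : c a = 0
    · rw [hca, zero_mul]
    have hsum : ∑ b, (e b * (if circ a < circ b then 1 else 0) +
        e b * (if circ (partner d a) < circ b then 1 else 0)) = 0 := by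
      refine Finset.sum_involution (fun b _ => partner d b) (fun b _ => ?_) (fun b _ hb => ?_)
        (fun b _ => Finset.mem_univ _) (fun b _ => hp.partner_partner b)
      · rw [← he b _ (rel_partner d b), ← mul_add, ← mul_add, ← mul_add]
        by_cases heb : e b = 0
        · rw [heb, zero_mul]
        · rw [hd.not_cross (rel_partner d a) (rel_partner d b), mul_zero]
          intro hab
          rcases hce a with h | h
          · exact hca h
          · exact heb (he a b hab ▸ h)
      · have heb : e b ≠ 0 := by
          rintro h
          simp [h] at hb
        obtain ⟨b', hb', hbb'⟩ := hene b heb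
        rw [hp.partner_eq hb' hbb']
        exact hb'
    rw [hsum, mul_zero]
  · obtain ⟨b, hb, hab⟩ := hcne a (left_ne_zero_of_mul ha)
    rw [hp.partner_eq hb hab]
    exact hb

/-! ### Components of stacked matchings -/

/-- The graph on the three rows of two stacked diagrams in which each vertex is joined to the other
vertices of its blocks. -/
def stackGraph (d₁ d₂ : Diagram k) : SimpleGraph (Rows k) where
  Adj x y := x ≠ y ∧ ((∃ a b, d₁ a b ∧ x = upper a ∧ y = upper b) ∨
    ∃ a b, d₂ a b ∧ x = lower a ∧ y = lower b)
  symm.symm := by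
    rintro x y ⟨hne, ⟨a, b, h, hx, hy⟩ | ⟨a, b, h, hx, hy⟩⟩
    · exact ⟨hne.symm, Or.inl ⟨b, a, d₁.symm h, hy, hx⟩⟩
    · exact ⟨hne.symm, Or.inr ⟨b, a, d₂.symm h, hy, hx⟩⟩
  loopless.irrefl := fun x h => h.1 rfl

theorem stackGraph_reachable {d₁ d₂ : Diagram k} {x y : Rows k} :
    (stackGraph d₁ d₂).Reachable x y ↔ stack d₁ d₂ x y := by
  constructor
  · rintro ⟨p⟩
    induction p with
    | nil => exact (stack _ _).refl _
    | cons h _ ih => exact (stack _ _).trans (Relation.EqvGen.rel _ _ h.2) ih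
  · have h : stack d₁ d₂ ≤ (stackGraph d₁ d₂).reachableSetoid := by
      refine stack_le_iff.2 ⟨fun a b hab => ?_, fun a b hab => ?_⟩
      · by_cases hne : (upper a : Rows k) = upper b
        · rw [hne]
        · exact SimpleGraph.Adj.reachable ⟨hne, Or.inl ⟨a, b, hab, rfl, rfl⟩⟩
      · by_cases hne : (lower a : Rows k) = lower b
        · rw [hne]
        · exact SimpleGraph.Adj.reachable ⟨hne, Or.inr ⟨a, b, hab, rfl, rfl⟩⟩
    intro hxy
    exact h hxy

theorem upper_injective : Function.Injective (upper : Fin k ⊕ Fin k → Rows k) :=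
  Function.Injective.sumMap Function.injective_id Sum.inl_injective

theorem lower_injective : Function.Injective (lower : Fin k ⊕ Fin k → Rows k) := Sum.inr_injective

theorem outer_injective : Function.Injective (outer : Fin k ⊕ Fin k → Rows k) :=
  Function.Injective.sumMap Function.injective_id Sum.inr_injective

open Classical in
/-- The number of neighbours of `x` in the stacked picture of two matchings, counted in both
diagrams. -/
noncomputable def stackDegree (d₁ d₂ : Diagram k) (x : Rows k) : ℕ :=
  (if ∃ a b, b ≠ a ∧ d₁ a b ∧ x = upper a then 1 else 0) +
    if ∃ a b, b ≠ a ∧ d₂ a b ∧ x = lower a then 1 else 0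

/-- This is only an inequality: two middle vertices paired in both diagrams give a single edge of
the simple graph but count twice in `stackDegree`. -/
theorem card_neighbors_le {d₁ d₂ : Diagram k} (h₁ : AtMostPairs d₁) (h₂ : AtMostPairs d₂)
    (x : Rows k) : Set.ncard ((stackGraph d₁ d₂).neighborSet x) ≤ stackDegree d₁ d₂ x := by
  have hsub : (stackGraph d₁ d₂).neighborSet x ⊆
      {y | ∃ a b, b ≠ a ∧ d₁ a b ∧ x = upper a ∧ y = upper b} ∪
        {y | ∃ a b, b ≠ a ∧ d₂ a b ∧ x = lower a ∧ y = lower b} := by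
    rintro y ⟨hne, ⟨a, b, h, rfl, rfl⟩ | ⟨a, b, h, rfl, rfl⟩⟩
    · exact Or.inl ⟨a, b, fun h => hne (h ▸ rfl), h, rfl, rfl⟩
    · exact Or.inr ⟨a, b, fun h => hne (h ▸ rfl), h, rfl, rfl⟩
  refine (Set.ncard_le_ncard hsub (Set.toFinite _)).trans
    ((Set.ncard_union_le _ _).trans (add_le_add ?_ ?_))
  · split_ifs with h
    · rw [Set.ncard_le_one]
      rintro y ⟨a, b, hne, hab, rfl, rfl⟩ y' ⟨a', b', hne', hab', hx, rfl⟩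
      obtain rfl := upper_injective hx
      rcases h₁ a b b' hab hab' with h | h | h
      exacts [absurd h.symm hne, absurd h.symm hne', h ▸ rfl]
    · rw [Nat.le_zero, Set.ncard_eq_zero]
      ext y
      refine iff_of_false ?_ id
      rintro ⟨a, b, hne, hab, hx, -⟩
      exact h ⟨a, b, hne, hab, hx⟩
  · split_ifs with h
    · rw [Set.ncard_le_one]
      rintro y ⟨a, b, hne, hab, rfl, rfl⟩ y' ⟨a', b', hne', hab', hx, rfl⟩
      obtain rfl := lower_injective hx
      rcases h₂ a b b' hab hab' with h | h | h
      exacts [absurd h.symm hne, absurd h.symm hne', h ▸ rfl]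
    · rw [Nat.le_zero, Set.ncard_eq_zero]
      ext y
      refine iff_of_false ?_ id
      rintro ⟨a, b, hne, hab, hx, -⟩
      exact h ⟨a, b, hne, hab, hx⟩

-- A connected graph has at least one edge fewer than vertices; the handshake lemma turns this into
-- a bound on degrees.
open Classical in
theorem two_mul_card_le_sum_stackDegree {d₁ d₂ : Diagram k} (h₁ : AtMostPairs d₁)
    (h₂ : AtMostPairs d₂) (v : Rows k) :
    2 * (Finset.univ.filter fun x => stack d₁ d₂ v x).card ≤
      (∑ x ∈ Finset.univ.filter fun x => stack d₁ d₂ v x, stackDegree d₁ d₂ x) + 2 := by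
  set G := stackGraph d₁ d₂
  set C := G.connectedComponentMk v
  have hmem : ∀ x, x ∈ C.supp ↔ stack d₁ d₂ v x := by
    intro x
    rw [SimpleGraph.ConnectedComponent.mem_supp_iff, SimpleGraph.ConnectedComponent.eq,
      stackGraph_reachable]
    exact Setoid.comm' _
  have hconn := C.connected_toSimpleGraph.card_vert_le_card_edgeSet_add_one
  have hcard : Nat.card C = (Finset.univ.filter fun x => stack d₁ d₂ v x).card := by
    rw [Nat.card_eq_fintype_card]
    refine Fintype.card_of_subtype _ fun x => ?_
    rw [Finset.mem_filter_univ]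
    exact (hmem x).symm
  have hdeg := C.toSimpleGraph.sum_degrees_eq_twice_card_edges
  have hE : Nat.card C.toSimpleGraph.edgeSet = C.toSimpleGraph.edgeFinset.card := by
    rw [Nat.card_eq_fintype_card, ← SimpleGraph.edgeFinset_card]
  have hle : ∑ x : C, C.toSimpleGraph.degree x ≤ ∑ x : C, stackDegree d₁ d₂ x.1 := by
    refine Finset.sum_le_sum fun x _ => ?_
    refine le_trans ?_ (card_neighbors_le h₁ h₂ x.1)
    rw [← SimpleGraph.card_neighborSet_eq_degree, ← Nat.card_eq_fintype_card,
      Nat.card_coe_set_eq]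
    refine Set.ncard_le_ncard_of_injOn Subtype.val (fun y hy => hy)
      (Subtype.val_injective.injOn) (Set.toFinite _)
  have hsum : ∑ x : C, stackDegree d₁ d₂ x.1 =
      ∑ x ∈ Finset.univ.filter fun x => stack d₁ d₂ v x, stackDegree d₁ d₂ x := by
    symm
    refine Finset.sum_subtype _ (fun x => ?_) _
    rw [Finset.mem_filter_univ]
    exact (hmem x).symm
  rw [← hcard, ← hsum]
  omega

-- An outer vertex has degree at most one and a middle vertex at most two. As the component is
-- connected, its outer vertices and its missing degrees together number at most two: a component is
-- a path or a cycle.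
open Classical in
theorem sum_outer_le {d₁ d₂ : Diagram k} (h₁ : AtMostPairs d₁) (h₂ : AtMostPairs d₂) (v : Rows k) :
    (Finset.univ.filter fun a => stack d₁ d₂ v (outer a)).card +
      ∑ x ∈ Finset.univ.filter fun x => stack d₁ d₂ v x,
        ((if ∃ a, x = outer a then 1 else 2) - stackDegree d₁ d₂ x) ≤ 2 := by
  have h := two_mul_card_le_sum_stackDegree h₁ h₂ v
  set S := Finset.univ.filter fun x => stack d₁ d₂ v x
  have hle : ∀ x, stackDegree d₁ d₂ x ≤ if ∃ a, x = (outer a : Rows k) then 1 else 2 := by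
    rintro (x | x | x)
    · rw [if_pos ⟨Sum.inl x, rfl⟩]
      unfold stackDegree
      rw [if_neg (c := ∃ a b, b ≠ a ∧ d₂ a b ∧ Sum.inl x = lower a)
        (by rintro ⟨a, b, -, -, h⟩; cases h)]
      split_ifs <;> simp
    · unfold stackDegree
      rw [if_neg (c := ∃ a, Sum.inr (Sum.inl x) = (outer a : Rows k))
        (by rintro ⟨a | a, h⟩ <;> simp [outer] at h)]
      split_ifs <;> simp
    · rw [if_pos ⟨Sum.inr x, rfl⟩]
      unfold stackDegree
      rw [if_neg (c := ∃ a b, b ≠ a ∧ d₁ a b ∧ Sum.inr (Sum.inr x) = upper a)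
        (by rintro ⟨a | a, b, -, -, h⟩ <;> simp [upper] at h)]
      split_ifs <;> simp
  have houter : (Finset.univ.filter fun a => stack d₁ d₂ v (outer a)).card =
      ∑ x ∈ S, if ∃ a, x = (outer a : Rows k) then 1 else 0 := by
    rw [← Finset.card_filter, ← Finset.card_image_of_injective _ outer_injective]
    congr 1
    ext x
    simp only [Finset.mem_image, Finset.mem_filter, S]
    constructor
    · rintro ⟨a, ha, rfl⟩
      exact ⟨⟨Finset.mem_univ _, ha.2⟩, a, rfl⟩
    · rintro ⟨hx, a, rfl⟩
      exact ⟨a, ⟨Finset.mem_univ _, hx.2⟩, rfl⟩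
  -- At each vertex the outer indicator, the deficiency and the degree add up to two; `hle` makes
  -- the truncated subtraction exact.
  have hsum : ∑ x ∈ S, (if ∃ a, x = (outer a : Rows k) then 1 else 0) +
      ∑ x ∈ S, ((if ∃ a, x = outer a then 1 else 2) - stackDegree d₁ d₂ x) +
        ∑ x ∈ S, stackDegree d₁ d₂ x = 2 * S.card := by
    rw [← Finset.sum_add_distrib, ← Finset.sum_add_distrib, mul_comm, ← smul_eq_mul,
      ← Finset.sum_const]
    refine Finset.sum_congr rfl fun x _ => ?_
    have := hle x
    split_ifs at this ⊢ <;> omega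
  omega

theorem AtMostPairs.comp {d₁ d₂ : Diagram k} (h₁ : AtMostPairs d₁) (h₂ : AtMostPairs d₂) :
    AtMostPairs (comp d₁ d₂) := by
  classical
  intro a b c hab hac
  by_contra hne
  push Not at hne
  have h := sum_outer_le h₁ h₂ (outer a)
  have h3 : ({a, b, c} : Finset (Fin k ⊕ Fin k)).card ≤
      (Finset.univ.filter fun x => stack d₁ d₂ (outer a) (outer x)).card := by
    refine Finset.card_le_card fun x hx => ?_
    simp only [Finset.mem_insert, Finset.mem_singleton] at hx
    rw [Finset.mem_filter_univ]
    rcases hx with rfl | rfl | rfl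
    exacts [(stack _ _).refl _, hab, hac]
  rw [Finset.card_eq_three.2 ⟨a, b, c, hne.1, hne.2.1, hne.2.2, rfl⟩] at h3
  omega

/-- A component that joins two outer vertices consists of blocks of size two. -/
theorem AtMostPairs.exists_of_comp {d₁ d₂ : Diagram k} (h₁ : AtMostPairs d₁) (h₂ : AtMostPairs d₂)
    {a b : Fin k ⊕ Fin k} (hne : a ≠ b) (hab : DiagAlg.comp d₁ d₂ a b) :
    (∀ x, stack d₁ d₂ (outer a) (upper x) → ∃ y, y ≠ x ∧ d₁ x y) ∧
      ∀ x, stack d₁ d₂ (outer a) (lower x) → ∃ y, y ≠ x ∧ d₂ x y := by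
  classical
  have h := sum_outer_le h₁ h₂ (outer a)
  have h2 : ({a, b} : Finset (Fin k ⊕ Fin k)).card ≤
      (Finset.univ.filter fun x => stack d₁ d₂ (outer a) (outer x)).card := by
    refine Finset.card_le_card fun x hx => ?_
    simp only [Finset.mem_insert, Finset.mem_singleton] at hx
    rw [Finset.mem_filter_univ]
    rcases hx with rfl | rfl
    exacts [(stack _ _).refl _, hab]
  rw [Finset.card_pair hne] at h2
  -- Two outer vertices exhaust the bound, so no vertex of the component misses an edge.
  have h0 : ∑ x ∈ Finset.univ.filter fun x => stack d₁ d₂ (outer a) x,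
      ((if ∃ a, x = outer a then 1 else 2) - stackDegree d₁ d₂ x) = 0 := by omega
  rw [Finset.sum_eq_zero_iff] at h0
  constructor
  · intro x hx
    by_contra hno
    have hneg : ¬ ∃ a b, b ≠ a ∧ d₁ a b ∧ (upper x : Rows k) = upper a := by
      rintro ⟨a, b, hne, hab, hxa⟩
      obtain rfl := upper_injective hxa
      exact hno ⟨b, hne, hab⟩
    have := h0 (upper x) ((Finset.mem_filter_univ _).2 hx)
    unfold stackDegree at this
    rw [if_neg hneg] at this
    rcases x with x | x
    · rw [if_pos ⟨Sum.inl x, rfl⟩, if_neg (by rintro ⟨a, b, -, -, h⟩; cases h)] at this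
      omega
    · rw [if_neg (c := ∃ a, (upper (Sum.inr x) : Rows k) = outer a)
        (by rintro ⟨a | a, h⟩ <;> simp [outer, upper] at h)] at this
      split_ifs at this
  · intro x hx
    by_contra hno
    have hneg : ¬ ∃ a b, b ≠ a ∧ d₂ a b ∧ (lower x : Rows k) = lower a := by
      rintro ⟨a, b, hne, hab, hxa⟩
      obtain rfl := lower_injective hxa
      exact hno ⟨b, hne, hab⟩
    have := h0 (lower x) ((Finset.mem_filter_univ _).2 hx)
    unfold stackDegree at this
    rw [if_neg hneg] at this
    rcases x with x | x
    · rw [if_neg (c := ∃ a, (lower (Sum.inl x) : Rows k) = outer a)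
        (by rintro ⟨a | a, h⟩ <;> simp [outer, lower] at h)] at this
      split_ifs at this
    · rw [if_pos ⟨Sum.inr x, rfl⟩, if_neg (c := ∃ a b, b ≠ a ∧ d₁ a b ∧ lower (Sum.inr x) = upper a)
        (by rintro ⟨a | a, b, -, -, h⟩ <;> simp [lower, upper] at h)] at this
      omega

end Pairs

/-! ### The families are closed under concatenation and reflection -/

section Closure

variable {k : ℕ}

theorem IsBrauer.atMostPairs {d : Diagram k} (h : IsBrauer d) : AtMostPairs d := (isBrauer_iff.1 h).1

theorem IsRook.atMostPairs {d : Diagram k} (h : IsRook d) : AtMostPairs d := by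
  intro a b c hab hac
  have hbc := d.trans (d.symm hab) hac
  rcases a with a | a <;> rcases b with b | b <;> rcases c with c | c
  · exact Or.inl (congrArg _ (h.1 _ _ hab))
  · exact Or.inl (congrArg _ (h.1 _ _ hab))
  · exact Or.inr (Or.inl (congrArg _ (h.1 _ _ hac)))
  · exact Or.inr (Or.inr (congrArg _ (h.2 _ _ hbc)))
  · exact Or.inr (Or.inr (congrArg _ (h.1 _ _ hbc)))
  · exact Or.inr (Or.inl (congrArg _ (h.2 _ _ hac)))
  · exact Or.inl (congrArg _ (h.2 _ _ hab))
  · exact Or.inl (congrArg _ (h.2 _ _ hab))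

theorem stack_indicator_upper (d₁ d₂ : Diagram k) (v : Rows k) {a b : Fin k ⊕ Fin k}
    (h : d₁ a b) : stack d₁ d₂ v (upper a) ↔ stack d₁ d₂ v (upper b) :=
  ⟨fun h' => (stack _ _).trans h' (stack_upper _ h),
    fun h' => (stack _ _).trans h' ((stack _ _).symm (stack_upper _ h))⟩

theorem stack_indicator_lower (d₁ d₂ : Diagram k) (v : Rows k) {a b : Fin k ⊕ Fin k}
    (h : d₂ a b) : stack d₁ d₂ v (lower a) ↔ stack d₁ d₂ v (lower b) :=
  ⟨fun h' => (stack _ _).trans h' (stack_lower _ h),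
    fun h' => (stack _ _).trans h' ((stack _ _).symm (stack_lower _ h))⟩

open Classical in
/-- The indicator function of the component of `v` in the stacked picture. -/
noncomputable def compInd (d₁ d₂ : Diagram k) (v x : Rows k) : ZMod 2 :=
  if stack d₁ d₂ v x then 1 else 0

theorem compInd_congr {d₁ d₂ : Diagram k} {v x y : Rows k}
    (h : stack d₁ d₂ v x ↔ stack d₁ d₂ v y) : compInd d₁ d₂ v x = compInd d₁ d₂ v y := by
  classical exact if_congr h rfl rfl

theorem sum_compInd_upper {d₁ d₂ : Diagram k} (h : AtMostPairs d₁) {v : Rows k}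
    (hv : ∀ x, stack d₁ d₂ v (upper x) → ∃ y, y ≠ x ∧ d₁ x y) :
    ∑ a, compInd d₁ d₂ v (upper a) = 0 := by
  refine h.sum_eq_zero (fun a b hab => ?_) fun a ha => hv a ?_
  · unfold compInd
    rw [stack_indicator_upper d₁ d₂ v hab]
  · by_contra hneg
    exact ha (if_neg hneg)

theorem sum_compInd_lower {d₁ d₂ : Diagram k} (h : AtMostPairs d₂) {v : Rows k}
    (hv : ∀ x, stack d₁ d₂ v (lower x) → ∃ y, y ≠ x ∧ d₂ x y) :
    ∑ a, compInd d₁ d₂ v (lower a) = 0 := by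
  refine h.sum_eq_zero (fun a b hab => ?_) fun a ha => hv a ?_
  · unfold compInd
    rw [stack_indicator_lower d₁ d₂ v hab]
  · by_contra hneg
    exact ha (if_neg hneg)

/-- A component meets the vertices of each perfect matching in an even number. Adding the two
counts, the middle row cancels modulo two, so the component has an even number of outer vertices and
cannot end at a lone one. -/
theorem IsBrauer.comp {d₁ d₂ : Diagram k} (h₁ : IsBrauer d₁) (h₂ : IsBrauer d₂) :
    IsBrauer (comp d₁ d₂) := by
  rw [isBrauer_iff] at h₁ h₂ ⊢
  refine ⟨h₁.1.comp h₂.1, fun a => ?_⟩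
  by_contra hno
  push Not at hno
  set c := compInd d₁ d₂ (outer a)
  have hup : ∑ a, c (upper a) = 0 := sum_compInd_upper h₁.1 fun x _ => h₁.2 x
  have hlow : ∑ a, c (lower a) = 0 := sum_compInd_lower h₂.1 fun x _ => h₂.2 x
  have hout : ∑ b, c (outer b) = 1 := by
    rw [Finset.sum_eq_single a]
    · exact if_pos ((stack _ _).refl _)
    · intro b _ hb
      exact if_neg (hno b hb)
    · simp
  rw [Fintype.sum_sum_type] at hup hlow hout
  change ∑ i, c (Sum.inl i) + ∑ i, c (Sum.inr (Sum.inl i)) = 0 at hup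
  change ∑ i, c (Sum.inr (Sum.inl i)) + ∑ i, c (Sum.inr (Sum.inr i)) = 0 at hlow
  change ∑ i, c (Sum.inl i) + ∑ i, c (Sum.inr (Sum.inr i)) = 1 at hout
  generalize ∑ i, c (Sum.inl i) = x at *
  generalize ∑ i, c (Sum.inr (Sum.inl i)) = y at *
  generalize ∑ i, c (Sum.inr (Sum.inr i)) = z at *
  clear hno
  revert x y z
  decide

/-! ### Concatenation of planar diagrams -/

/-- The part of `crossSum` that comes from two vertices of one row. -/
noncomputable def rowSum (c e : Fin k → ZMod 2) : ZMod 2 :=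
  ∑ i, ∑ j, c i * e j * if i < j then 1 else 0

/-- Along the boundary every top vertex precedes every bottom vertex, and the bottom row is read
backwards; hence the swapped arguments in the last term. -/
theorem crossSum_eq (c e : Fin k ⊕ Fin k → ZMod 2) :
    crossSum c e = rowSum (c ∘ Sum.inl) (e ∘ Sum.inl) +
      (∑ i, c (Sum.inl i)) * (∑ j, e (Sum.inr j)) + rowSum (e ∘ Sum.inr) (c ∘ Sum.inr) := by
  have h1 : ∀ i j : Fin k, circ (Sum.inl i : Fin k ⊕ Fin k) < circ (Sum.inl j : Fin k ⊕ Fin k) ↔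
      i < j := fun i j => Iff.rfl
  have h2 : ∀ i j : Fin k, circ (Sum.inl i : Fin k ⊕ Fin k) < circ (Sum.inr j : Fin k ⊕ Fin k) := by
    intro i j
    have := i.2
    have := j.2
    simp only [circ, Sum.elim_inl, Sum.elim_inr]
    omega
  have h3 : ∀ i j : Fin k,
      ¬ circ (Sum.inr i : Fin k ⊕ Fin k) < circ (Sum.inl j : Fin k ⊕ Fin k) := by
    intro i j
    exact not_lt.2 (h2 j i).le
  have h4 : ∀ i j : Fin k, circ (Sum.inr i : Fin k ⊕ Fin k) < circ (Sum.inr j : Fin k ⊕ Fin k) ↔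
      j < i := by
    intro i j
    have := i.2
    have := j.2
    rw [Fin.lt_def]
    simp only [circ, Sum.elim_inr]
    omega
  unfold crossSum rowSum
  rw [Finset.sum_comm (s := Finset.univ) (t := Finset.univ)
    (f := fun i j => (e ∘ Sum.inr) i * (c ∘ Sum.inr) j * if i < j then (1 : ZMod 2) else 0)]
  simp only [Fintype.sum_sum_type, h1, h2, h3, h4, if_true, if_false, mul_one, mul_zero,
    Finset.sum_const_zero, mul_add, Finset.sum_add_distrib, Finset.mul_sum,
    Finset.sum_mul, Function.comp_apply]
  rw [add_zero, add_assoc]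
  refine congrArg₂ _ (by simp only [mul_assoc]) (congrArg₂ _ Finset.sum_comm ?_)
  refine Finset.sum_congr rfl fun i _ => Finset.sum_congr rfl fun j _ => ?_
  rw [← mul_assoc, mul_comm (c _)]

theorem rowSum_add_rowSum {c e : Fin k → ZMod 2} (h : ∀ i, c i = 0 ∨ e i = 0) :
    rowSum c e + rowSum e c = (∑ i, c i) * ∑ j, e j := by
  unfold rowSum
  rw [Finset.sum_comm (s := Finset.univ) (t := Finset.univ)
    (f := fun i j => e i * c j * if i < j then (1 : ZMod 2) else 0), ← Finset.sum_add_distrib,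
    Finset.sum_mul_sum]
  refine Finset.sum_congr rfl fun i _ => ?_
  rw [← Finset.sum_add_distrib]
  refine Finset.sum_congr rfl fun j _ => ?_
  rcases lt_trichotomy i j with hij | rfl | hij
  · simp [hij, hij.not_gt]
  · rcases h i with h | h <;> simp [h]
  · simp [hij, hij.not_gt, mul_comm]

/-- Suppose two components with two outer ends each cross. Their crossing sums vanish in both `d₁`
and `d₂`. The middle row occurs once in each orientation, and `rowSum_add_rowSum` evaluates the
total. Each component has the same parity in all three rows, so the identities combine to make the
outer crossing sum even, while crossing ends make it odd. -/
theorem IsPlanar.comp {d₁ d₂ : Diagram k} (h₁ : IsPlanar d₁) (h₂ : IsPlanar d₂)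
    (p₁ : AtMostPairs d₁) (p₂ : AtMostPairs d₂) : IsPlanar (comp d₁ d₂) := by
  intro a b a' b' hab hba' ha'b' haa' hbb'
  by_contra hne
  have hna : a ≠ a' := by rintro rfl; omega
  have hnb : b ≠ b' := by rintro rfl; omega
  obtain ⟨ua, la⟩ := p₁.exists_of_comp p₂ hna haa'
  obtain ⟨ub, lb⟩ := p₁.exists_of_comp p₂ hnb hbb'
  set c := compInd d₁ d₂ (outer a)
  set e := compInd d₁ d₂ (outer b)
  have hce : ∀ x, c x = 0 ∨ e x = 0 := by
    intro x
    by_contra hx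
    push Not at hx
    have hcx : stack d₁ d₂ (outer a) x := by
      by_contra h
      exact hx.1 (if_neg h)
    have hex : stack d₁ d₂ (outer b) x := by
      by_contra h
      exact hx.2 (if_neg h)
    exact hne ((stack _ _).trans hcx ((stack _ _).symm hex))
  have hcu := sum_compInd_upper p₁ ua
  have hcl := sum_compInd_lower p₂ la
  have heu := sum_compInd_upper p₁ ub
  have hel := sum_compInd_lower p₂ lb
  have hup : crossSum (c ∘ upper) (e ∘ upper) = 0 := by
    refine h₁.crossSum_eq_zero p₁ (fun x y hxy => ?_) (fun x hx => ua x ?_) (fun x y hxy => ?_)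
      (fun x hx => ub x ?_) fun x => hce _
    · exact compInd_congr (stack_indicator_upper d₁ d₂ _ hxy)
    · by_contra h
      exact hx (if_neg h)
    · exact compInd_congr (stack_indicator_upper d₁ d₂ _ hxy)
    · by_contra h
      exact hx (if_neg h)
  have hlow : crossSum (c ∘ lower) (e ∘ lower) = 0 := by
    refine h₂.crossSum_eq_zero p₂ (fun x y hxy => ?_) (fun x hx => la x ?_) (fun x y hxy => ?_)
      (fun x hx => lb x ?_) fun x => hce _
    · exact compInd_congr (stack_indicator_lower d₁ d₂ _ hxy)
    · by_contra h
      exact hx (if_neg h)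
    · exact compInd_congr (stack_indicator_lower d₁ d₂ _ hxy)
    · by_contra h
      exact hx (if_neg h)
  have hca : ∀ x, (c (outer x) = 1 ∧ (x = a ∨ x = a')) ∨ (c (outer x) = 0 ∧ x ≠ a ∧ x ≠ a') := by
    intro x
    by_cases hx : stack d₁ d₂ (outer a) (outer x)
    · refine Or.inl ⟨if_pos hx, ?_⟩
      rcases (p₁.comp p₂) a a' x haa' hx with h | h | h
      exacts [absurd h hna, Or.inl h.symm, Or.inr h.symm]
    · refine Or.inr ⟨if_neg hx, ?_, ?_⟩
      · rintro rfl
        exact hx ((stack _ _).refl _)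
      · rintro rfl
        exact hx haa'
  have heb : ∀ x, (e (outer x) = 1 ∧ (x = b ∨ x = b')) ∨ (e (outer x) = 0 ∧ x ≠ b ∧ x ≠ b') := by
    intro x
    by_cases hx : stack d₁ d₂ (outer b) (outer x)
    · refine Or.inl ⟨if_pos hx, ?_⟩
      rcases (p₁.comp p₂) b b' x hbb' hx with h | h | h
      exacts [absurd h hnb, Or.inl h.symm, Or.inr h.symm]
    · refine Or.inr ⟨if_neg hx, ?_, ?_⟩
      · rintro rfl
        exact hx ((stack _ _).refl _)
      · rintro rfl
        exact hx hbb'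
  have sum_pair : ∀ {f : Fin k ⊕ Fin k → ZMod 2} {p q : Fin k ⊕ Fin k}, p ≠ q →
      (∀ x, (f x = 1 ∧ (x = p ∨ x = q)) ∨ (f x = 0 ∧ x ≠ p ∧ x ≠ q)) →
      ∀ g : Fin k ⊕ Fin k → ZMod 2, ∑ x, f x * g x = g p + g q := by
    intro f p q hpq hf g
    have hp : f p = 1 := by
      rcases hf p with h | h
      exacts [h.1, absurd rfl h.2.1]
    have hq : f q = 1 := by
      rcases hf q with h | h
      exacts [h.1, absurd rfl h.2.2]
    rw [Fintype.sum_eq_add p q hpq, hp, hq, one_mul, one_mul]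
    rintro x ⟨hxp, hxq⟩
    rcases hf x with ⟨_, h | h⟩ | h
    · exact absurd h hxp
    · exact absurd h hxq
    · rw [h.1, zero_mul]
  -- For ends in the order `a, b, a', b'`, three of the four comparisons hold.
  have hout : crossSum (c ∘ outer) (e ∘ outer) = 1 := by
    unfold crossSum
    simp only [Function.comp_apply]
    rw [sum_pair hna hca, sum_pair hnb heb, sum_pair hnb heb, if_pos hab,
      if_pos (hab.trans (hba'.trans ha'b')), if_neg hba'.not_gt, if_pos ha'b']
    decide
  rw [crossSum_eq] at hup hlow hout
  have hM : rowSum (c ∘ Sum.inr ∘ Sum.inl) (e ∘ Sum.inr ∘ Sum.inl) +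
      rowSum (e ∘ Sum.inr ∘ Sum.inl) (c ∘ Sum.inr ∘ Sum.inl) =
      (∑ i, c (Sum.inr (Sum.inl i))) * ∑ i, e (Sum.inr (Sum.inl i)) :=
    rowSum_add_rowSum fun i => hce _
  rw [Fintype.sum_sum_type] at hcu hcl heu hel
  change ∑ i, c (Sum.inl i) + ∑ i, c (Sum.inr (Sum.inl i)) = 0 at hcu
  change ∑ i, c (Sum.inr (Sum.inl i)) + ∑ i, c (Sum.inr (Sum.inr i)) = 0 at hcl
  change ∑ i, e (Sum.inl i) + ∑ i, e (Sum.inr (Sum.inl i)) = 0 at heu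
  change ∑ i, e (Sum.inr (Sum.inl i)) + ∑ i, e (Sum.inr (Sum.inr i)) = 0 at hel
  change rowSum (c ∘ Sum.inl) (e ∘ Sum.inl) + (∑ i, c (Sum.inl i)) *
    (∑ i, e (Sum.inr (Sum.inl i))) +
    rowSum (e ∘ Sum.inr ∘ Sum.inl) (c ∘ Sum.inr ∘ Sum.inl) = 0 at hup
  change rowSum (c ∘ Sum.inr ∘ Sum.inl) (e ∘ Sum.inr ∘ Sum.inl) +
    (∑ i, c (Sum.inr (Sum.inl i))) * (∑ i, e (Sum.inr (Sum.inr i))) +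
    rowSum (e ∘ Sum.inr ∘ Sum.inr) (c ∘ Sum.inr ∘ Sum.inr) = 0 at hlow
  change rowSum (c ∘ Sum.inl) (e ∘ Sum.inl) + (∑ i, c (Sum.inl i)) *
    (∑ i, e (Sum.inr (Sum.inr i))) +
    rowSum (e ∘ Sum.inr ∘ Sum.inr) (c ∘ Sum.inr ∘ Sum.inr) = 1 at hout
  have eq_of_add : ∀ x y : ZMod 2, x + y = 0 → y = x := by decide
  have e1 := eq_of_add _ _ hcu
  have e2 := eq_of_add _ _ hcl
  have e3 := eq_of_add _ _ heu
  have e4 := eq_of_add _ _ hel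
  rw [e1, e3] at hM
  rw [e4, e3, e1] at hlow
  rw [e3] at hup
  rw [e4, e3] at hout
  -- Here `s` is the product of the two common row parities, `p` and `q` are the middle row sums in
  -- the two orders, and `r` and `t` are the top and bottom row sums.
  have key : ∀ s p q r t : ZMod 2, p + q = s → r + s + q = 0 → p + s + t = 0 → r + s + t ≠ 1 := by
    decide
  exact key _ _ _ _ _ hM hup hlow hout

/-- Every outer vertex is labelled by its unique middle neighbour, or by itself if there is none.
The labels are constant on components and distinguish vertices of the same row. -/
theorem IsRook.comp {d₁ d₂ : Diagram k} (h₁ : IsRook d₁) (h₂ : IsRook d₂) :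
    IsRook (comp d₁ d₂) := by
  classical
  let f : Fin k → Rows k := fun t =>
    if h : ∃ m, d₁ (Sum.inl t) (Sum.inr m) then Sum.inr (Sum.inl h.choose) else Sum.inl t
  let g : Fin k → Rows k := fun t =>
    if h : ∃ m, d₂ (Sum.inl m) (Sum.inr t) then Sum.inr (Sum.inl h.choose) else Sum.inr (Sum.inr t)
  have hf : ∀ t m, d₁ (Sum.inl t) (Sum.inr m) → f t = Sum.inr (Sum.inl m) := by
    intro t m h
    have h' : ∃ m, d₁ (Sum.inl t) (Sum.inr m) := ⟨m, h⟩
    simp only [f, dif_pos h']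
    rw [h₁.2 _ _ (d₁.trans (d₁.symm h'.choose_spec) h)]
  have hg : ∀ t m, d₂ (Sum.inl m) (Sum.inr t) → g t = Sum.inr (Sum.inl m) := by
    intro t m h
    have h' : ∃ m, d₂ (Sum.inl m) (Sum.inr t) := ⟨m, h⟩
    simp only [g, dif_pos h']
    rw [h₂.1 _ _ (d₂.trans h'.choose_spec (d₂.symm h))]
  have hle : stack d₁ d₂ ≤ Setoid.ker (Sum.elim f (Sum.elim (fun m => Sum.inr (Sum.inl m)) g)) := by
    refine stack_le_iff.2 ⟨fun a b hab => ?_, fun a b hab => ?_⟩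
    · rw [Setoid.ker_def]
      rcases a with a | a <;> rcases b with b | b
      · rw [h₁.1 _ _ hab]
      · exact hf a b hab
      · exact (hf b a (d₁.symm hab)).symm
      · rw [h₁.2 _ _ hab]
    · rw [Setoid.ker_def]
      rcases a with a | a <;> rcases b with b | b
      · rw [h₂.1 _ _ hab]
      · exact (hg b a hab).symm
      · exact hg a b (d₂.symm hab)
      · rw [h₂.2 _ _ hab]
  constructor
  · intro i j hij
    have h : f i = f j := hle hij
    by_cases hi : ∃ m, d₁ (Sum.inl i) (Sum.inr m)
    · obtain ⟨m, hm⟩ := hi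
      rw [hf i m hm] at h
      by_cases hj : ∃ m, d₁ (Sum.inl j) (Sum.inr m)
      · obtain ⟨m', hm'⟩ := hj
        rw [hf j m' hm'] at h
        obtain rfl := Sum.inl_injective (Sum.inr_injective h)
        exact h₁.1 _ _ (d₁.trans hm (d₁.symm hm'))
      · simp [f, hj] at h
    · by_cases hj : ∃ m, d₁ (Sum.inl j) (Sum.inr m)
      · obtain ⟨m', hm'⟩ := hj
        rw [hf j m' hm'] at h
        simp [f, hi] at h
      · simpa [f, hi, hj] using h
  · intro i j hij
    have h : g i = g j := hle hij
    by_cases hi : ∃ m, d₂ (Sum.inl m) (Sum.inr i)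
    · obtain ⟨m, hm⟩ := hi
      rw [hg i m hm] at h
      by_cases hj : ∃ m, d₂ (Sum.inl m) (Sum.inr j)
      · obtain ⟨m', hm'⟩ := hj
        rw [hg j m' hm'] at h
        obtain rfl := Sum.inl_injective (Sum.inr_injective h)
        exact h₂.2 _ _ (d₂.trans (d₂.symm hm) hm')
      · simp [g, hj] at h
    · by_cases hj : ∃ m, d₂ (Sum.inl m) (Sum.inr j)
      · obtain ⟨m', hm'⟩ := hj
        rw [hg j m' hm'] at h
        simp [g, hi] at h
      · simpa [g, hi, hj] using h

theorem Family.comp_mem {A : Family} {d₁ d₂ : Diagram k} (h₁ : d₁ ∈ A.diagrams k)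
    (h₂ : d₂ ∈ A.diagrams k) : comp d₁ d₂ ∈ A.diagrams k := by
  cases A with
  | partition => trivial
  | brauer => exact IsBrauer.comp h₁ h₂
  | rookBrauer =>
    exact isRookBrauer_iff.2 ((isRookBrauer_iff.1 h₁).comp (isRookBrauer_iff.1 h₂))
  | rook => exact IsRook.comp h₁ h₂
  | temperleyLieb =>
    exact ⟨h₁.1.comp h₂.1, h₁.2.comp h₂.2 h₁.1.atMostPairs h₂.1.atMostPairs⟩
  | motzkin =>
    exact ⟨isRookBrauer_iff.2 ((isRookBrauer_iff.1 h₁.1).comp (isRookBrauer_iff.1 h₂.1)),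
      h₁.2.comp h₂.2 (isRookBrauer_iff.1 h₁.1) (isRookBrauer_iff.1 h₂.1)⟩
  | planarRook => exact ⟨h₁.1.comp h₂.1, h₁.2.comp h₂.2 h₁.1.atMostPairs h₂.1.atMostPairs⟩

theorem AtMostPairs.transpose {d : Diagram k} (h : AtMostPairs d) :
    AtMostPairs (transpose d) := by
  intro a b c hab hac
  have := h _ _ _ hab hac
  simpa [Sum.swap_leftInverse.injective.eq_iff] using this

theorem IsBrauer.transpose {d : Diagram k} (h : IsBrauer d) : IsBrauer (transpose d) := by
  rw [isBrauer_iff] at h ⊢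
  refine ⟨h.1.transpose, fun a => ?_⟩
  obtain ⟨b, hb, hab⟩ := h.2 a.swap
  refine ⟨b.swap, fun h => hb (by rw [← h, Sum.swap_swap]), ?_⟩
  rw [transpose_apply, Sum.swap_swap]
  exact hab

theorem IsRook.transpose {d : Diagram k} (h : IsRook d) : IsRook (transpose d) := ⟨h.2, h.1⟩

theorem IsPlanar.transpose {d : Diagram k} (h : IsPlanar d) : IsPlanar (transpose d) := by
  have hc : ∀ a : Fin k ⊕ Fin k, circ a.swap + circ a + 1 = 2 * k := by
    rintro (a | a) <;> have := a.2 <;> simp only [circ, Sum.swap, Sum.elim_inl, Sum.elim_inr] <;>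
      omega
  intro a b c e hab hbc hce hac hbe
  have ha := hc a
  have hb := hc b
  have hc' := hc c
  have he := hc e
  have := h e.swap c.swap b.swap a.swap (by omega) (by omega) (by omega) (d.symm hbe) (d.symm hac)
  exact d.trans hac (d.symm (d.trans hbe this))

theorem Family.transpose_mem {A : Family} {d : Diagram k} (h : d ∈ A.diagrams k) :
    transpose d ∈ A.diagrams k := by
  cases A with
  | partition => trivial
  | brauer => exact IsBrauer.transpose h
  | rookBrauer => exact isRookBrauer_iff.2 (isRookBrauer_iff.1 h).transpose
  | rook => exact IsRook.transpose h
  | temperleyLieb => exact ⟨h.1.transpose, h.2.transpose⟩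
  | motzkin => exact ⟨isRookBrauer_iff.2 (isRookBrauer_iff.1 h.1).transpose, h.2.transpose⟩
  | planarRook => exact ⟨h.1.transpose, h.2.transpose⟩

theorem isRook_permDiagram (γ : Equiv.Perm (Fin k)) : IsRook (permDiagram k γ) := by
  refine ⟨fun i j h => ?_, fun i j h => ?_⟩ <;> rw [permDiagram_apply] at h
  · exact h
  · exact γ.injective h

theorem isBrauer_permDiagram (γ : Equiv.Perm (Fin k)) : IsBrauer (permDiagram k γ) := by
  refine isBrauer_iff.2 ⟨(isRook_permDiagram γ).atMostPairs, ?_⟩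
  rintro (i | i)
  · exact ⟨Sum.inr (γ.symm i), by simp, (permDiagram_apply γ).2 (by simp)⟩
  · exact ⟨Sum.inl (γ i), by simp, (permDiagram_apply γ).2 (by simp)⟩

theorem Family.permDiagram_mem {A : Family} (hA : ¬ A.Planar) (γ : Equiv.Perm (Fin k)) :
    permDiagram k γ ∈ A.diagrams k := by
  cases A with
  | partition => trivial
  | brauer => exact isBrauer_permDiagram γ
  | rookBrauer => exact isRookBrauer_iff.2 (isRook_permDiagram γ).atMostPairs
  | rook => exact isRook_permDiagram γ
  | temperleyLieb => exact absurd trivial hA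
  | motzkin => exact absurd trivial hA
  | planarRook => exact absurd trivial hA

end Closure

/-! ### Diagrams with the bottom half of `e_m` -/

section Glue

variable {k m : ℕ}

open Classical in
/-- The label of a vertex `i ≥ m` in the row pattern of `e_m`. -/
noncomputable def Family.tailLabel (A : Family) (m i : ℕ) : ℕ := if A.Parity then (i - m) / 2 else i

theorem Family.tailLabel_eq {A : Family} {i j : ℕ} (hi : m ≤ i) (hj : m ≤ j)
    (h : A.tailLabel m i = A.tailLabel m j) : i = j ∨ i + 1 = j ∨ j + 1 = i := by
  unfold Family.tailLabel at h
  split_ifs at h <;> omega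

theorem Family.tailLabel_eq_of_not_parity {A : Family} (hA : ¬ A.Parity) {i j : ℕ}
    (h : A.tailLabel m i = A.tailLabel m j) : i = j := by
  simpa [Family.tailLabel, hA] using h

/-- The neighbour is on the right or left according to the parity of `j - m`; evenness of `k - m`
keeps the right neighbour inside the row. -/
theorem Family.exists_tailLabel_eq {A : Family} (hA : A.Parity) (hk : Even (k - m)) (j : Fin k)
    (hj : m ≤ j) : ∃ i : Fin k, i ≠ j ∧ m ≤ i ∧ A.tailLabel m i = A.tailLabel m j := by
  simp only [Family.tailLabel, hA, if_true]
  obtain ⟨r, hr⟩ := hk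
  have := j.2
  rcases Nat.even_or_odd' ((j : ℕ) - m) with ⟨c, hc | hc⟩
  · exact ⟨⟨j + 1, by omega⟩, by simp [Fin.ext_iff], by simp; omega, by simp; omega⟩
  · exact ⟨⟨j - 1, by omega⟩, by simp [Fin.ext_iff]; omega, by simp; omega, by simp; omega⟩

theorem Family.idemDiagram_inl_inl {A : Family} {i j : Fin k} :
    A.idemDiagram k m (Sum.inl i) (Sum.inl j) ↔
      i = j ∨ (m ≤ i ∧ m ≤ j ∧ A.tailLabel m i = A.tailLabel m j) := by
  change (if (i : ℕ) < m then ((0 : ℕ), (i : ℕ)) else (1, A.tailLabel m i)) =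
    (if (j : ℕ) < m then ((0 : ℕ), (j : ℕ)) else (1, A.tailLabel m j)) ↔ _
  by_cases hi : (i : ℕ) < m <;> by_cases hj : (j : ℕ) < m <;>
    simp only [hi, hj, if_true, if_false, Prod.mk.injEq, Fin.ext_iff] <;> grind

theorem Family.idemDiagram_inr_inr {A : Family} {i j : Fin k} :
    A.idemDiagram k m (Sum.inr i) (Sum.inr j) ↔
      i = j ∨ (m ≤ i ∧ m ≤ j ∧ A.tailLabel m i = A.tailLabel m j) := by
  change (if (i : ℕ) < m then ((0 : ℕ), (i : ℕ)) else (2, A.tailLabel m i)) =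
    (if (j : ℕ) < m then ((0 : ℕ), (j : ℕ)) else (2, A.tailLabel m j)) ↔ _
  by_cases hi : (i : ℕ) < m <;> by_cases hj : (j : ℕ) < m <;>
    simp only [hi, hj, if_true, if_false, Prod.mk.injEq, Fin.ext_iff] <;> grind

theorem Family.idemDiagram_inl_inr {A : Family} {i j : Fin k} :
    A.idemDiagram k m (Sum.inl i) (Sum.inr j) ↔ i = j ∧ (j : ℕ) < m := by
  change (if (i : ℕ) < m then ((0 : ℕ), (i : ℕ)) else (1, A.tailLabel m i)) =
    (if (j : ℕ) < m then ((0 : ℕ), (j : ℕ)) else (2, A.tailLabel m j)) ↔ _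
  by_cases hi : (i : ℕ) < m <;> by_cases hj : (j : ℕ) < m <;>
    simp only [hi, hj, if_true, if_false, Prod.mk.injEq, Fin.ext_iff] <;> grind

/-- The bottom half of `d` is that of `e_m`, and its propagating blocks meet the bottom row in the
first `m` vertices. -/
def IsBot (A : Family) (m : ℕ) (d : Diagram k) : Prop :=
  (∀ i j, d (Sum.inr i) (Sum.inr j) ↔ A.idemDiagram k m (Sum.inr i) (Sum.inr j)) ∧
    ∀ j : Fin k, (∃ x, d (Sum.inl x) (Sum.inr j)) ↔ (j : ℕ) < m

theorem isBot_idemDiagram (A : Family) (k m : ℕ) : IsBot A m (A.idemDiagram k m) := by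
  refine ⟨fun _ _ => Iff.rfl, fun j => ?_⟩
  constructor
  · rintro ⟨x, hx⟩
    exact (Family.idemDiagram_inl_inr.1 hx).2
  · intro hj
    exact ⟨j, Family.idemDiagram_inl_inr.2 ⟨rfl, hj⟩⟩

theorem IsBot.inr_inr_of_lt {A : Family} {d : Diagram k} (hd : IsBot A m d) {i j : Fin k}
    (hi : (i : ℕ) < m) (h : d (Sum.inr i) (Sum.inr j)) : i = j := by
  rcases Family.idemDiagram_inr_inr.1 ((hd.1 i j).1 h) with h | ⟨h, -⟩
  · exact h
  · omega

theorem IsBot.rank_eq {A : Family} {d : Diagram k} (hd : IsBot A m d) (hm : m ≤ k) :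
    rank d = m := by
  unfold rank
  have : {c : Quotient d | (∃ i, Quotient.mk d (Sum.inl i) = c) ∧
      ∃ j, Quotient.mk d (Sum.inr j) = c} =
      Set.range fun j : Fin m => Quotient.mk d (Sum.inr (Fin.castLE hm j)) := by
    ext c
    constructor
    · rintro ⟨⟨i, hi⟩, j, rfl⟩
      exact ⟨⟨j, (hd.2 j).1 ⟨i, Quotient.exact hi⟩⟩, rfl⟩
    · rintro ⟨j, rfl⟩
      obtain ⟨x, hx⟩ := (hd.2 (Fin.castLE hm j)).2 j.2
      exact ⟨⟨x, Quotient.sound hx⟩, _, rfl⟩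
  rw [this, Set.ncard_range_of_injective, Nat.card_fin]
  intro i j hij
  exact Fin.castLE_injective hm (hd.inr_inr_of_lt i.2 (Quotient.exact hij))

/-- Propagating blocks of the composite can reach the bottom row only at its first `m` vertices. If
there are still `m` of them, each of these vertices propagates and no two have been merged, so the
bottom half is unchanged. -/
theorem IsBot.comp {A : Family} {d : Diagram k} (hd : IsBot A m d) (hm : m ≤ k) (a : Diagram k)
    (hr : m ≤ rank (comp a d)) : IsBot A m (comp a d) := by
  set c := DiagAlg.comp a d with hc
  set f : Fin m → Quotient c := fun j => Quotient.mk c (Sum.inr (Fin.castLE hm j)) with hf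
  have hlt : ∀ j : Fin k, (∃ x, c (Sum.inl x) (Sum.inr j)) → (j : ℕ) < m := by
    rintro j ⟨x, hx⟩
    exact (hd.2 j).1 (exists_lower_of_comp hx)
  have hsub : {q : Quotient c | (∃ i, Quotient.mk c (Sum.inl i) = q) ∧
      ∃ j, Quotient.mk c (Sum.inr j) = q} ⊆ f '' Set.univ := by
    rintro q ⟨⟨i, hi⟩, j, rfl⟩
    exact ⟨⟨j, hlt j ⟨i, Quotient.exact hi⟩⟩, trivial, rfl⟩
  have hle : (f '' Set.univ).ncard ≤ m := by
    refine (Set.ncard_image_le (Set.toFinite _)).trans ?_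
    rw [Set.ncard_univ, Nat.card_fin]
  have heq := Set.eq_of_subset_of_ncard_le hsub (hle.trans hr) (Set.toFinite _)
  have hinj : Set.InjOn f Set.univ := by
    refine Set.injOn_of_ncard_image_eq (le_antisymm ?_ ?_) (Set.toFinite _)
    · exact Set.ncard_image_le (Set.toFinite _)
    · rw [Set.ncard_univ, Nat.card_fin, ← heq]
      exact hr
  constructor
  · intro i j
    constructor
    · intro hij
      have hout : ∀ {i j : Fin k}, ¬ (i : ℕ) < m → c (Sum.inr i) (Sum.inr j) →
          d (Sum.inr i) (Sum.inr j) := by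
        intro i j hi hij
        obtain ⟨v, hv, hvi⟩ := exists_of_stack_bottom
          (fun x hx => hi ((hd.2 i).1 ⟨x, hx⟩)) hij
        obtain rfl : j = v := Sum.inr_injective (Sum.inr_injective hv)
        exact d.symm hvi
      by_cases hi : (i : ℕ) < m
      · by_cases hj : (j : ℕ) < m
        · have := hinj (x₁ := ⟨i, hi⟩) (x₂ := ⟨j, hj⟩) trivial trivial (Quotient.sound hij)
          rw [Fin.mk.injEq, Fin.val_inj] at this
          rw [this]
        · exact (hd.1 i j).1 (d.symm (hout hj (c.symm hij)))
      · exact (hd.1 i j).1 (hout hi hij)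
    · intro hij
      exact stack_lower a ((hd.1 i j).2 hij)
  · refine fun j => ⟨hlt j, fun hj => ?_⟩
    have : f ⟨j, hj⟩ ∈ f '' Set.univ := ⟨_, trivial, rfl⟩
    rw [← heq] at this
    obtain ⟨⟨x, hx⟩, -⟩ := this
    exact ⟨x, Quotient.exact hx⟩

/-! ### Unique factorization into a top half and a permutation -/

/-- The diagram with the top half of `w` and the bottom half of `e_m`, in which the bottom vertex
`j < m` is joined to the propagating block number `σ j` of `w`. -/
noncomputable def glue (A : Family) (w : Diagram k) (h : rank w = m) (σ : Equiv.Perm (Fin m)) :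
    Diagram k :=
  Setoid.ker (Sum.elim (fun x => (Sum.inl (Quotient.mk w (Sum.inl x)) : Quotient w ⊕ ℕ))
    (fun j => if hj : (j : ℕ) < m then Sum.inl (Quotient.mk w (Sum.inl (propMax w h (σ ⟨j, hj⟩))))
      else Sum.inr (A.tailLabel m j)))

theorem comap_ker {α β γ : Type*} (f : α → β) (g : β → γ) :
    Setoid.comap f (Setoid.ker g) = Setoid.ker (g ∘ f) := rfl

theorem rank_le (d : Diagram k) : rank d ≤ k := by
  simpa using Fintype.card_le_of_embedding (propMax d rfl).toEmbedding

variable {A : Family} {w : Diagram k} {h : rank w = m} {σ : Equiv.Perm (Fin m)}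

theorem glue_inl_inl {x y : Fin k} :
    glue A w h σ (Sum.inl x) (Sum.inl y) ↔ w (Sum.inl x) (Sum.inl y) := by
  unfold glue
  rw [Setoid.ker_def]
  exact Sum.inl_injective.eq_iff.trans Quotient.eq

theorem glue_inl_inr {x j : Fin k} :
    glue A w h σ (Sum.inl x) (Sum.inr j) ↔
      ∃ hj : (j : ℕ) < m, w (Sum.inl x) (Sum.inl (propMax w h (σ ⟨j, hj⟩))) := by
  unfold glue
  rw [Setoid.ker_def]
  by_cases hj : (j : ℕ) < m
  · simp only [Sum.elim_inl, Sum.elim_inr, hj, dif_pos, exists_true_left]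
    exact Sum.inl_injective.eq_iff.trans Quotient.eq
  · simp [hj]

theorem glue_inr_inr {i j : Fin k} : glue A w h σ (Sum.inr i) (Sum.inr j) ↔
    i = j ∨ (m ≤ i ∧ m ≤ j ∧ A.tailLabel m i = A.tailLabel m j) := by
  unfold glue
  rw [Setoid.ker_def]
  by_cases hi : (i : ℕ) < m <;> by_cases hj : (j : ℕ) < m
  · simp only [Sum.elim_inr, hi, hj, dif_pos]
    refine Sum.inl_injective.eq_iff.trans (Quotient.eq.trans ((propMax_rel_iff h).trans ?_))
    rw [σ.injective.eq_iff, Fin.mk.injEq, Fin.val_inj]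
    constructor
    · exact Or.inl
    · rintro (h | h)
      · exact h
      · omega
  · simp only [Sum.elim_inr, hi, hj, dif_pos, dif_neg, not_false_eq_true]
    refine iff_of_false (by simp) ?_
    rintro (rfl | h)
    · exact hj hi
    · omega
  · simp only [Sum.elim_inr, hi, hj, dif_pos, dif_neg, not_false_eq_true]
    refine iff_of_false (by simp) ?_
    rintro (rfl | h)
    · exact hi hj
    · omega
  · simp only [Sum.elim_inr, hi, hj, dif_neg, not_false_eq_true]
    rw [Sum.inr_injective.eq_iff]
    constructor
    · intro h
      exact Or.inr ⟨not_lt.1 hi, not_lt.1 hj, h⟩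
    · rintro (rfl | h)
      exacts [rfl, h.2.2]

theorem isProp_glue {x : Fin k} : IsProp (glue A w h σ) x ↔ IsProp w x := by
  constructor
  · rintro ⟨j, hj⟩
    obtain ⟨hj, hx⟩ := glue_inl_inr.1 hj
    exact IsProp.congr (w.symm hx) (isPropMax_propMax h _).1
  · intro hx
    obtain ⟨i, hi⟩ := exists_propMax_rel h hx
    refine ⟨Fin.castLE (h ▸ rank_le w) (σ.symm i), glue_inl_inr.2 ⟨(σ.symm i).2, ?_⟩⟩
    change w (Sum.inl x) (Sum.inl (propMax w h (σ (σ.symm i))))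
    rw [Equiv.apply_symm_apply]
    exact hi

theorem rank_glue : rank (glue A w h σ) = m :=
  (rank_congr (fun _ _ => glue_inl_inl) fun _ => isProp_glue).trans h

theorem symDiagram_glue (hw : IsSymmetricDiagram m w) : symDiagram (glue A w h σ) = w :=
  hw.symDiagram_eq (fun _ _ => glue_inl_inl) fun _ => isProp_glue

theorem glue_propMax (i : Fin m) (j : Fin k) (hj : (j : ℕ) = i) :
    glue A w h σ (Sum.inl (propMax w h (σ i))) (Sum.inr j) := by
  refine glue_inl_inr.2 ⟨by omega, ?_⟩
  have : (⟨j, by omega⟩ : Fin m) = i := Fin.ext hj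
  rw [this]

theorem glue_injective {w' : Diagram k} {h' : rank w' = m} {σ' : Equiv.Perm (Fin m)}
    (hw : IsSymmetricDiagram m w) (hw' : IsSymmetricDiagram m w')
    (heq : glue A w h σ = glue A w' h' σ') : w = w' ∧ σ = σ' := by
  obtain rfl : w = w' := by
    rw [← symDiagram_glue (A := A) (h := h) (σ := σ) hw, heq, symDiagram_glue hw']
  refine ⟨rfl, Equiv.ext fun i => ?_⟩
  have hi := glue_propMax (A := A) (w := w) (h := h) (σ := σ) i
    (Fin.castLE (h ▸ rank_le w) i) rfl
  rw [heq] at hi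
  obtain ⟨_, hi⟩ := glue_inl_inr.1 hi
  exact (propMax_rel_iff h).1 hi

/-- Acting from below permutes only the attachments of the first `m` bottom vertices. In particular
`glue A w h σ` is `glue A w h 1` times `σ`. -/
theorem glue_comp_permDiagram (τ : Equiv.Perm (Fin m)) :
    comp (glue A w h σ) (permDiagram k τ) = glue A w h (σ * τ) := by
  have hm : m ≤ k := h ▸ rank_le w
  rw [← permDiagram_extPerm hm, comp_permDiagram_right]
  unfold glue
  rw [comap_ker]
  congr 1
  funext a
  rcases a with a | a
  · rfl
  · simp only [Function.comp_apply, Sum.map_inr, Sum.elim_inr]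
    by_cases ha : (a : ℕ) < m
    · have h2 := extPerm_castLE hm τ ⟨a, ha⟩
      rw [show Fin.castLE hm ⟨a, ha⟩ = a from rfl] at h2
      simp only [h2, ha, dif_pos, Fin.val_castLE, Fin.is_lt, Fin.eta, Equiv.Perm.mul_apply]
    · rw [extPerm_of_le hm τ (not_lt.1 ha)]
      simp [ha]

theorem isBot_glue : IsBot A m (glue A w h σ) := by
  refine ⟨fun i j => glue_inr_inr.trans Family.idemDiagram_inr_inr.symm, fun j => ?_⟩
  constructor
  · rintro ⟨x, hx⟩
    exact (glue_inl_inr.1 hx).1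
  · intro hj
    exact ⟨_, glue_propMax ⟨j, hj⟩ j rfl⟩

/-- Each of the first `m` bottom vertices lies in a propagating block, and different ones lie in
different blocks. This is an injection between `m`-element sets, hence the required permutation. -/
theorem IsBot.exists_glue_eq {d : Diagram k} (hd : IsBot A m d) (hr : rank (symDiagram d) = m) :
    ∃ σ, glue A (symDiagram d) hr σ = d := by
  have hm : m ≤ k := hr ▸ rank_le _
  have hex : ∀ j : Fin m, ∃ i : Fin m,
      d (Sum.inl (propMax (symDiagram d) hr i)) (Sum.inr (Fin.castLE hm j)) := by
    intro j
    obtain ⟨x, hx⟩ := (hd.2 (Fin.castLE hm j)).2 j.2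
    obtain ⟨i, hi⟩ := exists_propMax_rel hr (isProp_symDiagram.2 ⟨_, hx⟩)
    exact ⟨i, d.trans (d.symm (symDiagram_inl_inl.1 hi)) hx⟩
  choose f hf using hex
  have hinj : Function.Injective f := by
    intro i j hij
    have h1 := hf i
    rw [hij] at h1
    exact Fin.castLE_injective hm (hd.inr_inr_of_lt i.2 (d.trans (d.symm h1) (hf j)))
  refine ⟨Equiv.ofBijective f (Finite.injective_iff_bijective.1 hinj), ?_⟩
  have key : ∀ x j, glue A (symDiagram d) hr
      (Equiv.ofBijective f (Finite.injective_iff_bijective.1 hinj)) (Sum.inl x) (Sum.inr j) ↔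
      d (Sum.inl x) (Sum.inr j) := by
    intro x j
    rw [glue_inl_inr]
    constructor
    · rintro ⟨hj, hx⟩
      exact d.trans (symDiagram_inl_inl.1 hx) (hf ⟨j, hj⟩)
    · intro hx
      have hj := (hd.2 j).1 ⟨x, hx⟩
      exact ⟨hj, symDiagram_inl_inl.2 (d.trans hx (d.symm (hf ⟨j, hj⟩)))⟩
  ext a b
  rcases a with a | a <;> rcases b with b | b
  · exact glue_inl_inl.trans symDiagram_inl_inl
  · exact key a b
  · exact (Setoid.comm' _).trans ((key b a).trans (Setoid.comm' _))
  · exact glue_inr_inr.trans (Family.idemDiagram_inr_inr.symm.trans (hd.1 a b).symm)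

/-! ### Membership in the families -/

theorem atMostPairs_of_rows {d : Diagram k}
    (htop : ∀ x y z, d (Sum.inl x) (Sum.inl y) → d (Sum.inl x) (Sum.inl z) → x = y ∨ x = z ∨ y = z)
    (hbot : ∀ x y z, d (Sum.inr x) (Sum.inr y) → d (Sum.inr x) (Sum.inr z) → x = y ∨ x = z ∨ y = z)
    (hT : ∀ x y j, d (Sum.inl x) (Sum.inl y) → d (Sum.inl x) (Sum.inr j) → x = y)
    (hB : ∀ x i j, d (Sum.inl x) (Sum.inr i) → d (Sum.inl x) (Sum.inr j) → i = j) :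
    AtMostPairs d := by
  intro a b c hab hac
  have hbc := d.trans (d.symm hab) hac
  rcases a with a | a <;> rcases b with b | b <;> rcases c with c | c
  · simpa using htop a b c hab hac
  · exact Or.inl (congrArg _ (hT _ _ _ hab hac))
  · exact Or.inr (Or.inl (congrArg _ (hT _ _ _ hac hab)))
  · exact Or.inr (Or.inr (congrArg _ (hB _ _ _ hab hac)))
  · exact Or.inr (Or.inr (congrArg _ (hT _ _ _ hbc (d.symm hab))))
  · exact Or.inr (Or.inl (congrArg _ (hB _ _ _ (d.symm hab) hbc)))
  · exact Or.inl (congrArg _ (hB _ _ _ (d.symm hac) (d.symm hbc)))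
  · simpa using hbot a b c hab hac

theorem row_pattern {x y z : Fin k}
    (h1 : x = y ∨ (m ≤ x ∧ m ≤ y ∧ A.tailLabel m x = A.tailLabel m y))
    (h2 : x = z ∨ (m ≤ x ∧ m ≤ z ∧ A.tailLabel m x = A.tailLabel m z)) :
    x = y ∨ x = z ∨ y = z := by
  rcases h1 with h1 | ⟨hx, hy, h1⟩
  · exact Or.inl h1
  rcases h2 with h2 | ⟨-, hz, h2⟩
  · exact Or.inr (Or.inl h2)
  have e1 := Family.tailLabel_eq hx hy h1
  have e2 := Family.tailLabel_eq hx hz h2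
  have e3 := Family.tailLabel_eq hy hz (h1.symm.trans h2)
  simp only [Fin.ext_iff]
  omega

theorem row_pattern_adjacent {x y : Fin k}
    (h1 : x = y ∨ (m ≤ x ∧ m ≤ y ∧ A.tailLabel m x = A.tailLabel m y)) (h2 : (x : ℕ) + 1 < y) :
    False := by
  rcases h1 with rfl | ⟨hx, hy, h1⟩
  · omega
  · have e1 := Family.tailLabel_eq hx hy h1
    omega

theorem atMostPairs_idemDiagram : AtMostPairs (A.idemDiagram k m) := by
  refine atMostPairs_of_rows (fun x y z h1 h2 => ?_) (fun x y z h1 h2 => ?_)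
    (fun x y j h1 h2 => ?_) fun x i j h1 h2 => ?_
  · exact row_pattern (Family.idemDiagram_inl_inl.1 h1) (Family.idemDiagram_inl_inl.1 h2)
  · exact row_pattern (Family.idemDiagram_inr_inr.1 h1) (Family.idemDiagram_inr_inr.1 h2)
  · obtain ⟨rfl, hx⟩ := Family.idemDiagram_inl_inr.1 h2
    rcases Family.idemDiagram_inl_inl.1 h1 with h | h
    · exact h
    · omega
  · exact (Family.idemDiagram_inl_inr.1 h1).1.symm.trans (Family.idemDiagram_inl_inr.1 h2).1

theorem atMostPairs_glue (hw : IsSymmetricDiagram m w) (hp : AtMostPairs w) :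
    AtMostPairs (glue A w h σ) := by
  refine atMostPairs_of_rows (fun x y z h1 h2 => ?_) (fun x y z h1 h2 => ?_)
    (fun x y j h1 h2 => ?_) fun x i j h1 h2 => ?_
  · simpa using hp _ _ _ (glue_inl_inl.1 h1) (glue_inl_inl.1 h2)
  · exact row_pattern (glue_inr_inr.1 h1) (glue_inr_inr.1 h2)
  · obtain ⟨hj, h2⟩ := glue_inl_inr.1 h2
    have h3 := hw.inl_inr.2 ⟨h2, (isPropMax_propMax h _).1⟩
    simpa using hp _ _ _ (glue_inl_inl.1 h1) h3
  · obtain ⟨hi, h1⟩ := glue_inl_inr.1 h1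
    obtain ⟨hj, h2⟩ := glue_inl_inr.1 h2
    have h3 := (propMax_rel_iff h).1 (w.trans (w.symm h1) h2)
    rw [σ.injective.eq_iff, Fin.mk.injEq, Fin.val_inj] at h3
    exact h3

theorem isBrauer_idemDiagram (hA : A.Parity) (hk : Even (k - m)) :
    IsBrauer (A.idemDiagram k m) := by
  refine isBrauer_iff.2 ⟨atMostPairs_idemDiagram, ?_⟩
  rintro (j | j) <;> by_cases hj : (j : ℕ) < m
  · exact ⟨Sum.inr j, by simp, Family.idemDiagram_inl_inr.2 ⟨rfl, hj⟩⟩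
  · obtain ⟨i, hij, hi, h⟩ := Family.exists_tailLabel_eq hA hk j (not_lt.1 hj)
    exact ⟨Sum.inl i, by simpa using hij,
      Family.idemDiagram_inl_inl.2 (Or.inr ⟨not_lt.1 hj, hi, h.symm⟩)⟩
  · exact ⟨Sum.inl j, by simp, Setoid.symm' _ (Family.idemDiagram_inl_inr.2 ⟨rfl, hj⟩)⟩
  · obtain ⟨i, hij, hi, h⟩ := Family.exists_tailLabel_eq hA hk j (not_lt.1 hj)
    exact ⟨Sum.inr i, by simpa using hij,
      Family.idemDiagram_inr_inr.2 (Or.inr ⟨not_lt.1 hj, hi, h.symm⟩)⟩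

theorem isBrauer_glue (hA : A.Parity) (hk : Even (k - m)) (hw : IsSymmetricDiagram m w)
    (hb : IsBrauer w) : IsBrauer (glue A w h σ) := by
  refine isBrauer_iff.2 ⟨atMostPairs_glue hw hb.atMostPairs, ?_⟩
  rintro (j | j)
  · obtain ⟨b | b, hbj, hb⟩ := (isBrauer_iff.1 hb).2 (Sum.inl j)
    · exact ⟨Sum.inl b, hbj, glue_inl_inl.2 hb⟩
    · obtain ⟨i, hi⟩ := (isProp_glue (A := A) (h := h) (σ := σ)).2 ⟨b, hb⟩
      exact ⟨Sum.inr i, by simp, hi⟩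
  · by_cases hj : (j : ℕ) < m
    · exact ⟨Sum.inl _, by simp, Setoid.symm' _ (glue_propMax ⟨j, hj⟩ j rfl)⟩
    · obtain ⟨i, hij, hi, h⟩ := Family.exists_tailLabel_eq hA hk j (not_lt.1 hj)
      exact ⟨Sum.inr i, by simpa using hij, glue_inr_inr.2 (Or.inr ⟨not_lt.1 hj, hi, h.symm⟩)⟩

theorem isRook_idemDiagram (hA : ¬ A.Parity) : IsRook (A.idemDiagram k m) := by
  constructor <;> intro i j hij
  · rcases Family.idemDiagram_inl_inl.1 hij with h | h
    exacts [h, Fin.ext (Family.tailLabel_eq_of_not_parity hA h.2.2)]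
  · rcases Family.idemDiagram_inr_inr.1 hij with h | h
    exacts [h, Fin.ext (Family.tailLabel_eq_of_not_parity hA h.2.2)]

theorem isRook_glue (hA : ¬ A.Parity) (hr : IsRook w) : IsRook (glue A w h σ) := by
  constructor <;> intro i j hij
  · exact hr.1 _ _ (glue_inl_inl.1 hij)
  · rcases glue_inr_inr.1 hij with h | h
    exacts [h, Fin.ext (Family.tailLabel_eq_of_not_parity hA h.2.2)]

/-! ### Planarity of the glued diagrams -/

theorem circ_inl_lt_inl {i j : Fin k} :
    circ (Sum.inl i : Fin k ⊕ Fin k) < circ (Sum.inl j : Fin k ⊕ Fin k) ↔ i < j := Iff.rfl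

theorem circ_inl_lt_inr (i j : Fin k) :
    circ (Sum.inl i : Fin k ⊕ Fin k) < circ (Sum.inr j : Fin k ⊕ Fin k) := by
  have := i.2
  have := j.2
  simp only [circ, Sum.elim_inl, Sum.elim_inr]
  omega

theorem circ_inr_lt_inr {i j : Fin k} :
    circ (Sum.inr i : Fin k ⊕ Fin k) < circ (Sum.inr j : Fin k ⊕ Fin k) ↔ j < i := by
  have := i.2
  have := j.2
  rw [Fin.lt_def]
  simp only [circ, Sum.elim_inr]
  omega

/-- Planarity, by the number of the four vertices that lie in the top row. -/
theorem isPlanar_of_rows {d : Diagram k}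
    (h4 : ∀ a b c e : Fin k, a < b → b < c → c < e → d (Sum.inl a) (Sum.inl c) →
      d (Sum.inl b) (Sum.inl e) → d (Sum.inl a) (Sum.inl b))
    (h3 : ∀ a b c e : Fin k, a < b → b < c → d (Sum.inl a) (Sum.inl c) →
      d (Sum.inl b) (Sum.inr e) → d (Sum.inl a) (Sum.inl b))
    (h2 : ∀ a b c e : Fin k, a < b → e < c → d (Sum.inl a) (Sum.inr c) →
      ¬ d (Sum.inl b) (Sum.inr e))
    (h1 : ∀ a b c e : Fin k, e < c → c < b → d (Sum.inl a) (Sum.inr c) →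
      ¬ d (Sum.inr b) (Sum.inr e))
    (h0 : ∀ a b c : Fin k, c < b → b < a → ¬ d (Sum.inr a) (Sum.inr c)) : IsPlanar d := by
  intro a b c e hab hbc hce hac hbe
  have no : ∀ {i j : Fin k},
      circ (Sum.inr i : Fin k ⊕ Fin k) < circ (Sum.inl j : Fin k ⊕ Fin k) → False :=
    fun {i j} h => (circ_inl_lt_inr j i).not_gt h
  rcases a with a | a
  · rcases b with b | b
    · rcases c with c | c
      · rcases e with e | e
        · exact h4 a b c e hab hbc hce hac hbe
        · exact h3 a b c e hab hbc hac hbe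
      · rcases e with e | e
        · exact (no hce).elim
        · exact absurd hbe (h2 a b c e hab (circ_inr_lt_inr.1 hce) hac)
    · rcases c with c | c
      · exact (no hbc).elim
      · rcases e with e | e
        · exact (no hce).elim
        · exact absurd hbe (h1 a b c e (circ_inr_lt_inr.1 hce) (circ_inr_lt_inr.1 hbc) hac)
  · rcases b with b | b
    · exact (no hab).elim
    · rcases c with c | c
      · exact (no hbc).elim
      · exact absurd hac (h0 a b c (circ_inr_lt_inr.1 hbc) (circ_inr_lt_inr.1 hab))

theorem isPlanar_idemDiagram : IsPlanar (A.idemDiagram k m) := by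
  refine isPlanar_of_rows (fun a b c e hab hbc _ hac _ => ?_) (fun a b c e hab hbc hac _ => ?_)
    (fun a b c e hab hce hac hbe => ?_) (fun a b c e hec hcb hac hbe => ?_)
    fun a b c hcb hba hac => ?_
  · exact (row_pattern_adjacent (Family.idemDiagram_inl_inl.1 hac) (by omega)).elim
  · exact (row_pattern_adjacent (Family.idemDiagram_inl_inl.1 hac) (by omega)).elim
  · obtain ⟨rfl, -⟩ := Family.idemDiagram_inl_inr.1 hac
    obtain ⟨rfl, -⟩ := Family.idemDiagram_inl_inr.1 hbe
    exact lt_asymm hab hce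
  · exact row_pattern_adjacent (Family.idemDiagram_inr_inr.1 (Setoid.symm' _ hbe)) (by omega)
  · exact row_pattern_adjacent (Family.idemDiagram_inr_inr.1 (Setoid.symm' _ hac)) (by omega)

/-- Since `w` has blocks of size at most two, its propagating blocks are vertical edges.
Order-preserving attachment creates no crossing among them, and top arcs are unaffected. -/
theorem isPlanar_glue (hw : IsSymmetricDiagram m w) (hp : AtMostPairs w) (hpl : IsPlanar w) :
    IsPlanar (glue A w h 1) := by
  have hmax : ∀ a c : Fin k, glue A w h 1 (Sum.inl a) (Sum.inr c) →
      ∃ hc : (c : ℕ) < m, a = propMax w h ⟨c, hc⟩ := by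
    intro a c hac
    obtain ⟨hc, hac⟩ := glue_inl_inr.1 hac
    refine ⟨hc, ?_⟩
    have h3 := hw.inl_inr.2 ⟨hac, (isPropMax_propMax h _).1⟩
    simpa using hp _ _ _ hac h3
  refine isPlanar_of_rows (fun a b c e hab hbc hce hac hbe => ?_)
    (fun a b c e hab hbc hac hbe => ?_)
    (fun a b c e hab hce hac hbe => ?_) (fun a b c e hec hcb hac hbe => ?_)
    fun a b c hcb hba hac => ?_
  · exact glue_inl_inl.2 (hpl _ _ _ _ (circ_inl_lt_inl.2 hab) (circ_inl_lt_inl.2 hbc)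
      (circ_inl_lt_inl.2 hce) (glue_inl_inl.1 hac) (glue_inl_inl.1 hbe))
  -- The edge from `b` to its new bottom end is replaced by the vertical edge at `b` in `w`, where
  -- planarity applies.
  · have hb : IsProp w b := isProp_glue.1 ⟨e, hbe⟩
    exact glue_inl_inl.2 (hpl _ _ _ _ (circ_inl_lt_inl.2 hab) (circ_inl_lt_inl.2 hbc)
      (circ_inl_lt_inr c b) (glue_inl_inl.1 hac) (hw.2.2 b hb))
  · obtain ⟨hc, rfl⟩ := hmax _ _ hac
    obtain ⟨he, rfl⟩ := hmax _ _ hbe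
    exact lt_asymm ((propMax w h).lt_iff_lt.1 hab) hce
  · exact row_pattern_adjacent (glue_inr_inr.1 (Setoid.symm' _ hbe)) (by omega)
  · exact row_pattern_adjacent (glue_inr_inr.1 (Setoid.symm' _ hac)) (by omega)

/-- An inversion of `σ` would make two propagating blocks cross, so `σ` is strictly increasing on
`Fin m`. -/
theorem IsPlanar.eq_one_of_glue (hpl : IsPlanar (glue A w h σ)) : σ = 1 := by
  have hm : m ≤ k := h ▸ rank_le w
  have hmono : StrictMono σ := by
    intro i j hij
    by_contra hlt
    have hlt' : σ j < σ i := lt_of_le_of_ne (not_lt.1 hlt) (σ.injective.ne hij.ne')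
    have := hpl (Sum.inl (propMax w h (σ j))) (Sum.inl (propMax w h (σ i)))
      (Sum.inr (Fin.castLE hm j)) (Sum.inr (Fin.castLE hm i))
      (circ_inl_lt_inl.2 ((propMax w h).lt_iff_lt.2 hlt')) (circ_inl_lt_inr _ _)
      (circ_inr_lt_inr.2 hij) (glue_propMax j _ rfl) (glue_propMax i _ rfl)
    exact hlt'.ne ((propMax_rel_iff h).1 (glue_inl_inl.1 this))
  refine Equiv.ext fun i => ?_
  exact congrFun ((hmono.range_inj strictMono_id).1 (by simp)) i

theorem Family.idemDiagram_mem (hk : A.Parity → Even (k - m)) :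
    A.idemDiagram k m ∈ A.diagrams k := by
  cases A with
  | partition => trivial
  | brauer => exact isBrauer_idemDiagram trivial (hk trivial)
  | rookBrauer => exact isRookBrauer_iff.2 atMostPairs_idemDiagram
  | rook => exact isRook_idemDiagram id
  | temperleyLieb => exact ⟨isBrauer_idemDiagram trivial (hk trivial), isPlanar_idemDiagram⟩
  | motzkin => exact ⟨isRookBrauer_iff.2 atMostPairs_idemDiagram, isPlanar_idemDiagram⟩
  | planarRook => exact ⟨isRook_idemDiagram id, isPlanar_idemDiagram⟩

theorem Family.glue_mem (hk : A.Parity → Even (k - m)) (hw : IsSymmetricDiagram m w)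
    (hwA : w ∈ A.diagrams k) (hσ : A.Planar → σ = 1) : glue A w h σ ∈ A.diagrams k := by
  cases A with
  | partition => trivial
  | brauer => exact isBrauer_glue trivial (hk trivial) hw hwA
  | rookBrauer =>
    exact isRookBrauer_iff.2 (atMostPairs_glue hw (isRookBrauer_iff.1 hwA))
  | rook => exact isRook_glue id hwA
  | temperleyLieb =>
    obtain rfl := hσ trivial
    exact ⟨isBrauer_glue trivial (hk trivial) hw hwA.1,
      isPlanar_glue hw hwA.1.atMostPairs hwA.2⟩
  | motzkin =>
    obtain rfl := hσ trivial
    have hp := isRookBrauer_iff.1 hwA.1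
    exact ⟨isRookBrauer_iff.2 (atMostPairs_glue hw hp), isPlanar_glue hw hp hwA.2⟩
  | planarRook =>
    obtain rfl := hσ trivial
    exact ⟨isRook_glue id hwA.1, isPlanar_glue hw hwA.1.atMostPairs hwA.2⟩

theorem Family.eq_one_of_glue_mem (hA : A.Planar) (hmem : glue A w h σ ∈ A.diagrams k) :
    σ = 1 := by
  cases A with
  | partition => exact hA.elim
  | brauer => exact hA.elim
  | rookBrauer => exact hA.elim
  | rook => exact hA.elim
  | temperleyLieb => exact hmem.2.eq_one_of_glue
  | motzkin => exact hmem.2.eq_one_of_glue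
  | planarRook => exact hmem.2.eq_one_of_glue

end Glue

/-! ### The trace of a monomial operator on an induced module -/

section Trace

/-- The matrix of `F` has one nonzero block in each block column, and this block is diagonal exactly
when `act w = w`. -/
theorem trace_pi_monomial {W M : Type*} [Fintype W] [DecidableEq W] [AddCommGroup M] [Module ℂ M]
    [FiniteDimensional ℂ M] (F : (W → M) →ₗ[ℂ] (W → M)) (act : W → W) (T : W → M →ₗ[ℂ] M)
    (hF : ∀ w x, F (Pi.single w x) = Pi.single (act w) (T w x)) :
    LinearMap.trace ℂ (W → M) F = ∑ w, if act w = w then LinearMap.trace ℂ M (T w) else 0 := by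
  let b := Module.finBasis ℂ M
  rw [LinearMap.trace_eq_matrix_trace ℂ (Pi.basis fun _ : W => b) F]
  simp only [Matrix.trace, Matrix.diag_apply, LinearMap.toMatrix_apply]
  rw [Fintype.sum_sigma]
  refine Finset.sum_congr rfl fun w _ => ?_
  simp only [Pi.basis_apply, Pi.basis_repr, hF]
  split_ifs with h
  · rw [LinearMap.trace_eq_matrix_trace ℂ b]
    simp only [Matrix.trace, Matrix.diag_apply, LinearMap.toMatrix_apply]
    refine Finset.sum_congr rfl fun i _ => ?_
    rw [h, Pi.single_eq_same]
  · refine Finset.sum_eq_zero fun i _ => ?_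
    rw [Pi.single_eq_of_ne (Ne.symm h)]
    simp

variable {P G W : Type*} [Ring P] [Algebra ℂ P] {B : Subalgebra ℂ P} {J : Submodule B P}
  [Group G] [Fintype W] {t : W → P} {ι : MonoidAlgebra ℂ G →ₐ[ℂ] P}
  {N : Submodule (MonoidAlgebra ℂ G) (MonoidAlgebra ℂ G)}

instance [Finite G] : FiniteDimensional ℂ (MonoidAlgebra ℂ G) :=
  Module.Finite.equiv (MonoidAlgebra.coeffLinearEquiv ℂ).symm

/-- The hypotheses identify `V` with the induced space `W → N` via `x ↦ ∑ t w * ι (x w)`. There `a`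
permutes the coordinates by `act` and twists them by `τ`, so `trace_pi_monomial` applies. -/
theorem moduleChar_eq_sum_fixed [Finite G] [DecidableEq W] {V : Submodule B (P ⧸ J)}
    (hV : ∀ v, v ∈ V ↔ ∃ x : W → N, v = J.mkQ (∑ w, t w * ι (x w)))
    (hinj : ∀ x : W → MonoidAlgebra ℂ G, ∑ w, t w * ι (x w) ∈ J → x = 0)
    (a : B) (act : W → W) (τ : W → G)
    (ha : ∀ w, (a : P) * t w = t (act w) * ι (MonoidAlgebra.single (τ w) 1)) :
    moduleChar B V a = ∑ w, if act w = w then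
      moduleChar (MonoidAlgebra ℂ G) N (MonoidAlgebra.single (τ w) 1) else 0 := by
  have : FiniteDimensional ℂ N :=
    Module.Finite.of_injective (N.subtype.restrictScalars ℂ) Subtype.val_injective
  let Φ : (W → N) →ₗ[ℂ] V :=
    { toFun := fun x => ⟨J.mkQ (∑ w, t w * ι (x w)), (hV _).2 ⟨x, rfl⟩⟩
      map_add' := fun x y => by
        apply Subtype.ext
        simp only [Pi.add_apply, Submodule.coe_add, map_add, mul_add, Finset.sum_add_distrib]
      map_smul' := fun c x => by
        apply Subtype.ext
        have : ∑ w, t w * ι (((c • x) w : N) : MonoidAlgebra ℂ G) =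
            c • ∑ w, t w * ι (x w : MonoidAlgebra ℂ G) := by
          rw [Finset.smul_sum]
          refine Finset.sum_congr rfl fun w _ => ?_
          rw [← mul_smul_comm, ← map_smul]
          rfl
        simp only [this]
        rfl }
  have hΦ : Function.Bijective Φ := by
    constructor
    · rw [injective_iff_map_eq_zero]
      intro x hx
      have h1 : J.mkQ (∑ w, t w * ι (x w)) = 0 := congrArg Subtype.val hx
      rw [Submodule.mkQ_apply, Submodule.Quotient.mk_eq_zero] at h1
      have h2 := hinj (fun w => x w) h1
      funext w
      exact Subtype.ext (congrFun h2 w)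
    · rintro ⟨v, hv⟩
      obtain ⟨x, rfl⟩ := (hV v).1 hv
      exact ⟨x, rfl⟩
  let e : (W → N) ≃ₗ[ℂ] V := LinearEquiv.ofBijective Φ hΦ
  unfold moduleChar
  rw [← LinearMap.trace_conj' (Algebra.lsmul ℂ ℂ V a) e.symm]
  refine trace_pi_monomial _ act (fun w => Algebra.lsmul ℂ ℂ N (MonoidAlgebra.single (τ w) 1)) ?_
  intro w x
  rw [LinearEquiv.conj_apply_apply, LinearEquiv.symm_symm, LinearEquiv.symm_apply_eq]
  have hsingle : ∀ (w : W) (x : N), ∑ v, t v * ι ((Pi.single w x : W → N) v) = t w * ι x := by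
    intro w x
    rw [Finset.sum_eq_single w]
    · rw [Pi.single_eq_same]
    · intro v _ hv
      rw [Pi.single_eq_of_ne hv]
      simp
    · simp
  apply Subtype.ext
  change a • J.mkQ (∑ v, t v * ι ((Pi.single w x : W → N) v)) =
    J.mkQ (∑ v, t v * ι ((Pi.single (act w) (MonoidAlgebra.single (τ w) (1 : ℂ) • x) : W → N) v))
  rw [hsingle, hsingle, ← map_smul]
  congr 1
  change (a : P) * (t w * ι x) = t (act w) * ι (MonoidAlgebra.single (τ w) 1 * (x : MonoidAlgebra ℂ G))
  rw [← mul_assoc, ha, map_mul, mul_assoc]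

/-- This is what makes the module induced: modulo `J`, the left ideal `B q` is `∑ t w * ι N` with
`N` the left ideal generated by `p`. One inclusion holds because the right-hand side is stable under
the generators `S` and contains `q`. For the other, each `t w * ι g` lies in `B` and recovers
itself, up to a nonzero scalar, after multiplication by `e`. -/
theorem mem_map_span_iff {S : Set P} (hB : B = Algebra.adjoin ℂ S) {q : P}
    {p : MonoidAlgebra ℂ G} (e : P) (hq : q = ι p * e) (hcomm : ∀ g, Commute (ι g) e)
    (hS : ∀ d ∈ S, ∀ w, ∃ (c : ℂ) (w' : W) (g : MonoidAlgebra ℂ G),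
      d * t w - c • (t w' * ι g) ∈ J)
    (hJ : ∀ x ∈ J, ∀ g, x * ι g ∈ J)
    (htB : ∀ w g, t w * ι (MonoidAlgebra.single g 1) ∈ B)
    (hte : ∀ w g, ∃ c : ℂ, c ≠ 0 ∧ t w * ι (MonoidAlgebra.single g 1) * e =
      c • (t w * ι (MonoidAlgebra.single g 1)))
    (he : ∃ (c : ℂ) (w : W) (g : MonoidAlgebra ℂ G), e = c • (t w * ι g)) (v : P ⧸ J) :
    v ∈ Submodule.map J.mkQ (Submodule.span B {q}) ↔
      ∃ x : W → Submodule.span (MonoidAlgebra ℂ G) {p}, v = J.mkQ (∑ w, t w * ι (x w)) := by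
  classical
  subst hB
  set N := Submodule.span (MonoidAlgebra ℂ G) {p} with hN
  have hsmul : ∀ (c : ℂ) {x : P}, x ∈ J → c • x ∈ J := by
    intro c x hx
    have := J.smul_mem (algebraMap ℂ (Algebra.adjoin ℂ S) c) hx
    rwa [algebraMap_smul] at this
  have hsingle : ∀ (w : W) (x : N), ∑ v, t v * ι ((Pi.single w x : W → N) v) = t w * ι x := by
    intro w x
    rw [Finset.sum_eq_single w]
    · rw [Pi.single_eq_same]
    · intro v _ hv
      rw [Pi.single_eq_of_ne hv]
      simp
    · simp
  -- Representatives in `P` of the claimed image, `J` included.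
  let Z : Submodule ℂ P :=
    { carrier := {z | ∃ x : W → N, z - ∑ w, t w * ι (x w) ∈ J}
      zero_mem' := ⟨0, by simp⟩
      add_mem' := by
        rintro y z ⟨x, hx⟩ ⟨x', hx'⟩
        refine ⟨x + x', ?_⟩
        have := J.add_mem hx hx'
        simp only [Pi.add_apply, Submodule.coe_add, map_add, mul_add, Finset.sum_add_distrib]
        rwa [add_sub_add_comm]
      smul_mem' := by
        rintro c z ⟨x, hx⟩
        refine ⟨c • x, ?_⟩
        have h2 := hsmul c hx
        rw [smul_sub, Finset.smul_sum] at h2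
        convert h2 using 4 with w
        rw [← mul_smul_comm, ← map_smul]
        rfl }
  have hJZ : ∀ x ∈ J, x ∈ Z := fun x hx => ⟨0, by simpa using hx⟩
  have htZ : ∀ (w : W) (x : MonoidAlgebra ℂ G), x ∈ N → t w * ι x ∈ Z := by
    intro w x hx
    refine ⟨Pi.single w ⟨x, hx⟩, ?_⟩
    rw [hsingle, sub_self]
    exact J.zero_mem
  have hstable : ∀ a ∈ Algebra.adjoin ℂ S, ∀ z ∈ Z, a * z ∈ Z := by
    intro a ha
    induction ha using Algebra.adjoin_induction with
    | mem d hd =>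
      rintro z ⟨x, hx⟩
      have h1 : d * (z - ∑ w, t w * ι (x w)) ∈ J :=
        J.smul_mem ⟨d, Algebra.subset_adjoin hd⟩ hx
      rw [← sub_add_cancel z (∑ w, t w * ι (x w)), mul_add, Finset.mul_sum]
      refine Z.add_mem (hJZ _ h1) (Z.sum_mem fun w _ => ?_)
      obtain ⟨c, w', g, hc⟩ := hS d hd w
      have h2 := hJ _ hc (x w)
      rw [sub_mul, smul_mul_assoc, mul_assoc (t w'), ← map_mul, mul_assoc d] at h2
      rw [← sub_add_cancel (d * (t w * ι (x w))) (c • (t w' * ι (g * x w)))]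
      exact Z.add_mem (hJZ _ h2) (Z.smul_mem c (htZ _ _ (N.smul_mem g (x w).2)))
    | algebraMap r =>
      intro z hz
      rw [← Algebra.smul_def]
      exact Z.smul_mem r hz
    | add a b _ _ ha hb =>
      intro z hz
      rw [add_mul]
      exact Z.add_mem (ha z hz) (hb z hz)
    | mul a b _ _ ha hb =>
      intro z hz
      rw [mul_assoc]
      exact ha _ (hb z hz)
  have hp : p ∈ N := Submodule.mem_span_singleton_self p
  have hqZ : q ∈ Z := by
    obtain ⟨c, w, g, rfl⟩ := he
    rw [hq, (hcomm p).eq, smul_mul_assoc, mul_assoc, ← map_mul]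
    exact Z.smul_mem c (htZ _ _ (N.smul_mem g hp))
  constructor
  · rintro ⟨y, hy, rfl⟩
    obtain ⟨a, rfl⟩ := Submodule.mem_span_singleton.1 hy
    obtain ⟨x, hx⟩ := hstable a.1 a.2 q hqZ
    refine ⟨x, ?_⟩
    rw [Submodule.mkQ_apply, Submodule.mkQ_apply, Submodule.Quotient.eq]
    exact hx
  · rintro ⟨x, rfl⟩
    refine Submodule.mem_map_of_mem (Submodule.sum_mem _ fun w _ => ?_)
    obtain ⟨y, hy⟩ := Submodule.mem_span_singleton.1 (x w).2
    rw [← hy, smul_eq_mul, map_mul]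
    clear hy
    induction y using MonoidAlgebra.induction_linear with
    | zero => simp
    | add f g hf hg =>
      rw [map_add, add_mul, mul_add]
      exact Submodule.add_mem _ hf hg
    | single g r =>
      obtain ⟨c, hc, hcg⟩ := hte w g
      have hr : MonoidAlgebra.single g r = r • MonoidAlgebra.single g (1 : ℂ) := by simp
      -- As `e` commutes with `ι p`, the product of `t w * ι g` with `q` is `c • (t w * ι g * ι p)`;
      -- the factor `c⁻¹` compensates.
      have : t w * (ι (MonoidAlgebra.single g r) * ι p) =
          (algebraMap ℂ (Algebra.adjoin ℂ S) (r * c⁻¹) *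
            ⟨t w * ι (MonoidAlgebra.single g 1), htB w g⟩ : Algebra.adjoin ℂ S) • q := by
        rw [mul_smul, algebraMap_smul]
        change _ = (r * c⁻¹) • (t w * ι (MonoidAlgebra.single g 1) * q)
        rw [hq, (hcomm p).eq, ← mul_assoc _ e, hcg, smul_mul_assoc, smul_smul, mul_assoc r,
          inv_mul_cancel₀ hc, mul_one, hr, map_smul, smul_mul_assoc, mul_smul_comm, mul_assoc]
      rw [this]
      exact Submodule.smul_mem _ _ (Submodule.mem_span_singleton_self q)

end Trace

/-! ### Cycle types and characters of symmetric groups -/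

section Symmetric

theorem cycleType_viaEmbedding {α β : Type*} [Fintype α] [DecidableEq α] [Fintype β] [DecidableEq β]
    (σ : Equiv.Perm α) (f : α ↪ β) : (σ.viaEmbedding f).cycleType = σ.cycleType := by
  classical
  unfold Equiv.Perm.viaEmbedding
  convert Equiv.Perm.cycleType_extendDomain (Equiv.ofInjective f.1 f.2)

/-- A juxtaposition is the product of two disjoint permutations, each extended by fixed points. -/
theorem cycleType_permCongr_sumCongr {α β γ : Type*} [Fintype α] [DecidableEq α] [Fintype β]
    [DecidableEq β] [Fintype γ] [DecidableEq γ] (e : α ⊕ β ≃ γ) (σ : Equiv.Perm α)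
    (τ : Equiv.Perm β) :
    (e.permCongr (Equiv.Perm.sumCongr σ τ)).cycleType = σ.cycleType + τ.cycleType := by
  set f : α ↪ γ := ⟨fun a => e (Sum.inl a), e.injective.comp Sum.inl_injective⟩
  set g : β ↪ γ := ⟨fun b => e (Sum.inr b), e.injective.comp Sum.inr_injective⟩
  have hfg : ∀ b, g b ∉ Set.range f := by
    rintro b ⟨a, ha⟩
    cases e.injective ha
  have hgf : ∀ a, f a ∉ Set.range g := by
    rintro a ⟨b, hb⟩
    cases e.injective hb
  have heq : e.permCongr (Equiv.Perm.sumCongr σ τ) = σ.viaEmbedding f * τ.viaEmbedding g := by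
    refine Equiv.ext fun c => ?_
    obtain ⟨a | b, rfl⟩ := e.surjective c
    · rw [Equiv.Perm.mul_apply]
      have h1 : τ.viaEmbedding g (e (Sum.inl a)) = e (Sum.inl a) :=
        Equiv.Perm.viaEmbedding_apply_of_notMem τ g _ (hgf a)
      have h2 : σ.viaEmbedding f (e (Sum.inl a)) = e (Sum.inl (σ a)) :=
        Equiv.Perm.viaEmbedding_apply σ f a
      rw [h1, h2]
      simp
    · rw [Equiv.Perm.mul_apply]
      have h1 : τ.viaEmbedding g (e (Sum.inr b)) = e (Sum.inr (τ b)) :=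
        Equiv.Perm.viaEmbedding_apply τ g b
      have h2 : σ.viaEmbedding f (e (Sum.inr (τ b))) = e (Sum.inr (τ b)) :=
        Equiv.Perm.viaEmbedding_apply_of_notMem σ f _ (hfg _)
      rw [h1, h2]
      simp
  have hdisj : (σ.viaEmbedding f).Disjoint (τ.viaEmbedding g) := by
    intro c
    obtain ⟨a | b, rfl⟩ := e.surjective c
    · exact Or.inr (Equiv.Perm.viaEmbedding_apply_of_notMem τ g _ (hgf a))
    · exact Or.inl (Equiv.Perm.viaEmbedding_apply_of_notMem σ f _ (hfg b))
  rw [heq, hdisj.cycleType_mul, cycleType_viaEmbedding, cycleType_viaEmbedding]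

theorem cycleType_cycles (L : List ℕ) :
    (cycles L).cycleType = (L : Multiset ℕ).filter (2 ≤ ·) := by
  induction L with
  | nil => exact Equiv.Perm.cycleType_one
  | cons r L ih =>
    unfold cycles
    rw [cycleType_permCongr_sumCongr, ih, Equiv.Perm.cycleType_inv, ← Multiset.cons_coe]
    by_cases hr : 2 ≤ r
    · rw [Multiset.filter_cons_of_pos _ hr, cycleType_finRotate_of_le hr,
        Multiset.singleton_add]
    · rw [Multiset.filter_cons_of_neg _ hr]
      have : (finRotate r).cycleType = 0 := by
        rw [Equiv.Perm.cycleType_eq_zero]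
        refine Equiv.ext fun i => ?_
        obtain rfl | rfl : r = 0 ∨ r = 1 := by omega
        · exact i.elim0
        · exact Subsingleton.elim _ _
      rw [this, zero_add]

theorem cycleType_permCongr_finCongr {a b : ℕ} (h : a = b) (σ : Equiv.Perm (Fin a)) :
    ((finCongr h).permCongr σ).cycleType = σ.cycleType := by
  subst h
  rfl

theorem cycleType_gamma {m : ℕ} (μ : m.Partition) :
    (gamma μ).cycleType = μ.parts.filter (2 ≤ ·) := by
  unfold gamma
  rw [cycleType_permCongr_finCongr, cycleType_cycles, partsList, Multiset.sort_eq]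

/-- `Equiv.Perm.cycleType` forgets fixed points; the total size restores the number of parts equal
to one. -/
theorem parts_eq_of_filter_eq {s t : Multiset ℕ} (hs : ∀ i ∈ s, 0 < i) (ht : ∀ i ∈ t, 0 < i)
    (hsum : s.sum = t.sum) (h : s.filter (2 ≤ ·) = t.filter (2 ≤ ·)) : s = t := by
  have key : ∀ s : Multiset ℕ, (∀ i ∈ s, 0 < i) → ∃ c, s = s.filter (2 ≤ ·) +
      Multiset.replicate c 1 := by
    intro s hs
    refine ⟨(s.filter fun i => ¬ 2 ≤ i).card, ?_⟩
    conv_lhs => rw [← Multiset.filter_add_not (2 ≤ ·) s]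
    congr 1
    rw [Multiset.eq_replicate]
    refine ⟨rfl, fun i hi => ?_⟩
    rw [Multiset.mem_filter] at hi
    have := hs i hi.1
    omega
  obtain ⟨c, hc⟩ := key s hs
  obtain ⟨c', hc'⟩ := key t ht
  have h1 := congrArg Multiset.sum hc
  have h2 := congrArg Multiset.sum hc'
  rw [Multiset.sum_add, Multiset.sum_replicate, smul_eq_mul, mul_one] at h1 h2
  rw [h] at h1
  have : c = c' := by omega
  rw [hc, hc', h, this]

theorem hasCycleType_gamma {m : ℕ} (μ : m.Partition) : HasCycleType (gamma μ) μ := by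
  refine parts_eq_of_filter_eq (fun i hi => (gamma μ).partition.parts_pos hi)
    (fun i hi => μ.parts_pos hi) ?_ ?_
  · rw [(gamma μ).partition.parts_sum, μ.parts_sum, Fintype.card_fin]
  · rw [Equiv.Perm.filter_parts_partition_eq_cycleType, cycleType_gamma]

theorem symChar_congr {m : ℕ} (μ : m.Partition) {σ τ : Equiv.Perm (Fin m)} (h : IsConj σ τ) :
    symChar μ σ = symChar μ τ := by
  obtain ⟨g, rfl⟩ := isConj_iff.1 h
  unfold symChar moduleChar
  have : MonoidAlgebra.single (g * σ * g⁻¹) (1 : ℂ) =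
      MonoidAlgebra.single g 1 * (MonoidAlgebra.single σ 1 * MonoidAlgebra.single g⁻¹ 1) := by
    simp [MonoidAlgebra.single_mul_single, mul_assoc]
  rw [this, map_mul, LinearMap.trace_mul_comm, ← map_mul, mul_assoc,
    MonoidAlgebra.single_mul_single]
  simp [MonoidAlgebra.single_mul_single]

theorem symChar_gamma {m : ℕ} (ν μ : m.Partition) {σ : Equiv.Perm (Fin m)}
    (h : HasCycleType σ μ) : symChar ν (gamma μ) = symChar ν σ := by
  refine symChar_congr ν (Equiv.Perm.partition_eq_of_isConj.2 ?_)
  exact Nat.Partition.ext ((hasCycleType_gamma μ).trans h.symm)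

theorem boxOf_indiscrete {m : ℕ} (x : Fin m) :
    boxOf (Nat.Partition.indiscrete m) x = (0, (x : ℕ)) := by
  have hm : m ≠ 0 := fun h => (h ▸ x).elim0
  have : columnWord (Nat.Partition.indiscrete m) = (List.range m).map fun j => (0, j) := by
    unfold columnWord
    rw [Nat.Partition.indiscrete_parts hm, List.map_eq_flatMap]
    refine List.flatMap_congr fun j hj => ?_
    have : Multiset.countP (j < ·) {m} = 1 := by
      rw [Multiset.countP_eq_card_filter, Multiset.filter_singleton,
        if_pos (List.mem_range.1 hj), Multiset.card_singleton]
    rw [this]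
    rfl
  unfold boxOf
  rw [this]
  simp

theorem youngSymmetrizer_indiscrete (m : ℕ) {V : Type*} [AddCommGroup V] [Module ℂ V]
    (f : Equiv.Perm (Fin m) → V) :
    youngSymmetrizer (Nat.Partition.indiscrete m) f = ∑ ρ, f ρ := by
  have hcol : columnGroup (Nat.Partition.indiscrete m) = {1} := by
    ext σ
    simp only [columnGroup, Finset.mem_filter_univ, boxOf_indiscrete, Fin.val_inj,
      Finset.mem_singleton]
    exact ⟨fun h => Equiv.ext h, fun h => by simp [h]⟩
  have hrow : rowGroup (Nat.Partition.indiscrete m) = Finset.univ := by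
    ext σ
    simp [rowGroup, boxOf_indiscrete]
  simp [youngSymmetrizer, hcol, hrow]

/-- For a single row the Young symmetrizer is the sum of all permutations, which spans a line with
trivial action. This is the factor needed for the planar families. -/
theorem symChar_indiscrete {m : ℕ} (σ : Equiv.Perm (Fin m)) :
    symChar (Nat.Partition.indiscrete m) σ = 1 := by
  set p : MonoidAlgebra ℂ (Equiv.Perm (Fin m)) :=
    youngSymmetrizer (Nat.Partition.indiscrete m) fun σ => MonoidAlgebra.single σ 1 with hp
  have hsum : p = ∑ ρ : Equiv.Perm (Fin m), MonoidAlgebra.single ρ 1 :=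
    youngSymmetrizer_indiscrete m _
  have hmul : ∀ g : Equiv.Perm (Fin m), MonoidAlgebra.single g 1 * p = p := by
    intro g
    rw [hsum, Finset.mul_sum]
    simp only [MonoidAlgebra.single_mul_single, mul_one]
    exact Fintype.sum_equiv (Equiv.mulLeft g) _ _ fun _ => rfl
  have hp0 : p ≠ 0 := by
    intro h0
    have h1 := congrArg (fun x : MonoidAlgebra ℂ (Equiv.Perm (Fin m)) => x.coeff 1) h0
    rw [hsum] at h1
    simp [MonoidAlgebra.coeff_sum, Finsupp.single_apply] at h1
  have hsmul : ∀ a : MonoidAlgebra ℂ (Equiv.Perm (Fin m)), ∃ c : ℂ, a * p = c • p := by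
    intro a
    induction a using MonoidAlgebra.induction_linear with
    | zero => exact ⟨0, by simp⟩
    | add f g hf hg =>
      obtain ⟨c, hc⟩ := hf
      obtain ⟨c', hc'⟩ := hg
      exact ⟨c + c', by rw [add_mul, hc, hc', add_smul]⟩
    | single g r =>
      refine ⟨r, ?_⟩
      have hr : MonoidAlgebra.single g r = r • MonoidAlgebra.single g (1 : ℂ) := by simp
      rw [hr, smul_mul_assoc, hmul]
  have hmem : p ∈ spechtModule (Nat.Partition.indiscrete m) :=
    Submodule.mem_span_singleton_self _
  have hrank : Module.finrank ℂ (spechtModule (Nat.Partition.indiscrete m)) = 1 := by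
    refine finrank_eq_one ⟨p, hmem⟩ (fun h => hp0 (congrArg Subtype.val h)) ?_
    rintro ⟨w, hw⟩
    obtain ⟨a, rfl⟩ := Submodule.mem_span_singleton.1 hw
    obtain ⟨c, hc⟩ := hsmul a
    exact ⟨c, Subtype.ext hc.symm⟩
  unfold symChar moduleChar
  have hid : Algebra.lsmul ℂ ℂ (spechtModule (Nat.Partition.indiscrete m))
      (MonoidAlgebra.single σ (1 : ℂ)) = LinearMap.id := by
    refine LinearMap.ext ?_
    rintro ⟨w, hw⟩
    obtain ⟨a, rfl⟩ := Submodule.mem_span_singleton.1 hw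
    apply Subtype.ext
    change MonoidAlgebra.single σ 1 * (a * p) = a * p
    obtain ⟨c, hc⟩ := hsmul a
    rw [hc, mul_smul_comm, hmul]
  rw [hid, LinearMap.trace_id, hrank, Nat.cast_one]

end Symmetric

/-! ### The irreducible modules as induced modules -/

section Irreducible

variable {k m : ℕ}

instance : Finite (Diagram k) :=
  Finite.of_injective (fun d : Diagram k => (d : Fin k ⊕ Fin k → Fin k ⊕ Fin k → Prop))
    fun _ _ h => Setoid.ext fun a b => iff_of_eq (congrFun (congrFun h a) b)

theorem comp_permDiagram_permDiagram (σ τ : Equiv.Perm (Fin k)) :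
    comp (permDiagram k σ) (permDiagram k τ) = permDiagram k (σ * τ) := by
  rw [comp_permDiagram_right]
  ext a b
  rw [Setoid.comap_rel, permDiagram_apply, permDiagram_apply]
  rcases a with a | a <;> rcases b with b | b <;> rfl

/-- Multiplication by `e_m` on the right fixes the diagrams with the bottom half of `e_m`. -/
theorem IsBot.comp_idemDiagram {A : Family} {d : Diagram k} (hd : IsBot A m d) :
    DiagAlg.comp d (A.idemDiagram k m) = d := by
  classical
  apply le_antisymm
  · let f : Rows k → Quotient d ⊕ Quotient d :=
      Sum.elim (fun x => Sum.inl (Quotient.mk d (Sum.inl x)))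
        (Sum.elim (fun j => Sum.inl (Quotient.mk d (Sum.inr j)))
          (fun j => if (j : ℕ) < m then Sum.inl (Quotient.mk d (Sum.inr j))
            else Sum.inr (Quotient.mk d (Sum.inr j))))
    have hle : stack d (A.idemDiagram k m) ≤ Setoid.ker f := by
      refine stack_le_iff.2 ⟨fun a b hab => ?_, fun a b hab => ?_⟩
      · rw [Setoid.ker_def]
        have h1 : (Quotient.mk d a) = Quotient.mk d b := Quotient.sound hab
        rcases a with a | a <;> rcases b with b | b <;> exact congrArg Sum.inl h1
      · rw [Setoid.ker_def]
        have hcross : ∀ i j : Fin k, A.idemDiagram k m (Sum.inl i) (Sum.inr j) →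
            f (lower (Sum.inl i)) = f (lower (Sum.inr j)) := by
          intro i j hij
          obtain ⟨rfl, hi⟩ := Family.idemDiagram_inl_inr.1 hij
          simp [f, lower, hi]
        rcases a with a | a <;> rcases b with b | b
        · have h1 : d (Sum.inr a) (Sum.inr b) := (hd.1 a b).2
            (Family.idemDiagram_inr_inr.2 (Family.idemDiagram_inl_inl.1 hab))
          exact congrArg Sum.inl (Quotient.sound h1)
        · exact hcross a b hab
        · exact (hcross b a (Setoid.symm' _ hab)).symm
        · have h1 : Quotient.mk d (Sum.inr a) = Quotient.mk d (Sum.inr b) :=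
            Quotient.sound ((hd.1 a b).2 hab)
          rcases Family.idemDiagram_inr_inr.1 hab with rfl | ⟨ha, hb, -⟩
          · rfl
          · simp [f, lower, ha.not_gt, hb.not_gt, h1]
    have hcross : ∀ x j : Fin k, f (outer (Sum.inl x)) = f (outer (Sum.inr j)) →
        d (Sum.inl x) (Sum.inr j) := by
      intro x j hxj
      by_cases hj : (j : ℕ) < m
      · simp only [f, outer, Sum.map_inl, Sum.map_inr, Sum.elim_inl, Sum.elim_inr, hj, if_true,
          id] at hxj
        exact Quotient.exact (Sum.inl_injective hxj)
      · simp [f, outer, hj] at hxj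
    intro a b hab
    have h1 : f (outer a) = f (outer b) := hle hab
    rcases a with a | a <;> rcases b with b | b
    · exact Quotient.exact (Sum.inl_injective h1)
    · exact hcross a b h1
    · exact d.symm (hcross b a h1.symm)
    · by_cases ha : (a : ℕ) < m <;> by_cases hb : (b : ℕ) < m <;>
        simp only [f, outer, Sum.map_inr, Sum.elim_inr, ha, hb, if_true, if_false,
          reduceCtorEq] at h1
      · exact Quotient.exact (Sum.inl_injective h1)
      · exact Quotient.exact (Sum.inr_injective h1)
  · have hcross : ∀ x j : Fin k, d (Sum.inl x) (Sum.inr j) →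
        DiagAlg.comp d (A.idemDiagram k m) (Sum.inl x) (Sum.inr j) := by
      intro x j hxj
      refine (stack _ _).trans (stack_upper _ hxj) (stack_lower d (a := Sum.inl j)
        (b := Sum.inr j) (Family.idemDiagram_inl_inr.2 ⟨rfl, (hd.2 j).1 ⟨x, hxj⟩⟩))
    intro a b hab
    rcases a with a | a <;> rcases b with b | b
    · exact stack_upper _ hab
    · exact hcross a b hab
    · exact Setoid.symm' _ (hcross b a (d.symm hab))
    · exact stack_lower d (a := Sum.inr a) (b := Sum.inr b) ((hd.1 a b).1 hab)

theorem extPerm_lt_iff (hm : m ≤ k) (σ : Equiv.Perm (Fin m)) (j : Fin k) :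
    (extPerm hm σ j : ℕ) < m ↔ (j : ℕ) < m := by
  by_cases hj : (j : ℕ) < m
  · have := extPerm_castLE hm σ ⟨j, hj⟩
    rw [show Fin.castLE hm ⟨j, hj⟩ = j from rfl] at this
    simp [this, hj]
  · rw [extPerm_of_le hm σ (not_lt.1 hj)]

theorem row_pattern_extPerm {A : Family} (hm : m ≤ k) (σ : Equiv.Perm (Fin m)) (i j : Fin k) :
    (extPerm hm σ i = extPerm hm σ j ∨ (m ≤ (extPerm hm σ i : ℕ) ∧ m ≤ (extPerm hm σ j : ℕ) ∧
      A.tailLabel m (extPerm hm σ i) = A.tailLabel m (extPerm hm σ j))) ↔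
      (i = j ∨ (m ≤ (i : ℕ) ∧ m ≤ (j : ℕ) ∧ A.tailLabel m i = A.tailLabel m j)) := by
  refine or_congr (extPerm hm σ).injective.eq_iff ?_
  rw [← not_lt, ← not_lt, extPerm_lt_iff, extPerm_lt_iff, not_lt, not_lt]
  constructor
  · rintro ⟨hi, hj, h⟩
    rw [extPerm_of_le hm σ hi, extPerm_of_le hm σ hj] at h
    exact ⟨hi, hj, h⟩
  · rintro ⟨hi, hj, h⟩
    rw [extPerm_of_le hm σ hi, extPerm_of_le hm σ hj]
    exact ⟨hi, hj, h⟩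

theorem Family.permDiagram_comp_idemDiagram (A : Family) (hm : m ≤ k) (σ : Equiv.Perm (Fin m)) :
    comp (permDiagram k (extPerm hm σ)) (A.idemDiagram k m) =
      comp (A.idemDiagram k m) (permDiagram k (extPerm hm σ)) := by
  rw [comp_permDiagram_left, comp_permDiagram_right]
  have hsymm : ∀ i, (extPerm hm σ).symm i = extPerm hm σ⁻¹ i := by
    intro i
    rw [map_inv]
    rfl
  have hcross : ∀ a b : Fin k, A.idemDiagram k m (Sum.inl ((extPerm hm σ).symm a)) (Sum.inr b) ↔
      A.idemDiagram k m (Sum.inl a) (Sum.inr (extPerm hm σ b)) := by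
    intro a b
    rw [Family.idemDiagram_inl_inr, Family.idemDiagram_inl_inr, extPerm_lt_iff,
      Equiv.symm_apply_eq]
  ext a b
  rw [Setoid.comap_rel, Setoid.comap_rel]
  rcases a with a | a <;> rcases b with b | b
  · refine Family.idemDiagram_inl_inl.trans (Iff.trans ?_ Family.idemDiagram_inl_inl.symm)
    rw [hsymm, hsymm]
    exact row_pattern_extPerm hm σ⁻¹ a b
  · exact hcross a b
  · exact (Setoid.comm' _).trans ((hcross b a).trans (Setoid.comm' _))
  · exact Family.idemDiagram_inr_inr.trans ((row_pattern_extPerm hm σ a b).symm.trans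
      Family.idemDiagram_inr_inr.symm)

/-! ### Conjugates and twists -/

theorem rank_conj_permDiagram (γ : Equiv.Perm (Fin k)) (w : Diagram k) :
    rank (conj (permDiagram k γ) w) = rank w := by
  unfold conj
  rw [transpose_permDiagram, rank_comp_permDiagram_right, rank_comp_permDiagram_left]

theorem isProp_conj_permDiagram {γ : Equiv.Perm (Fin k)} {w : Diagram k} {x : Fin k} :
    IsProp (conj (permDiagram k γ) w) x ↔ IsProp w (γ.symm x) := by
  rw [conj_permDiagram]
  constructor
  · rintro ⟨j, hj⟩
    exact ⟨γ.symm j, hj⟩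
  · rintro ⟨j, hj⟩
    refine ⟨γ j, ?_⟩
    rw [Setoid.comap_rel]
    simpa using hj

theorem IsSymmetricDiagram.conj {w : Diagram k} (hw : IsSymmetricDiagram m w)
    (γ : Equiv.Perm (Fin k)) : IsSymmetricDiagram m (conj (permDiagram k γ) w) := by
  refine ⟨?_, (rank_conj_permDiagram γ w).trans hw.2.1, fun i hi => ?_⟩
  · rw [conj_permDiagram]
    ext a b
    refine Iff.trans ?_ (iff_of_eq (congrArg (fun d : Diagram k =>
      d (Sum.map γ.symm γ.symm a) (Sum.map γ.symm γ.symm b)) hw.1))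
    rcases a with a | a <;> rcases b with b | b <;> rfl
  · have h := hw.2.2 _ (isProp_conj_permDiagram.1 hi)
    rw [conj_permDiagram]
    exact h

/-- `IsTwist` is a relation; uniqueness lets the twist found in the multiplication be identified
with the one in `fixedDiagrams`. -/
theorem IsTwist.eq {γ : Equiv.Perm (Fin k)} {w : Diagram k} (hw : rank w = m)
    {σ τ : Equiv.Perm (Fin m)} (hσ : IsTwist (permDiagram k γ) w σ)
    (hτ : IsTwist (permDiagram k γ) w τ) : σ = τ := by
  have hr : rank (conj (permDiagram k γ) w) = m := (rank_conj_permDiagram γ w).trans hw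
  refine Equiv.ext fun i => ?_
  obtain ⟨x, y, hx, hy, hxy⟩ := hσ i
  obtain ⟨x', y', hx', hy', hxy'⟩ := hτ i
  rw [isNthPropMax_iff hw] at hx hx'
  rw [isNthPropMax_iff hr] at hy hy'
  subst hx hx' hy hy'
  have h := (stack _ _).trans hxy ((stack _ _).symm hxy')
  rw [stack_permDiagram_left] at h
  have hc : ∀ x y, conj (permDiagram k γ) w (Sum.inl x) (Sum.inl y) ↔
      w (Sum.inl (γ.symm x)) (Sum.inl (γ.symm y)) := by
    intro x y
    rw [conj_permDiagram]
    rfl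
  exact (propMax_rel_iff hr).1 ((hc _ _).2 h)

/-- The symmetric diagram of the product appears as a variable `w'` so that any other expression for
it, such as a conjugate, can be substituted without rewriting inside `glue`. -/
theorem comp_glue_eq {A : Family} {w : Diagram k} (h : rank w = m) (d : Diagram k)
    (hr : m ≤ rank (comp d (glue A w h 1))) :
    ∀ w', symDiagram (comp d (glue A w h 1)) = w' → ∀ h' : rank w' = m,
      ∃ σ, comp d (glue A w h 1) = glue A w' h' σ := by
  rintro _ rfl h'
  have hb : IsBot A m (comp d (glue A w h 1)) := isBot_glue.comp (h ▸ rank_le w) d hr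
  obtain ⟨σ, hσ⟩ := hb.exists_glue_eq h'
  exact ⟨σ, hσ.symm⟩

/-- This is $(\gamma t_w)(\gamma t_w)^T=\gamma\,(t_wt_w^T)\,\gamma^T$, where $t_wt_w^T=w$. -/
theorem symDiagram_permDiagram_comp_glue {A : Family} {w : Diagram k}
    (hw : IsSymmetricDiagram m w) (γ : Equiv.Perm (Fin k)) :
    symDiagram (comp (permDiagram k γ) (glue A w hw.2.1 1)) = conj (permDiagram k γ) w := by
  refine (hw.conj γ).symDiagram_eq (fun x y => ?_) fun x => ?_
  · rw [comp_permDiagram_left, conj_permDiagram]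
    exact glue_inl_inl
  · rw [comp_permDiagram_left, isProp_conj_permDiagram]
    exact isProp_glue (A := A) (h := hw.2.1) (σ := 1)

theorem isTwist_of_comp_glue_eq {A : Family} {w : Diagram k}
    (hw : IsSymmetricDiagram m w) {γ : Equiv.Perm (Fin k)} {σ : Equiv.Perm (Fin m)}
    (h : comp (permDiagram k γ) (glue A w hw.2.1 1) =
      glue A (conj (permDiagram k γ) w) (hw.conj γ).2.1 σ) : IsTwist (permDiagram k γ) w σ := by
  intro i
  refine ⟨propMax w hw.2.1 i, propMax _ (hw.conj γ).2.1 (σ i), (isNthPropMax_iff hw.2.1).2 rfl,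
    (isNthPropMax_iff (hw.conj γ).2.1).2 rfl, ?_⟩
  have h1 := glue_propMax (A := A) (h := (hw.conj γ).2.1) (σ := σ) i
    (Fin.castLE (hw.2.1 ▸ rank_le w) i) rfl
  rw [← h, comp_permDiagram_left] at h1
  obtain ⟨_, h2⟩ := glue_inl_inr.1 h1
  rw [stack_permDiagram_left]
  exact h2

/-! ### The half-diagram basis modulo low rank -/

theorem pow_loops_ne_zero {n : ℂ} (hn : n ≠ 0 ∨ k = 0) (d₁ d₂ : Diagram k) :
    n ^ loops d₁ d₂ ≠ 0 := by
  rcases hn with hn | rfl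
  · exact pow_ne_zero _ hn
  · rw [loops_eq_zero fun x => x.elim0, pow_zero]
    exact one_ne_zero

open Classical in
theorem Family.pow_idem_ne_zero (A : Family) {n : ℂ} (hn : n ≠ 0 ∨ k = 0) (m : ℕ) :
    n ^ (if A.Parity then (k - m) / 2 else k - m) ≠ 0 := by
  rcases hn with hn | rfl
  · exact pow_ne_zero _ hn
  · simp

/-- The symmetric `m`-diagrams of the family `A`. -/
abbrev Family.SymDiagrams (A : Family) (k m : ℕ) : Type :=
  {w : Diagram k // w ∈ A.diagrams k ∧ IsSymmetricDiagram m w}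

/-- The element of `P_k(n)` given by the top half of `w` and the bottom half of `e_m`. -/
noncomputable def Family.halfBasis (A : Family) (n : ℂ) (w : A.SymDiagrams k m) :
    PartitionAlgebra k n :=
  PartitionAlgebra.basis k n (glue A w.1 w.2.2.2.1 1)

/-- Permutations of `{1, …, m}` as elements of `P_k(n)`. -/
noncomputable def permHom (n : ℂ) (hm : m ≤ k) :
    Equiv.Perm (Fin m) →* PartitionAlgebra k n where
  toFun σ := PartitionAlgebra.basis k n (permDiagram k (extPerm hm σ))
  map_one' := by rw [map_one, permDiagram_one, PartitionAlgebra.one_def]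
  map_mul' σ τ := by
    rw [PartitionAlgebra.basis_mul_basis, loops_permDiagram_left, pow_zero, one_smul,
      comp_permDiagram_permDiagram, map_mul]

variable {G : Type*} [Group G]

/-- The homomorphism from a group algebra to `P_k(n)` given by a permutation representation. -/
noncomputable def groupAlgHom (n : ℂ) (hm : m ≤ k) (φ : G →* Equiv.Perm (Fin m)) :
    MonoidAlgebra ℂ G →ₐ[ℂ] PartitionAlgebra k n :=
  MonoidAlgebra.lift ℂ _ _ ((permHom n hm).comp φ)

theorem groupAlgHom_single (n : ℂ) (hm : m ≤ k) (φ : G →* Equiv.Perm (Fin m)) (g : G) (r : ℂ) :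
    groupAlgHom n hm φ (MonoidAlgebra.single g r) =
      r • PartitionAlgebra.basis k n (permDiagram k (extPerm hm (φ g))) := by
  unfold groupAlgHom
  rw [MonoidAlgebra.lift_single]
  rfl

theorem Family.halfBasis_mul (A : Family) (n : ℂ) (hm : m ≤ k) (φ : G →* Equiv.Perm (Fin m))
    (w : A.SymDiagrams k m) (g : G) (r : ℂ) :
    A.halfBasis n w * groupAlgHom n hm φ (MonoidAlgebra.single g r) =
      r • PartitionAlgebra.basis k n (glue A w.1 w.2.2.2.1 (φ g)) := by
  rw [groupAlgHom_single, mul_smul_comm, Family.halfBasis, PartitionAlgebra.basis_mul_basis,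
    loops_permDiagram_right, pow_zero, one_smul, permDiagram_extPerm, glue_comp_permDiagram,
    one_mul]

/-- By `rank_comp_le`, diagrams of rank less than `m` span a left ideal of the whole partition
algebra. It contains $\mathbf J_{m-1}$ and has no coefficient at a diagram of larger rank. -/
theorem Family.lowRank_le (A : Family) (n : ℂ) {x : PartitionAlgebra k n}
    (hx : x ∈ A.lowRank k n m) {d : Diagram k} (hd : m ≤ rank d) :
    (PartitionAlgebra.basis k n).repr x d = 0 := by
  set b := PartitionAlgebra.basis k n with hb
  set L : Submodule ℂ (PartitionAlgebra k n) := Submodule.span ℂ (b '' {d | rank d < m}) with hL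
  have hstable : ∀ y : PartitionAlgebra k n, ∀ x ∈ L, y * x ∈ L := by
    intro y x hx
    induction hx using Submodule.span_induction with
    | mem x hx =>
      obtain ⟨d, hd, rfl⟩ := hx
      have hy : y ∈ Submodule.span ℂ (Set.range b) := b.mem_span y
      induction hy using Submodule.span_induction with
      | mem y hy =>
        obtain ⟨a, rfl⟩ := hy
        rw [hb, PartitionAlgebra.basis_mul_basis]
        exact L.smul_mem _ (Submodule.subset_span
          ⟨_, (rank_comp_le a d).trans_lt hd, rfl⟩)
      | zero => rw [zero_mul]; exact L.zero_mem
      | add y y' _ _ h h' => rw [add_mul]; exact L.add_mem h h'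
      | smul c y _ h => rw [smul_mul_assoc]; exact L.smul_mem c h
    | zero => rw [mul_zero]; exact L.zero_mem
    | add x x' _ _ h h' => rw [mul_add]; exact L.add_mem h h'
    | smul c x _ h => rw [mul_smul_comm]; exact L.smul_mem c h
  have hxL : x ∈ L := by
    unfold Family.lowRank at hx
    induction hx using Submodule.span_induction with
    | mem x hx =>
      obtain ⟨d, hd, rfl⟩ := hx
      exact Submodule.subset_span ⟨d, hd.2, rfl⟩
    | zero => exact L.zero_mem
    | add x x' _ _ h h' => exact L.add_mem h h'
    | smul a x _ h => exact hstable a.1 x h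
  rw [hL, Module.Basis.mem_span_image] at hxL
  by_contra hne
  exact (not_lt.2 hd) (hxL (Finsupp.mem_support_iff.2 hne))

theorem Family.lowRank_smul_mem (A : Family) (n c : ℂ) {x : PartitionAlgebra k n}
    (hx : x ∈ A.lowRank k n m) : c • x ∈ A.lowRank k n m := by
  have := (A.lowRank k n m).smul_mem (algebraMap ℂ (A.algebra k n) c) hx
  rwa [algebraMap_smul] at this

theorem Family.lowRank_mul_mem (A : Family) (n : ℂ) (hm : m ≤ k) (φ : G →* Equiv.Perm (Fin m))
    (hφ : ∀ d ∈ A.diagrams k, ∀ g, comp d (permDiagram k (extPerm hm (φ g))) ∈ A.diagrams k)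
    {x : PartitionAlgebra k n} (hx : x ∈ A.lowRank k n m) (g : MonoidAlgebra ℂ G) :
    x * groupAlgHom n hm φ g ∈ A.lowRank k n m := by
  induction g using MonoidAlgebra.induction_linear with
  | zero => rw [map_zero, mul_zero]; exact Submodule.zero_mem _
  | add f g hf hg => rw [map_add, mul_add]; exact Submodule.add_mem _ hf hg
  | single g r =>
    rw [groupAlgHom_single, mul_smul_comm]
    refine A.lowRank_smul_mem n r ?_
    unfold Family.lowRank at hx ⊢
    induction hx using Submodule.span_induction with
    | mem x hx =>
      obtain ⟨d, hd, rfl⟩ := hx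
      rw [PartitionAlgebra.basis_mul_basis, loops_permDiagram_right, pow_zero, one_smul]
      refine Submodule.subset_span ⟨_, ⟨hφ d hd.1 g, ?_⟩, rfl⟩
      rw [rank_comp_permDiagram_right]
      exact hd.2
    | zero => rw [zero_mul]; exact Submodule.zero_mem _
    | add x x' _ _ h h' => rw [add_mul]; exact Submodule.add_mem _ h h'
    | smul a x _ h =>
      change (a : PartitionAlgebra k n) * x * _ ∈ _
      rw [mul_assoc]
      exact Submodule.smul_mem _ a h

theorem Family.commute_idem (A : Family) (n : ℂ) (hm : m ≤ k) (φ : G →* Equiv.Perm (Fin m))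
    (g : MonoidAlgebra ℂ G) : Commute (groupAlgHom n hm φ g) (A.idem k n m) := by
  induction g using MonoidAlgebra.induction_linear with
  | zero => rw [map_zero]; exact Commute.zero_left _
  | add f g hf hg => rw [map_add]; exact hf.add_left hg
  | single g r =>
    rw [groupAlgHom_single]
    refine Commute.smul_left ?_ r
    unfold Family.idem
    refine Commute.smul_right ?_ _
    change _ * _ = _ * _
    rw [PartitionAlgebra.basis_mul_basis, PartitionAlgebra.basis_mul_basis,
      loops_permDiagram_left, loops_permDiagram_right, A.permDiagram_comp_idemDiagram]

/-- The products $t_wg$ are distinct basis diagrams of rank `m`, so the coefficients of a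
combination of them can be read off. With `Family.lowRank_le` this gives independence modulo
$\mathbf J_{m-1}$. -/
theorem Family.repr_halfBasis_mul (A : Family) (n : ℂ) (hm : m ≤ k)
    {φ : G →* Equiv.Perm (Fin m)} (hφ : Function.Injective φ) (w w₀ : A.SymDiagrams k m)
    (x : MonoidAlgebra ℂ G) (g : G) [Decidable (w = w₀)] :
    (PartitionAlgebra.basis k n).repr (A.halfBasis n w * groupAlgHom n hm φ x)
      (glue A w₀.1 w₀.2.2.2.1 (φ g)) = if w = w₀ then x.coeff g else 0 := by
  classical
  induction x using MonoidAlgebra.induction_linear with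
  | zero => simp
  | add f f' hf hf' =>
    rw [map_add, mul_add, map_add, Finsupp.add_apply, hf, hf']
    split_ifs <;> simp
  | single g' r =>
    rw [A.halfBasis_mul, map_smul, Finsupp.smul_apply, Module.Basis.repr_self,
      Finsupp.single_apply]
    by_cases hw : w = w₀
    · subst hw
      rw [if_pos rfl, MonoidAlgebra.coeff_single, Finsupp.single_apply]
      by_cases hg : g' = g
      · subst hg
        simp
      · rw [if_neg hg, if_neg, smul_zero]
        intro h
        exact hg (hφ (glue_injective w.2.2 w.2.2 h).2)
    · rw [if_neg hw, if_neg, smul_zero]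
      intro h
      exact hw (Subtype.ext (glue_injective w.2.2 w₀.2.2 h).1)

/-- The irreducible module as the module induced from a left ideal of the group algebra. -/
theorem Family.moduleChar_irrModule (A : Family) {n : ℂ} (hn : n ≠ 0 ∨ k = 0) (hm : m ≤ k)
    (hk : A.Parity → Even (k - m)) [Finite G] {φ : G →* Equiv.Perm (Fin m)}
    (hφ : Function.Injective φ) (hplanar : ∀ g, A.Planar → φ g = 1)
    (hrange : ∀ (w : A.SymDiagrams k m) (σ : Equiv.Perm (Fin m)),
      glue A w.1 w.2.2.2.1 σ ∈ A.diagrams k → ∃ g, φ g = σ)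
    (hcomp : ∀ d ∈ A.diagrams k, ∀ g, comp d (permDiagram k (extPerm hm (φ g))) ∈ A.diagrams k)
    (μ : m.Partition) (p : MonoidAlgebra ℂ G)
    (hp : A.primIdem k n μ = groupAlgHom n hm φ p * A.idem k n m)
    (γ : Equiv.Perm (Fin k)) (hγ : permDiagram k γ ∈ A.diagrams k)
    [Fintype (A.SymDiagrams k m)] [DecidableEq (Diagram k)] :
    ∃ τ : A.SymDiagrams k m → G, (∀ w, IsTwist (permDiagram k γ) w.1 (φ (τ w))) ∧
      moduleChar (A.algebra k n) (A.irrModule k n μ) (A.diag k n (permDiagram k γ) hγ) =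
        ∑ w : A.SymDiagrams k m, if conj (permDiagram k γ) w.1 = w.1 then
          moduleChar (MonoidAlgebra ℂ G) (Submodule.span (MonoidAlgebra ℂ G) {p})
            (MonoidAlgebra.single (τ w) 1) else 0 := by
  classical
  have hglue : ∀ (w : A.SymDiagrams k m) (g : G), glue A w.1 w.2.2.2.1 (φ g) ∈ A.diagrams k :=
    fun w g => Family.glue_mem hk w.2.2 w.2.1 (hplanar g)
  have hglue1 : ∀ w : A.SymDiagrams k m, glue A w.1 w.2.2.2.1 1 ∈ A.diagrams k :=
    fun w => Family.glue_mem hk w.2.2 w.2.1 fun _ => rfl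
  have hsymm : ∀ d ∈ A.diagrams k, rank d = m → symDiagram d ∈ A.diagrams k ∧
      IsSymmetricDiagram m (symDiagram d) := by
    rintro d hd rfl
    exact ⟨Family.comp_mem hd (Family.transpose_mem hd), isSymmetricDiagram_symDiagram d⟩
  have hact : ∀ w : A.SymDiagrams k m, conj (permDiagram k γ) w.1 ∈ A.diagrams k := by
    intro w
    rw [← symDiagram_permDiagram_comp_glue (A := A) w.2.2]
    refine (hsymm _ (Family.comp_mem hγ (hglue1 w)) ?_).1
    rw [rank_comp_permDiagram_left, rank_glue]
  have hτ : ∀ w : A.SymDiagrams k m, ∃ g : G,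
      comp (permDiagram k γ) (glue A w.1 w.2.2.2.1 1) =
        glue A (conj (permDiagram k γ) w.1) (w.2.2.conj γ).2.1 (φ g) := by
    intro w
    obtain ⟨σ, hσ⟩ := comp_glue_eq w.2.2.2.1 (permDiagram k γ)
      (by rw [rank_comp_permDiagram_left, rank_glue]) _
      (symDiagram_permDiagram_comp_glue (A := A) w.2.2 γ) (w.2.2.conj γ).2.1
    obtain ⟨g, rfl⟩ := hrange ⟨_, hact w, w.2.2.conj γ⟩ σ (hσ ▸ Family.comp_mem hγ (hglue1 w))
    exact ⟨g, hσ⟩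
  choose τ hτ using hτ
  refine ⟨τ, fun w => isTwist_of_comp_glue_eq w.2.2 (hτ w), ?_⟩
  have hV := mem_map_span_iff (J := A.lowRank k n m) (t := A.halfBasis (k := k) (m := m) n)
    (ι := groupAlgHom n hm φ) (B := A.algebra k n)
    (S := PartitionAlgebra.basis k n '' A.diagrams k) rfl (A.idem k n m) hp
    (A.commute_idem n hm φ) ?_ (fun x hx g => A.lowRank_mul_mem n hm φ hcomp hx g) ?_ ?_ ?_
  · refine (moduleChar_eq_sum_fixed hV ?_ _ (fun w => ⟨_, hact w, w.2.2.conj γ⟩) τ ?_).trans ?_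
    · intro x hx
      funext w
      refine MonoidAlgebra.ext (Finsupp.ext fun g => ?_)
      have h := A.lowRank_le n hx (d := glue A w.1 w.2.2.2.1 (φ g)) rank_glue.ge
      rw [map_sum, Finsupp.finsetSum_apply] at h
      simp only [A.repr_halfBasis_mul n hm hφ] at h
      rw [Finset.sum_ite_eq' Finset.univ w, if_pos (Finset.mem_univ _)] at h
      exact h
    · intro w
      rw [A.halfBasis_mul, one_smul]
      change PartitionAlgebra.basis k n (permDiagram k γ) * _ = _
      rw [Family.halfBasis, PartitionAlgebra.basis_mul_basis, loops_permDiagram_left, pow_zero,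
        one_smul, hτ w]
    · refine Finset.sum_congr rfl fun w _ => ?_
      simp only [Subtype.ext_iff]
  · rintro _ ⟨d, hd, rfl⟩ w
    have hmem := Family.comp_mem hd (hglue1 w)
    have hmul : PartitionAlgebra.basis k n d * A.halfBasis n w =
        n ^ loops d (glue A w.1 w.2.2.2.1 1) •
          PartitionAlgebra.basis k n (comp d (glue A w.1 w.2.2.2.1 1)) :=
      PartitionAlgebra.basis_mul_basis _ _
    rw [hmul]
    -- The product falls into $\mathbf J_{m-1}$, or it keeps rank `m` and factors again as a
    -- half-diagram times a group element.
    by_cases hr : rank (comp d (glue A w.1 w.2.2.2.1 1)) < m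
    · refine ⟨0, w, 0, ?_⟩
      rw [zero_smul, sub_zero]
      exact A.lowRank_smul_mem n _ (Submodule.subset_span ⟨_, ⟨hmem, hr⟩, rfl⟩)
    · have hr' := (isBot_glue.comp hm d (not_lt.1 hr)).rank_eq hm
      obtain ⟨h1, h2⟩ := hsymm _ hmem hr'
      obtain ⟨σ, hσ⟩ := comp_glue_eq w.2.2.2.1 d (not_lt.1 hr) _ rfl h2.2.1
      obtain ⟨g, rfl⟩ := hrange ⟨_, h1, h2⟩ σ (by rw [← hσ]; exact hmem)
      refine ⟨n ^ loops d (glue A w.1 w.2.2.2.1 1), ⟨_, h1, h2⟩, MonoidAlgebra.single g 1, ?_⟩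
      rw [A.halfBasis_mul, one_smul, ← hσ, sub_self]
      exact Submodule.zero_mem _
  · intro w g
    rw [A.halfBasis_mul, one_smul]
    exact Algebra.subset_adjoin (Set.mem_image_of_mem _ (hglue w g))
  · intro w g
    rw [A.halfBasis_mul, one_smul]
    unfold Family.idem
    rw [mul_smul_comm, PartitionAlgebra.basis_mul_basis, isBot_glue.comp_idemDiagram, smul_smul]
    -- Only the nonvanishing of the scalar matters, so the removed components need not be counted.
    exact ⟨_, mul_ne_zero (inv_ne_zero (A.pow_idem_ne_zero hn m)) (pow_loops_ne_zero hn _ _), rfl⟩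
  · have hb := isBot_idemDiagram A k m
    have hmem : A.idemDiagram k m ∈ A.diagrams k := Family.idemDiagram_mem hk
    obtain ⟨h1, h2⟩ := hsymm _ hmem (hb.rank_eq hm)
    obtain ⟨σ, hσ⟩ := hb.exists_glue_eq h2.2.1
    obtain ⟨g, rfl⟩ := hrange ⟨_, h1, h2⟩ σ (by rw [hσ]; exact hmem)
    refine ⟨(n ^ (if A.Parity then (k - m) / 2 else k - m))⁻¹, ⟨_, h1, h2⟩,
      MonoidAlgebra.single g 1, ?_⟩
    rw [A.halfBasis_mul, one_smul, hσ]
    rfl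

/-! ### From the induced module to the character formula -/

theorem map_youngSymmetrizer (μ : m.Partition) {U V : Type*} [AddCommGroup U] [Module ℂ U]
    [AddCommGroup V] [Module ℂ V] (F : U →ₗ[ℂ] V) (f : Equiv.Perm (Fin m) → U) :
    F (youngSymmetrizer μ f) = youngSymmetrizer μ fun σ => F (f σ) := by
  simp only [youngSymmetrizer, map_sum, map_smul]

theorem moduleChar_span_one :
    moduleChar (MonoidAlgebra ℂ Unit) (Submodule.span (MonoidAlgebra ℂ Unit) {(1 : MonoidAlgebra ℂ Unit)})
      (MonoidAlgebra.single () 1) = 1 := by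
  have hone : (MonoidAlgebra.single () 1 : MonoidAlgebra ℂ Unit) = 1 := rfl
  have hone_mem : (1 : MonoidAlgebra ℂ Unit) ∈
      Submodule.span (MonoidAlgebra ℂ Unit) {(1 : MonoidAlgebra ℂ Unit)} :=
    Submodule.mem_span_singleton_self _
  have hrank : Module.finrank ℂ (Submodule.span (MonoidAlgebra ℂ Unit)
      {(1 : MonoidAlgebra ℂ Unit)}) = 1 := by
    refine finrank_eq_one ⟨1, hone_mem⟩ (fun h => one_ne_zero (congrArg Subtype.val h)) ?_
    rintro ⟨w, hw⟩
    refine ⟨w.coeff (), Subtype.ext ?_⟩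
    change w.coeff () • (1 : MonoidAlgebra ℂ Unit) = w
    refine MonoidAlgebra.ext (Finsupp.ext fun u => ?_)
    rw [← hone]
    simp
  unfold moduleChar
  rw [hone, map_one, LinearMap.trace_one, hrank, Nat.cast_one]

/-- The irreducible characters of the diagram algebras at permutations, as sums over the symmetric
diagrams fixed under conjugation. -/
theorem Family.irrChar_eq_sum_fixed (A : Family) {n : ℂ} (hn : n ≠ 0 ∨ k = 0) (hm : m ≤ k)
    (hk : A.Parity → Even (k - m)) (μ : m.Partition)
    (hμ : A.Planar → μ = Nat.Partition.indiscrete m)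
    (γ : Equiv.Perm (Fin k)) (hγ : permDiagram k γ ∈ A.diagrams k)
    [Fintype (A.SymDiagrams k m)] [DecidableEq (Diagram k)] :
    ∃ τ : A.SymDiagrams k m → Equiv.Perm (Fin m),
      (∀ w, IsTwist (permDiagram k γ) w.1 (τ w)) ∧
      moduleChar (A.algebra k n) (A.irrModule k n μ) (A.diag k n (permDiagram k γ) hγ) =
        ∑ w : A.SymDiagrams k m, if conj (permDiagram k γ) w.1 = w.1 then symChar μ (τ w)
          else 0 := by
  by_cases hA : A.Planar
  -- Planar diagrams allow no nontrivial twist, so the group is trivial and its symmetrizer is `1`.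
  · obtain ⟨τ, hτ, h⟩ := A.moduleChar_irrModule hn hm hk (G := Unit) (φ := 1)
      (fun _ _ _ => rfl) (fun _ _ => rfl)
      (fun w σ hmem => ⟨(), (Family.eq_one_of_glue_mem hA hmem).symm⟩)
      (fun d hd g => by
        rw [MonoidHom.one_apply, map_one, permDiagram_one, (comp_id_loops d).1]
        exact hd) μ 1
      (by rw [map_one, one_mul, Family.primIdem, if_pos hA]) γ hγ
    refine ⟨fun w => 1, hτ, h.trans (Finset.sum_congr rfl fun w _ => ?_)⟩
    rw [moduleChar_span_one, hμ hA, symChar_indiscrete]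
  · obtain ⟨τ, hτ, h⟩ := A.moduleChar_irrModule hn hm hk (G := Equiv.Perm (Fin m))
      (φ := MonoidHom.id _) (fun _ _ h => h) (fun _ h => absurd h hA) (fun w σ _ => ⟨σ, rfl⟩)
      (fun d hd g => Family.comp_mem hd (Family.permDiagram_mem hA _)) μ
      (youngSymmetrizer μ fun σ => MonoidAlgebra.single σ 1)
      (by
        rw [Family.primIdem, if_neg hA]
        congr 1
        refine Eq.trans ?_ (map_youngSymmetrizer μ (groupAlgHom n hm _).toLinearMap _).symm
        congr 1
        funext σ
        change _ = groupAlgHom n hm _ _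
        rw [groupAlgHom_single, one_smul, permDiagram_extPerm]
        rfl) γ hγ
    exact ⟨τ, hτ, h⟩

theorem Family.irrChar_gamma (A : Family) (k n : ℕ) (hn : 2 * k ≤ n) (lam : n.Partition)
    (hlam : lam ∈ A.index k n) (κ : k.Partition)
    (hκ : permDiagram k (gamma κ) ∈ A.diagrams k) :
    A.irrChar k n lam (A.diag k n (permDiagram k (gamma κ)) hκ) =
      ∑ μ : (starSize lam).Partition, (A.coeff μ κ : ℂ) * symChar (star lam) (gamma μ) := by
  classical
  obtain ⟨hm, hk, hplanar⟩ := hlam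
  -- The bound `2 * k ≤ n` ensures that the loop parameter is invertible unless `k = 0`, where no
  -- component can be removed.
  have hn' : (n : ℂ) ≠ 0 ∨ k = 0 := by
    rcases Nat.eq_zero_or_pos k with h | h
    · exact Or.inr h
    · exact Or.inl (Nat.cast_ne_zero.2 (by omega))
  have : Fintype (A.SymDiagrams k (starSize lam)) := Fintype.ofFinite _
  obtain ⟨τ, hτ, h⟩ := A.irrChar_eq_sum_fixed hn' hm hk (star lam) hplanar (gamma κ) hκ
  refine h.trans ?_
  have hcoeff : ∀ μ : (starSize lam).Partition, (A.coeff μ κ : ℂ) =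
      ∑ w : A.SymDiagrams k (starSize lam),
        if conj (permDiagram k (gamma κ)) w.1 = w.1 ∧ HasCycleType (τ w) μ then 1 else 0 := by
    intro μ
    rw [Finset.sum_boole, Nat.cast_inj]
    unfold Family.coeff
    rw [← Set.ncard_coe_finset, ← Set.ncard_image_of_injective _ Subtype.val_injective]
    congr 1
    ext w
    constructor
    · rintro ⟨hwA, hw, hfix, σ, hσ, hct⟩
      refine ⟨⟨w, hwA, hw⟩, ?_, rfl⟩
      rw [Finset.mem_coe, Finset.mem_filter_univ]
      refine ⟨hfix, ?_⟩
      rw [(hτ ⟨w, hwA, hw⟩).eq hw.2.1 hσ]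
      exact hct
    · rintro ⟨w, hw, rfl⟩
      rw [Finset.mem_coe, Finset.mem_filter_univ] at hw
      exact ⟨w.2.1, w.2.2, hw.1, τ w, hτ w, hw.2⟩
  simp only [hcoeff, Finset.sum_mul]
  rw [Finset.sum_comm]
  refine Finset.sum_congr rfl fun w _ => ?_
  split_ifs with hfix
  -- The cycle type of the twist is the only `μ` to which the fixed diagram `w` contributes.
  · let ν : (starSize lam).Partition :=
      ⟨(τ w).partition.parts, (τ w).partition.parts_pos,
        (τ w).partition.parts_sum.trans (Fintype.card_fin _)⟩
    rw [Finset.sum_eq_single ν]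
    · rw [if_pos ⟨hfix, rfl⟩, one_mul, symChar_gamma _ ν rfl]
    · intro μ _ hμ
      rw [if_neg, zero_mul]
      rintro ⟨-, h⟩
      exact hμ (Nat.Partition.ext h.symm)
    · simp
  · refine (Finset.sum_eq_zero fun μ _ => ?_).symm
    rw [if_neg fun h => hfix h.1, zero_mul]

end Irreducible

end DiagAlg

theorem mainTheorem7 (A : DiagAlg.Family) (k n : ℕ) (hn : 2 * k ≤ n)
    (lam : n.Partition) (hlam : lam ∈ A.index k n)
    (κ : k.Partition) (hκ : DiagAlg.permDiagram k (DiagAlg.gamma κ) ∈ A.diagrams k) :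
    A.irrChar k n lam (A.diag k n (DiagAlg.permDiagram k (DiagAlg.gamma κ)) hκ) =
      ∑ μ : (DiagAlg.starSize lam).Partition,
        (A.coeff μ κ : ℂ) * DiagAlg.symChar (DiagAlg.star lam) (DiagAlg.gamma μ) :=
  DiagAlg.Family.irrChar_gamma A k n hn lam hlam κ hκ
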